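/- There is a single deterministic multi-pass streaming algorithm with the following property. Let $G$ be any simple graph on the vertex set $\{0,\dots,n-1\}$ with maximum degree $\Delta$. The algorithm is given $n$ (but not $\Delta$) and a stream that lists each edge of $G$ exactly once, in an arbitrary (adversarial) order and with the two endpoints of each edge in arbitrary order; it may read this same stream several times, each pass going through it one way from its beginning. The algorithm always halts and outputs a proper coloring of $G$ with colors from a palette of $\Delta+1$ colors. It uses $O(n\log^2 n)$ bits of space (the stored output included), makes $O(\log\Delta\cdot\log\log\Delta)$ passes over the stream, and runs in time polynomial in $n$. Here $\log$ is the base-$2$ logarithm, and where $n\le 1$ or $\Delta\le 2$, so that the respective expression vanishes or is undefined, the corresponding bound is to be read as $O(1)$. The algorithm is one fixed program for all $n$ and $G$, and the implied constants and the polynomial are absolute. The underlying machine is a random access machine over the natural numbers with addition, truncated subtraction, multiplication, division and remainder; its time is charged by the logarithmic cost criterion (an operation costs the binary lengths of the numbers involved), and its space at any moment is the sum of the binary lengths of the addresses and contents of all nonzero memory cells and of the temporary values being computed. -/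

import Mathlib

/-! A uniform deterministic multi-pass streaming machine: a random access machine with finitely many
named arrays of natural numbers, programmed in a structured language, with one-way read access to an
input stream that can only be restarted from its beginning. Time is charged by the logarithmic
cost criterion and space is counted in bits. -/

namespace Streaming

/-- Memory contents: `m (k, i)` is the value of cell `i` of array `k`. Only finitely many cells are
nonzero; a cell that holds `0` is regarded as free. -/
abbrev Mem : Type := ℕ × ℕ →₀ ℕ

/-- The number of bits that the memory occupies: for every nonzero cell, the binary lengths of the
two parts of its address and of its value. -/
noncomputable def Mem.bits (m : Mem) : ℕ :=
  m.sum fun a v => Nat.size a.1 + Nat.size a.2 + Nat.size v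

/-- Arithmetic expressions; `get k e` reads the cell of array `k` whose index is the value of `e`. -/
inductive Expr : Type
  | const (c : ℕ)
  | get (k : ℕ) (e : Expr)
  | add (a b : Expr)
  | sub (a b : Expr)
  | mul (a b : Expr)
  | div (a b : Expr)
  | mod (a b : Expr)

/-- The value of an expression: subtraction is truncated at `0`, and `div` and `mod` are the
quotient and the remainder, with `x / 0 = 0` and `x % 0 = x`. -/
def Expr.eval (m : Mem) : Expr → ℕ
  | .const c => c
  | .get k e => m (k, e.eval m)
  | .add a b => a.eval m + b.eval m
  | .sub a b => a.eval m - b.eval m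
  | .mul a b => a.eval m * b.eval m
  | .div a b => a.eval m / b.eval m
  | .mod a b => a.eval m % b.eval m

/-- The cost of evaluating an expression: every node contributes `1` plus the binary length of its
value. It bounds both the number of elementary steps (up to a polynomial) and the number of bits
of the intermediate results. -/
def Expr.cost (m : Mem) : Expr → ℕ
  | .const c => 1 + Nat.size c
  | .get k e => 1 + Nat.size ((Expr.get k e).eval m) + e.cost m
  | .add a b => 1 + Nat.size ((Expr.add a b).eval m) + a.cost m + b.cost m
  | .sub a b => 1 + Nat.size ((Expr.sub a b).eval m) + a.cost m + b.cost m
  | .mul a b => 1 + Nat.size ((Expr.mul a b).eval m) + a.cost m + b.cost m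
  | .div a b => 1 + Nat.size ((Expr.div a b).eval m) + a.cost m + b.cost m
  | .mod a b => 1 + Nat.size ((Expr.mod a b).eval m) + a.cost m + b.cost m

/-- Programs. -/
inductive Cmd : Type
  /-- do nothing -/
  | skip
  /-- store the value of `e` in the cell of array `k` whose index is the value of `i` -/
  | set (k : ℕ) (i e : Expr)
  /-- begin a new pass over the input stream -/
  | rewind
  /-- read the next token of the current pass into array `k` -/
  | next (k : ℕ)
  /-- sequential composition -/
  | seq (p q : Cmd)
  /-- run `p` if the value of `e` is nonzero, and `q` otherwise -/
  | cond (e : Expr) (p q : Cmd)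
  /-- repeat `p` as long as the value of `e` is nonzero -/
  | loop (e : Expr) (p : Cmd)

/-- A configuration: the memory and the part of the stream that the current pass has not read yet,
together with the resources used so far (which the program cannot access). -/
structure State : Type where
  /-- the memory -/
  mem : Mem
  /-- the tokens of the current pass that are still unread -/
  rest : List (ℕ × ℕ)
  /-- the number of passes begun so far -/
  passes : ℕ
  /-- the time used so far -/
  time : ℕ
  /-- the largest number of bits in use at any moment so far -/
  peak : ℕ

/-- Spend `c` time units, with `c` bits of temporary storage on top of the memory. -/
noncomputable def State.charge (s : State) (c : ℕ) : State :=
  { s with time := s.time + c, peak := max s.peak (s.mem.bits + c) }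

/-- Write the value `v` into cell `i` of array `k`. -/
noncomputable def State.write (s : State) (k i v : ℕ) : State :=
  { s with mem := s.mem.update (k, i) v,
           peak := max s.peak (Mem.bits (s.mem.update (k, i) v)) }

/-- Read the next token `(u, v)` of the current pass, if there is one: cells `0`, `1`, `2` of array
`k` receive `1`, `u`, `v`. At the end of the pass cell `0` receives `0`. -/
noncomputable def State.next (s : State) (k : ℕ) : State :=
  match s.rest with
  | [] => (s.charge 1).write k 0 0
  | t :: ts =>
      let s' := s.charge (1 + Nat.size t.1 + Nat.size t.2)
      { (((s'.write k 0 1).write k 1 t.1).write k 2 t.2) with rest := ts }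

/-- `Exec input p s t`: on the stream `input`, the program `p` started in configuration `s` halts
in configuration `t`. -/
inductive Exec (input : List (ℕ × ℕ)) : Cmd → State → State → Prop
  | skip (s : State) : Exec input .skip s (s.charge 1)
  | set (k : ℕ) (i e : Expr) (s : State) :
      Exec input (.set k i e) s
        ((s.charge (1 + i.cost s.mem + e.cost s.mem)).write k (i.eval s.mem) (e.eval s.mem))
  | rewind (s : State) :
      Exec input .rewind s { s.charge 1 with rest := input, passes := s.passes + 1 }
  | next (k : ℕ) (s : State) : Exec input (.next k) s (s.next k)
  | seq {p q : Cmd} {s t u : State} (hp : Exec input p s t) (hq : Exec input q t u) :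
      Exec input (.seq p q) s u
  | cond_true {e : Expr} {p q : Cmd} {s t : State} (he : e.eval s.mem ≠ 0)
      (hp : Exec input p (s.charge (1 + e.cost s.mem)) t) : Exec input (.cond e p q) s t
  | cond_false {e : Expr} {p q : Cmd} {s t : State} (he : e.eval s.mem = 0)
      (hq : Exec input q (s.charge (1 + e.cost s.mem)) t) : Exec input (.cond e p q) s t
  | loop_true {e : Expr} {p : Cmd} {s t u : State} (he : e.eval s.mem ≠ 0)
      (hp : Exec input p (s.charge (1 + e.cost s.mem)) t) (hl : Exec input (.loop e p) t u) :
      Exec input (.loop e p) s u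
  | loop_false {e : Expr} {p : Cmd} {s : State} (he : e.eval s.mem = 0) :
      Exec input (.loop e p) s (s.charge (1 + e.cost s.mem))

/-- The machine is deterministic. -/
theorem Exec.deterministic {input : List (ℕ × ℕ)} {p : Cmd} {s t t' : State}
    (h : Exec input p s t) (h' : Exec input p s t') : t = t' := by
  induction h generalizing t' with
  | skip s => cases h'; rfl
  | set k i e s => cases h'; rfl
  | rewind s => cases h'; rfl
  | next k s => cases h'; rfl
  | seq hp hq ihp ihq =>
    cases h' with
    | seq hp' hq' => cases ihp hp'; exact ihq hq'
  | cond_true he hp ih =>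
    cases h' with
    | cond_true he' hp' => exact ih hp'
    | cond_false he' hq' => exact absurd he' he
  | cond_false he hq ih =>
    cases h' with
    | cond_true he' hp' => exact absurd he he'
    | cond_false he' hq' => exact ih hq'
  | loop_true he hp hl ihp ihl =>
    cases h' with
    | loop_true he' hp' hl' => cases ihp hp'; exact ihl hl'
    | loop_false he' => exact absurd he' he
  | loop_false he =>
    cases h' with
    | loop_true he' hp' hl' => exact absurd he he'
    | loop_false he' => rfl

/-- The initial configuration for an input with `n` vertices: cell `0` of array `0` holds `n`, all
other cells are free, and no pass has begun. -/
noncomputable def State.start (n : ℕ) : State where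
  mem := Finsupp.single (0, 0) n
  rest := []
  passes := 0
  time := 0
  peak := Mem.bits (Finsupp.single (0, 0) n)

/-- `es` lists every edge of `G` exactly once, in any order and with either orientation. -/
def IsEdgeStream {n : ℕ} (G : SimpleGraph (Fin n)) (es : List (Fin n × Fin n)) : Prop :=
  (es.map fun e => s(e.1, e.2)).Nodup ∧
    ∀ u v : Fin n, s(u, v) ∈ es.map (fun e => s(e.1, e.2)) ↔ G.Adj u v

/-- The tokens that the machine reads: the endpoints of the edges, as natural numbers. -/
def tokens {n : ℕ} (es : List (Fin n × Fin n)) : List (ℕ × ℕ) :=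
  es.map fun e => ((e.1 : ℕ), (e.2 : ℕ))

end Streaming

/-! A proper coloring with `Δ + 1` colors is found by the method of Assadi, Chakrabarti, Ghosh and
Stoeckl. The vertices that are still uncolored form a set `U`. In an *epoch*, every vertex of `U`
starts by proposing all colors `0, …, Δ`, and then, in each *stage*, refines its proposal to one of `B`
parts, by fixing the next digit of the color in base `B`. The *slack* of a proposed set at a vertex is
the number of its colors minus the number of neighbors outside `U` whose color lies in it; as long as it
is positive, the set contains a free color. The *potential* is the sum of `1 / slack` over the pairs of
adjacent vertices of `U` that propose the same set. It is at most `|U|` in the beginning, since a vertex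
has fewer neighbors than colors (`Proposal.init`). If every vertex chooses a part with probability
proportional to its slack, independently for any two vertices, then the expected potential does not
grow. Choices by a hash function `x ↦ (a x + b) mod p` have this property (`sum_weight_le`), and the
best `a` and then the best `b` can be determined in one pass each (`score_le_of_argmin`). The division
by slacks and the choice by residues are rounded, but as `p` is of the order `n log Δ`, the errors of all
stages together amount to at most `|U| / 2` (`Proposal.refine`). When the proposed sets are single colors,
the potential counts the conflicts, so that at least a quarter of the proposals can be kept
(`Proposal.card_conflict`, `run_epochProg`).

An epoch with `B = 2 ^ k` has about `log Δ / k` stages of three passes, and needs a table of `|U| B`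
slacks. Since three epochs halve `U`, the branching factor can be doubled after every three epochs while
the table keeps `O(n)` cells (`run_repeat_epochProg`). The numbers of passes then sum up to
`log Δ` times a harmonic sum up to `log Δ`, which is `O(log Δ log log Δ)` (`passes_le`). In the end
`|U| Δ ≤ n`, so that the edges at `U` can be stored, and `U` is colored greedily (`run_greedyProg`).

The algorithm is written in a small language of loop programs, with a semantics in terms of functions,
and compiled to the streaming machine. Compiled programs reduce every index modulo a bound `N` and every
value modulo a bound `V` before writing. Together with the absence of unbounded loops, this makes the
bounds on space and time a matter of syntax (`Limits.adequate`), and the correctness proof shows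
that the reductions never have an effect. The bounds are `N = O(n log Δ)` and `V = (n + 2) ^ 16`; a first
part of the program, which determines `Δ`, does with `N = n + 3`. Hence `O(n log Δ)` cells of `O(log n)`
bits are in use (`peak_le`). -/

namespace Streaming

/-! ### Choosing a refinement by a hash function -/

section

open Finset

/-- The element `j` of `{0, …, B - 1}` whose interval contains `u`, where intervals of the lengths
`T j` are laid out from `0` on in descending order of `j`. -/
noncomputable def pick (T : ℕ → ℕ) (B u : ℕ) : ℕ :=
  sInf {j | ∑ i ∈ Ico (j + 1) B, T i ≤ u}

theorem sum_Ico_pick_le (T : ℕ → ℕ) (B u : ℕ) : ∑ i ∈ Ico (pick T B u + 1) B, T i ≤ u := by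
  have h : (B : ℕ) ∈ {j | ∑ i ∈ Ico (j + 1) B, T i ≤ u} := by simp
  exact Nat.sInf_mem ⟨B, h⟩

theorem lt_sum_Ico_pick {T : ℕ → ℕ} {B u : ℕ} (hu : u < ∑ i ∈ range B, T i) :
    u < ∑ i ∈ Ico (pick T B u) B, T i := by
  rcases Nat.eq_zero_or_pos (pick T B u) with h | h
  · rw [h]; simpa using hu
  · obtain ⟨k, hk⟩ := Nat.exists_eq_succ_of_ne_zero h.ne'
    have : k ∉ {j | ∑ i ∈ Ico (j + 1) B, T i ≤ u} := Nat.notMem_of_lt_sInf (by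
      change k < pick T B u
      omega)
    rw [hk]
    simpa using this

theorem pick_lt {T : ℕ → ℕ} {B u : ℕ} (hu : u < ∑ i ∈ range B, T i) : pick T B u < B := by
  by_contra h
  have := lt_sum_Ico_pick hu
  rw [Ico_eq_empty (by omega)] at this
  simp at this

theorem lt_add_of_pick {T : ℕ → ℕ} {B u : ℕ} (hu : u < ∑ i ∈ range B, T i) :
    u < T (pick T B u) + ∑ i ∈ Ico (pick T B u + 1) B, T i := by
  have := lt_sum_Ico_pick hu
  rwa [sum_eq_sum_Ico_succ_bot (pick_lt hu)] at this

theorem pick_pos {T : ℕ → ℕ} {B u : ℕ} (hu : u < ∑ i ∈ range B, T i) : 0 < T (pick T B u) := by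
  have h1 := lt_add_of_pick hu
  have h2 := sum_Ico_pick_le T B u
  omega

theorem pick_eq {T : ℕ → ℕ} {B u j : ℕ} (h1 : ∑ i ∈ Ico (j + 1) B, T i ≤ u)
    (h2 : ∀ i < j, u < ∑ k ∈ Ico (i + 1) B, T k) : pick T B u = j := by
  refine le_antisymm (Nat.sInf_le h1) ?_
  by_contra h
  have := h2 _ (not_le.1 h)
  have := sum_Ico_pick_le T B u
  omega

/-- A residue modulo the total `∑ T` of a uniform element of `{0, …, p - 1}` selects `j` with
probability at most `T j / ∑ T + T j / p`, up to rounding in favor of this bound. -/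
theorem card_pick_le (T : ℕ → ℕ) (B p j : ℕ) (hS : 0 < ∑ i ∈ range B, T i) :
    #{t ∈ range p | pick T B (t % ∑ i ∈ range B, T i) = j} ≤
      T j * (p / (∑ i ∈ range B, T i) + 1) := by
  set S := ∑ i ∈ range B, T i with hSdef
  have : T j * (p / S + 1) = #(range (T j) ×ˢ range (p / S + 1)) := by simp
  rw [this]
  refine card_le_card_of_injOn (fun t => (t % S - ∑ i ∈ Ico (j + 1) B, T i, t / S)) ?_ ?_
  · intro t ht
    simp only [coe_filter, mem_range, Set.mem_ofPred_eq] at ht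
    have h1 := lt_add_of_pick (u := t % S) (Nat.mod_lt t hS)
    have h2 := sum_Ico_pick_le T B (t % S)
    rw [ht.2] at h1 h2
    have h3 : t / S ≤ p / S := Nat.div_le_div_right ht.1.le
    simp only [coe_product, coe_range, Set.mem_prod, Set.mem_Iio]
    constructor <;> omega
  · intro t ht t' ht' h
    simp only [coe_filter, mem_range, Set.mem_ofPred_eq] at ht ht'
    simp only [Prod.mk.injEq] at h
    have h2 := sum_Ico_pick_le T B (t % S)
    have h2' := sum_Ico_pick_le T B (t' % S)
    rw [ht.2] at h2
    rw [ht'.2] at h2'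
    have : t % S = t' % S := by omega
    rw [← Nat.div_add_mod t S, ← Nat.div_add_mod t' S, this, h.2]

/-- The functions `x ↦ a x + b` modulo a prime are pairwise independent. -/
theorem hash_injOn {p : ℕ} (hp : p.Prime) {x y : ℕ} (hx : x < p) (hy : y < p) (hxy : x ≠ y) :
    Set.InjOn (fun h : ℕ × ℕ => ((h.1 * x + h.2) % p, (h.1 * y + h.2) % p))
      (range p ×ˢ range p : Finset (ℕ × ℕ)) := by
  have := Fact.mk hp
  rintro ⟨a, b⟩ hab ⟨a', b'⟩ hab' h
  simp only [coe_product, coe_range, Set.mem_prod, Set.mem_Iio] at hab hab'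
  simp only [Prod.mk.injEq] at h
  have e1 : (a : ZMod p) * x + b = a' * x + b' := by
    have := (ZMod.natCast_eq_natCast_iff' _ _ p).2 h.1
    push_cast at this
    exact this
  have e2 : (a : ZMod p) * y + b = a' * y + b' := by
    have := (ZMod.natCast_eq_natCast_iff' _ _ p).2 h.2
    push_cast at this
    exact this
  have hne : (x : ZMod p) - y ≠ 0 := by
    intro h0
    have := (ZMod.natCast_eq_natCast_iff' x y p).1 (sub_eq_zero.1 h0)
    rw [Nat.mod_eq_of_lt hx, Nat.mod_eq_of_lt hy] at this
    exact hxy this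
  have e3 : ((a : ZMod p) - a') * (x - y) = 0 := by linear_combination e1 - e2
  have e4 : (a : ZMod p) = a' := sub_eq_zero.1 ((mul_eq_zero.1 e3).resolve_right hne)
  have e5 : (b : ZMod p) = b' := by rw [e4] at e1; exact add_left_cancel e1
  have f4 := (ZMod.natCast_eq_natCast_iff' a a' p).1 e4
  have f5 := (ZMod.natCast_eq_natCast_iff' b b' p).1 e5
  rw [Nat.mod_eq_of_lt hab.1, Nat.mod_eq_of_lt hab'.1] at f4
  rw [Nat.mod_eq_of_lt hab.2, Nat.mod_eq_of_lt hab'.2] at f5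
  rw [f4, f5]

/-- The refinement that vertex `x` selects under the hash function with the coefficients `a`, `b`,
where `T x` is the table of the slacks of its refinements. -/
noncomputable def choice (p B : ℕ) (T : ℕ → ℕ → ℕ) (a b x : ℕ) : ℕ :=
  pick (T x) B ((a * x + b) % p % ∑ j ∈ range B, T x j)

/-- The contribution of a dart to the potential after the refinement, in units of `1 / p`. -/
noncomputable def weight (p B : ℕ) (T : ℕ → ℕ → ℕ) (a b : ℕ) (d : ℕ × ℕ) : ℕ :=
  if choice p B T a b d.1 = choice p B T a b d.2 then p / T d.1 (choice p B T a b d.1) else 0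

/-- On average over all hash functions, the potential of a dart does not grow, but for rounding: as the
hash values at the two ends are independent, the ends agree on the refinement `j` of the second one
with probability about `T d.1 j / ∑ T d.1`, and the weight is then `1 / T d.1 j`. -/
theorem sum_weight_le {p B : ℕ} (hp : p.Prime) (T : ℕ → ℕ → ℕ) {d : ℕ × ℕ} (h1 : d.1 < p)
    (h2 : d.2 < p) (hd : d.1 ≠ d.2) (hS : 0 < ∑ j ∈ range B, T d.1 j) :
    ∑ a ∈ range p, ∑ b ∈ range p, weight p B T a b d ≤
      p * p * (p / (∑ j ∈ range B, T d.1 j) + 1) := by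
  obtain ⟨x, y⟩ := d
  simp only at h1 h2 hd hS
  set S := ∑ j ∈ range B, T x j with hSdef
  set S' := ∑ j ∈ range B, T y j
  let g : ℕ × ℕ → ℕ := fun t =>
    if pick (T x) B (t.1 % S) = pick (T y) B (t.2 % S') then p / T x (pick (T x) B (t.1 % S)) else 0
  calc ∑ a ∈ range p, ∑ b ∈ range p, weight p B T a b (x, y)
      = ∑ h ∈ range p ×ˢ range p, g ((h.1 * x + h.2) % p, (h.1 * y + h.2) % p) := by
        rw [sum_product]; rfl
    _ = ∑ t ∈ (range p ×ˢ range p).image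
          (fun h : ℕ × ℕ => ((h.1 * x + h.2) % p, (h.1 * y + h.2) % p)), g t := by
        rw [sum_image (hash_injOn hp h1 h2 hd)]
    _ ≤ ∑ t ∈ range p ×ˢ range p, g t := by
        refine sum_le_sum_of_subset ?_
        intro t ht
        simp only [mem_image, mem_product, mem_range] at ht ⊢
        obtain ⟨h, -, rfl⟩ := ht
        exact ⟨Nat.mod_lt _ hp.pos, Nat.mod_lt _ hp.pos⟩
    _ = ∑ t₂ ∈ range p, ∑ t₁ ∈ range p, g (t₁, t₂) := by rw [sum_product_right]
    _ ≤ ∑ t₂ ∈ range p, p * (p / S + 1) := by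
        refine sum_le_sum fun t₂ _ => ?_
        set j := pick (T y) B (t₂ % S')
        calc ∑ t₁ ∈ range p, g (t₁, t₂)
            = ∑ t₁ ∈ range p, if pick (T x) B (t₁ % S) = j then p / T x j else 0 := by
              refine sum_congr rfl fun t₁ _ => ?_
              simp only [g]
              split_ifs with h
              · rw [h]
              · rfl
          _ = #{t ∈ range p | pick (T x) B (t % S) = j} * (p / T x j) := by
              rw [← sum_filter, sum_const, smul_eq_mul]
          _ ≤ T x j * (p / S + 1) * (p / T x j) := Nat.mul_le_mul_right _ (card_pick_le _ _ _ _ hS)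
          -- If `T x j = 0`, the weight is the junk value `p / 0 = 0`, but then no `t₁` selects `j`.
          _ = (p / T x j * T x j) * (p / S + 1) := by ring
          _ ≤ p * (p / S + 1) := Nat.mul_le_mul_right _ (Nat.div_mul_le_self _ _)
    _ = p * p * (p / S + 1) := by simp [mul_assoc]

/-- The method of conditional expectations: if `a` minimizes the potential summed over all `b`, and
`b` minimizes it for this `a`, then the potential is at most its average over all `a` and `b`. -/
theorem score_le_of_argmin {p B : ℕ} (hp : p.Prime) (T : ℕ → ℕ → ℕ) (F : Finset (ℕ × ℕ))
    (hF : ∀ d ∈ F, d.1 < p ∧ d.2 < p ∧ d.1 ≠ d.2 ∧ 0 < ∑ j ∈ range B, T d.1 j) {a b : ℕ}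
    (ha : ∀ a' < p, ∑ d ∈ F, ∑ b ∈ range p, weight p B T a b d ≤
      ∑ d ∈ F, ∑ b ∈ range p, weight p B T a' b d)
    (hb : ∀ b' < p, ∑ d ∈ F, weight p B T a b d ≤ ∑ d ∈ F, weight p B T a b' d) :
    ∑ d ∈ F, weight p B T a b d ≤ ∑ d ∈ F, (p / (∑ j ∈ range B, T d.1 j) + 1) := by
  set Q := ∑ d ∈ F, (p / (∑ j ∈ range B, T d.1 j) + 1)
  have h1 : ∑ a' ∈ range p, ∑ d ∈ F, ∑ b ∈ range p, weight p B T a' b d ≤ p * p * Q := by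
    rw [sum_comm, mul_sum]
    exact sum_le_sum fun d hd => sum_weight_le hp T (hF d hd).1 (hF d hd).2.1 (hF d hd).2.2.1
      (hF d hd).2.2.2
  have h2 : p * ∑ d ∈ F, ∑ b ∈ range p, weight p B T a b d ≤ p * p * Q := by
    refine le_trans ?_ h1
    calc p * ∑ d ∈ F, ∑ b ∈ range p, weight p B T a b d
        = ∑ a' ∈ range p, ∑ d ∈ F, ∑ b ∈ range p, weight p B T a b d := by simp
      _ ≤ _ := sum_le_sum fun a' ha' => ha a' (mem_range.1 ha')
  have h3 : p * ∑ d ∈ F, weight p B T a b d ≤ ∑ d ∈ F, ∑ b ∈ range p, weight p B T a b d := by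
    rw [sum_comm]
    calc p * ∑ d ∈ F, weight p B T a b d
        = ∑ b' ∈ range p, ∑ d ∈ F, weight p B T a b d := by simp
      _ ≤ _ := sum_le_sum fun b' hb' => hb b' (mem_range.1 hb')
  have h4 : p * (p * ∑ d ∈ F, weight p B T a b d) ≤ p * (p * Q) := by
    rw [← mul_assoc p p Q]
    exact (Nat.mul_le_mul_left p h3).trans h2
  exact Nat.le_of_mul_le_mul_left (Nat.le_of_mul_le_mul_left h4 hp.pos) hp.pos

/-! ### Slacks and the potential -/

/-- `A` is the set of darts, the ordered pairs of adjacent vertices, of a simple graph on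
`{0, …, n - 1}` with maximum degree at most `Δ`. -/
structure IsDartSet (n Δ : ℕ) (A : Finset (ℕ × ℕ)) : Prop where
  symm : ∀ d ∈ A, (d.2, d.1) ∈ A
  irrefl : ∀ d ∈ A, d.1 ≠ d.2
  lt : ∀ d ∈ A, d.1 < n
  deg : ∀ x, #{d ∈ A | d.1 = x} ≤ Δ

/-- A lower bound for the number of colors congruent to `r` modulo `M` that are free at `x`, where the
vertices outside `U` are colored with `col`: the number of these colors minus the number of neighbors
with such a color, or `0`. -/
def slack (A : Finset (ℕ × ℕ)) (U : Finset ℕ) (col : ℕ → ℕ) (Δ M r x : ℕ) : ℕ :=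
  #{c ∈ range (Δ + 1) | c % M = r} - #{d ∈ A | d.1 = x ∧ d.2 ∉ U ∧ col d.2 % M = r}

/-- The darts between vertices of `U` that propose the same set of colors. -/
def mono (A : Finset (ℕ × ℕ)) (U : Finset ℕ) (q : ℕ → ℕ) : Finset (ℕ × ℕ) :=
  {d ∈ A | d.1 ∈ U ∧ d.2 ∈ U ∧ q d.1 = q d.2}

/-- Every vertex `x` of `U` proposes the colors congruent to `q x` modulo `M`. One of them is free, and
the potential, the sum of the inverse slacks over the darts whose ends propose the same set, is at
most `|U|`, up to rounding. In units of `1 / p`, rounding has added at most `|U| Δ` in each of `s`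
stages. -/
structure Proposal (A : Finset (ℕ × ℕ)) (U : Finset ℕ) (col : ℕ → ℕ) (Δ p M s : ℕ)
    (q : ℕ → ℕ) : Prop where
  lt : ∀ x ∈ U, q x < M
  pos : ∀ x ∈ U, 0 < slack A U col Δ M (q x) x
  pot : ∑ d ∈ mono A U q, p / slack A U col Δ M (q d.1) d.1 ≤ #U * (p + s * Δ)

variable {n Δ p M s B : ℕ} {A : Finset (ℕ × ℕ)} {U : Finset ℕ} {col q : ℕ → ℕ}

theorem mod_mul_eq_iff {c M B r j : ℕ} (hr : r < M) (hj : j < B) :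
    c % (M * B) = r + j * M ↔ c % M = r ∧ c / M % B = j := by
  rw [Nat.mod_mul]
  constructor
  · intro h
    have hM : 0 < M := by omega
    have h1 := congrArg (· % M) h
    have h2 := congrArg (· / M) h
    simp only [Nat.add_mul_mod_self_left, Nat.add_mul_mod_self_right, Nat.mod_mod,
      Nat.mod_eq_of_lt hr] at h1
    simp only [Nat.add_mul_div_left _ _ hM, Nat.add_mul_div_right _ _ hM,
      Nat.div_eq_of_lt (Nat.mod_lt c hM), Nat.div_eq_of_lt hr] at h2
    omega
  · rintro ⟨rfl, rfl⟩
    rw [mul_comm M]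

theorem sum_card_refine {α : Type*} (X : Finset α) (f : α → ℕ) {r : ℕ} (hr : r < M) (hB : 0 < B) :
    ∑ j ∈ range B, #{c ∈ X | f c % (M * B) = r + j * M} = #{c ∈ X | f c % M = r} := by
  rw [card_eq_sum_card_fiberwise (f := fun c => f c / M % B) (t := range B)]
  · refine sum_congr rfl fun j hj => ?_
    congr 1
    ext c
    simp only [mem_filter, mem_range] at hj ⊢
    rw [mod_mul_eq_iff hr hj]
    tauto
  · intro c _
    simpa using Nat.mod_lt _ hB

/-- Refining a set of colors does not decrease the total slack. It may increase it, because the slack of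
a refinement is truncated at `0`. -/
theorem slack_le_sum {r : ℕ} (x : ℕ) (hr : r < M) (hB : 0 < B) :
    slack A U col Δ M r x ≤ ∑ j ∈ range B, slack A U col Δ (M * B) (r + j * M) x := by
  unfold slack
  have h1 := sum_card_refine (range (Δ + 1)) id hr hB
  have h2 := sum_card_refine {d ∈ A | d.1 = x ∧ d.2 ∉ U} (fun d => col d.2) hr hB
  simp only [filter_filter, id, and_assoc] at h1 h2
  rw [← h1, ← h2, tsub_le_iff_right, ← sum_add_distrib]
  exact sum_le_sum fun j _ => by omega

theorem card_mono_le (hA : IsDartSet n Δ A) : #(mono A U q) ≤ #U * Δ := by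
  rw [card_eq_sum_card_fiberwise (f := Prod.fst) (t := U)]
  · refine (sum_le_card_nsmul U _ Δ fun x _ => ?_)
    refine (card_le_card ?_).trans (hA.deg x)
    intro d hd
    simp only [mono, mem_filter] at hd ⊢
    exact ⟨hd.1.1, hd.2⟩
  · intro d hd
    simp only [mono, coe_filter, Set.mem_ofPred_eq] at hd
    exact hd.2.1

/-- A stage with a hash function of at most average potential preserves `Proposal`. -/
theorem Proposal.refine (hA : IsDartSet n Δ A) (h : Proposal A U col Δ p M s q) (hB : 0 < B)
    {T : ℕ → ℕ → ℕ} (hT : ∀ x ∈ U, ∀ j < B, T x j = slack A U col Δ (M * B) (q x + j * M) x)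
    {a b : ℕ} (hab : ∑ d ∈ mono A U q, weight p B T a b d ≤
      ∑ d ∈ mono A U q, (p / (∑ j ∈ range B, T d.1 j) + 1))
    {q' : ℕ → ℕ} (hq' : ∀ x ∈ U, q' x = q x + choice p B T a b x * M) :
    Proposal A U col Δ p (M * B) (s + 1) q' := by
  have hS : ∀ x ∈ U, slack A U col Δ M (q x) x ≤ ∑ j ∈ range B, T x j := by
    intro x hx
    refine (slack_le_sum x (h.lt x hx) hB).trans (le_of_eq (sum_congr rfl fun j hj => ?_))
    rw [hT x hx j (mem_range.1 hj)]
  have hu : ∀ x ∈ U, (a * x + b) % p % (∑ j ∈ range B, T x j) < ∑ j ∈ range B, T x j := fun x hx =>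
    Nat.mod_lt _ ((h.pos x hx).trans_le (hS x hx))
  have hc : ∀ x ∈ U, choice p B T a b x < B := fun x hx => pick_lt (hu x hx)
  have hs : ∀ x ∈ U, slack A U col Δ (M * B) (q' x) x = T x (choice p B T a b x) := by
    intro x hx
    rw [hT x hx _ (hc x hx), hq' x hx]
  refine ⟨fun x hx => ?_, fun x hx => ?_, ?_⟩
  · have h1 := h.lt x hx
    have h2 := hc x hx
    have h3 : (choice p B T a b x + 1) * M ≤ B * M := Nat.mul_le_mul_right M h2
    rw [add_mul] at h3
    rw [hq' x hx, mul_comm M B]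
    omega
  · rw [hs x hx]
    exact pick_pos (hu x hx)
  · have hiff : ∀ x ∈ U, ∀ y ∈ U,
        q' x = q' y ↔ q x = q y ∧ choice p B T a b x = choice p B T a b y := by
      intro x hx y hy
      have hM : 0 < M := (Nat.zero_le _).trans_lt (h.lt x hx)
      rw [hq' x hx, hq' y hy]
      constructor
      · intro e
        have h1 := congrArg (· % M) e
        have h2 := congrArg (· / M) e
        simp only [Nat.add_mul_mod_self_right, Nat.mod_eq_of_lt (h.lt x hx),
          Nat.mod_eq_of_lt (h.lt y hy)] at h1
        simp only [Nat.add_mul_div_right _ _ hM, Nat.div_eq_of_lt (h.lt x hx),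
          Nat.div_eq_of_lt (h.lt y hy), zero_add] at h2
        exact ⟨h1, h2⟩
      · rintro ⟨h1, h2⟩
        rw [h1, h2]
    have hmono : mono A U q' =
        {d ∈ mono A U q | choice p B T a b d.1 = choice p B T a b d.2} := by
      ext d
      simp only [mono, mem_filter]
      constructor
      · rintro ⟨h1, h2, h3, h4⟩
        rw [hiff _ h2 _ h3] at h4
        exact ⟨⟨h1, h2, h3, h4.1⟩, h4.2⟩
      · rintro ⟨⟨h1, h2, h3, h4⟩, h5⟩
        exact ⟨h1, h2, h3, (hiff _ h2 _ h3).2 ⟨h4, h5⟩⟩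
    have hUd : ∀ d ∈ mono A U q, d.1 ∈ U := fun d hd => by
      simp only [mono, mem_filter] at hd; exact hd.2.1
    calc ∑ d ∈ mono A U q', p / slack A U col Δ (M * B) (q' d.1) d.1
        = ∑ d ∈ mono A U q, weight p B T a b d := by
          rw [hmono, sum_filter]
          refine sum_congr rfl fun d hd => ?_
          unfold weight
          rw [hs _ (hUd d hd)]
      _ ≤ ∑ d ∈ mono A U q, (p / (∑ j ∈ range B, T d.1 j) + 1) := hab
      _ ≤ ∑ d ∈ mono A U q, (p / slack A U col Δ M (q d.1) d.1 + 1) := by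
          refine sum_le_sum fun d hd => ?_
          have := hUd d hd
          exact Nat.add_le_add_right (Nat.div_le_div_left (hS _ this) (h.pos _ this)) 1
      _ ≤ #U * (p + s * Δ) + #U * Δ := by
          rw [sum_add_distrib, sum_const, smul_eq_mul, mul_one]
          exact add_le_add h.pot (card_mono_le hA)
      _ = #U * (p + (s + 1) * Δ) := by ring

/-- Initially all colors are proposed. The slack of a vertex is then larger than the number of its
neighbors in `U`, so that its darts contribute at most `1` to the potential. -/
theorem Proposal.init (hA : IsDartSet n Δ A) (hq : ∀ x ∈ U, q x = 0) :
    Proposal A U col Δ p 1 0 q := by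
  have hs : ∀ x ∈ U, #{d ∈ A | d.1 = x ∧ d.2 ∈ U} + 1 ≤ slack A U col Δ 1 (q x) x := by
    intro x hx
    have h1 := hA.deg x
    rw [← card_filter_add_card_filter_not (s := {d ∈ A | d.1 = x}) (fun d => d.2 ∈ U)] at h1
    simp only [filter_filter] at h1
    simp only [slack, hq x hx, Nat.mod_one, and_true, filter_true, card_range]
    omega
  refine ⟨fun x hx => by rw [hq x hx]; omega, fun x hx => by have := hs x hx; omega, ?_⟩
  rw [← sum_fiberwise_of_maps_to (s := mono A U q) (t := U) (g := Prod.fst)]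
  · rw [zero_mul, add_zero, ← smul_eq_mul]
    refine sum_le_card_nsmul U _ p fun x hx => ?_
    calc ∑ d ∈ mono A U q with d.1 = x, p / slack A U col Δ 1 (q d.1) d.1
        = ∑ d ∈ mono A U q with d.1 = x, p / slack A U col Δ 1 (q x) x := by
          refine sum_congr rfl fun d hd => ?_
          rw [(mem_filter.1 hd).2]
      _ = #{d ∈ mono A U q | d.1 = x} * (p / slack A U col Δ 1 (q x) x) := by
          rw [sum_const, smul_eq_mul]
      _ ≤ slack A U col Δ 1 (q x) x * (p / slack A U col Δ 1 (q x) x) := by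
          refine Nat.mul_le_mul_right _ (le_trans (card_le_card ?_) (Nat.le_of_succ_le (hs x hx)))
          intro d hd
          simp only [mono, mem_filter] at hd ⊢
          exact ⟨hd.1.1, hd.2, hd.1.2.2.1⟩
      _ ≤ p := Nat.mul_div_le _ _
  · intro d hd
    simp only [mono, mem_filter] at hd
    exact hd.2.1

/-- As soon as `M` exceeds `Δ`, the proposed sets are single colors, and these are free. -/
theorem Proposal.free (h : Proposal A U col Δ p M s q) (hM : Δ < M) {x : ℕ} (hx : x ∈ U) :
    q x ≤ Δ ∧ slack A U col Δ M (q x) x = 1 ∧ ∀ d ∈ A, d.1 = x → d.2 ∉ U → col d.2 ≤ Δ →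
      col d.2 ≠ q x := by
  have hpos := h.pos x hx
  unfold slack at hpos ⊢
  have hsub : {c ∈ range (Δ + 1) | c % M = q x} ⊆ {q x} := by
    intro c hc
    simp only [mem_filter, mem_range, mem_singleton] at hc ⊢
    rw [← hc.2, Nat.mod_eq_of_lt (by omega)]
  have h1 := card_le_card hsub
  rw [card_singleton] at h1
  have h2 : #{d ∈ A | d.1 = x ∧ d.2 ∉ U ∧ col d.2 % M = q x} = 0 := by omega
  refine ⟨?_, by omega, ?_⟩
  · obtain ⟨c, hc⟩ := card_pos.1 (by omega : 0 < #{c ∈ range (Δ + 1) | c % M = q x})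
    have hc' := hsub hc
    simp only [mem_filter, mem_range, mem_singleton] at hc hc'
    omega
  · intro d hd h3 h4 h5 h6
    rw [card_eq_zero, filter_eq_empty_iff] at h2
    exact h2 hd ⟨h3, h4, by rw [Nat.mod_eq_of_lt (by omega), h6]⟩

/-- Few vertices have a larger neighbor that proposes the same color: all slacks are `1`, so that the
potential is the number of conflicting darts, at most `3 / 2 * |U|` with the rounding errors, and only
one of the two darts of an edge leads to the larger vertex. -/
theorem Proposal.card_conflict (hA : IsDartSet n Δ A) (h : Proposal A U col Δ p M s q)
    (hM : Δ < M) (hs : 2 * (s * Δ) ≤ p) (hp : 0 < p) :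
    4 * #{x ∈ U | ∃ y ∈ U, (x, y) ∈ A ∧ q x = q y ∧ x < y} ≤ 3 * #U := by
  have h1 : p * #(mono A U q) ≤ #U * (p + s * Δ) := by
    refine le_trans (le_of_eq ?_) h.pot
    rw [mul_comm, ← smul_eq_mul, ← sum_const]
    refine sum_congr rfl fun d hd => ?_
    simp only [mono, mem_filter] at hd
    rw [(h.free hM hd.2.1).2.1, Nat.div_one]
  have h2 : 2 * #(mono A U q) ≤ 3 * #U := by
    refine Nat.le_of_mul_le_mul_left ?_ hp
    calc p * (2 * #(mono A U q)) = 2 * (p * #(mono A U q)) := by ring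
      _ ≤ 2 * (#U * (p + s * Δ)) := Nat.mul_le_mul_left 2 h1
      _ = #U * (2 * p + 2 * (s * Δ)) := by ring
      _ ≤ #U * (2 * p + p) := Nat.mul_le_mul_left _ (by omega)
      _ = p * (3 * #U) := by ring
  have h3 : #{x ∈ U | ∃ y ∈ U, (x, y) ∈ A ∧ q x = q y ∧ x < y} ≤ #{d ∈ mono A U q | d.1 < d.2} := by
    refine (card_le_card ?_).trans (card_image_le (f := Prod.fst))
    intro x hx
    simp only [mem_filter, mem_image, Prod.exists, exists_and_right, exists_eq_right, mono] at hx ⊢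
    obtain ⟨hx, y, hy, hd, hq, hlt⟩ := hx
    exact ⟨y, ⟨hd, hx, hy, hq⟩, hlt⟩
  have h4 : #{d ∈ mono A U q | d.1 < d.2} = #{d ∈ mono A U q | ¬ d.1 < d.2} := by
    refine card_nbij' Prod.swap Prod.swap ?_ ?_ ?_ ?_
    · intro d hd
      simp only [mono, coe_filter, mem_filter, Set.mem_ofPred_eq, Prod.fst_swap, Prod.snd_swap] at hd ⊢
      exact ⟨⟨hA.symm d hd.1.1, hd.1.2.2.1, hd.1.2.1, hd.1.2.2.2.symm⟩, by omega⟩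
    · intro d hd
      simp only [mono, coe_filter, mem_filter, Set.mem_ofPred_eq, Prod.fst_swap, Prod.snd_swap] at hd ⊢
      have := hA.irrefl d hd.1.1
      exact ⟨⟨hA.symm d hd.1.1, hd.1.2.2.1, hd.1.2.1, hd.1.2.2.2.symm⟩, by omega⟩
    · intro d _; simp
    · intro d _; simp
  have h5 := card_filter_add_card_filter_not (s := mono A U q) (fun d => d.1 < d.2)
  omega

end

/-! ### A language of guarded loop programs -/

/-- The contents of the memory, as a function of the array and the index. -/
abbrev Store : Type := ℕ → ℕ → ℕ

/-- Overwrite cell `i` of array `k`. -/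
def Store.upd (m : Store) (k i v : ℕ) : Store :=
  fun k' i' => if k' = k ∧ i' = i then v else m k' i'

theorem Store.upd_of_ne (m : Store) {k k' : ℕ} (i v : ℕ) (h : k' ≠ k) : m.upd k i v k' = m k' := by
  funext i'
  simp [Store.upd, h]

/-- The value of an expression in a store. -/
def ev (m : Store) : Expr → ℕ
  | .const c => c
  | .get k e => m k (ev m e)
  | .add a b => ev m a + ev m b
  | .sub a b => ev m a - ev m b
  | .mul a b => ev m a * ev m b
  | .div a b => ev m a / ev m b
  | .mod a b => ev m a % ev m b

/-- Loop programs. `forDown x e b` runs `b` with the counter, cell `0` of array `x`, running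
through the values below that of `e` in descending order. `onlyIf e b` runs `b` if the value of `e` is
nonzero. `pass b` makes one pass over the stream
and runs `b` twice for each token `(u, v)`, with `(u, v)` and with `(v, u)` in cell `0` of the arrays
`4` and `5`; array `3` receives the tokens. -/
inductive Prog : Type
  | set (k : ℕ) (i e : Expr)
  | seq (p q : Prog)
  | onlyIf (e : Expr) (p : Prog)
  | forDown (x : ℕ) (e : Expr) (b : Prog)
  | pass (b : Prog)

/-- The parameters of the semantics of loop programs: the stream, and the bounds on the indices and
on the values of the cells that a program writes. -/
structure Env : Type where
  input : List (ℕ × ℕ)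
  N : ℕ
  V : ℕ

/-- Iterate `f j` for `j = c - 1, …, 0`. -/
def iterDown (f : ℕ → Store → Store) : ℕ → Store → Store
  | 0, m => m
  | j + 1, m => iterDown f j (f j m)

/-- The sum of `g j` over the stores that `iterDown f` runs through. -/
def sumDown (f : ℕ → Store → Store) (g : ℕ → Store → ℕ) : ℕ → Store → ℕ
  | 0, _ => 0
  | j + 1, m => g j m + sumDown f g j (f j m)

/-- The effect of a pass with body `f` over the remaining tokens. -/
def passRun (f : Store → Store) : List (ℕ × ℕ) → Store → Store
  | [], m => m.upd 3 0 0
  | t :: ts, m =>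
    let m₁ := f (((((m.upd 3 0 1).upd 3 1 t.1).upd 3 2 t.2).upd 4 0 t.1).upd 5 0 t.2)
    passRun f ts (f ((m₁.upd 4 0 t.2).upd 5 0 t.1))

/-- The effect of a loop program on the store. Indices of written cells are reduced modulo `E.N`, and
written values modulo `E.V`, so that the space bound holds by construction, whether or not the program
is correct. -/
def run (E : Env) : Prog → Store → Store
  | .set k i e, m => m.upd k (ev m i % E.N) (ev m e % E.V)
  | .seq p q, m => run E q (run E p m)
  | .onlyIf e p, m => if ev m e = 0 then m else run E p m
  | .forDown x e b, m =>
    iterDown (fun j m => run E b (m.upd x 0 j)) (ev m e % E.V) (m.upd x 0 (ev m e % E.V))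
  | .pass b, m => passRun (run E b) E.input m

/-- The number of passes that a loop program makes, provided that the body of a pass makes none. -/
def np (E : Env) : Prog → Store → ℕ
  | .set _ _ _, _ => 0
  | .seq p q, m => np E p m + np E q (run E p m)
  | .onlyIf e p, m => if ev m e = 0 then 0 else np E p m
  | .forDown x e b, m =>
    sumDown (fun j m => run E b (m.upd x 0 j)) (fun j m => np E b (m.upd x 0 j))
      (ev m e % E.V) (m.upd x 0 (ev m e % E.V))
  | .pass _, _ => 1

/-- The arrays that a loop program may write to. -/
def Prog.writes : Prog → List ℕ
  | .set k _ _ => [k]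
  | .seq p q => p.writes ++ q.writes
  | .onlyIf _ p => p.writes
  | .forDown x _ b => x :: b.writes
  | .pass b => 3 :: 4 :: 5 :: b.writes

/-- The program makes no pass. -/
def Prog.noPass : Prog → Bool
  | .set _ _ _ => true
  | .seq p q => p.noPass && q.noPass
  | .onlyIf _ p => p.noPass
  | .forDown _ _ b => b.noPass
  | .pass _ => false

/-- Loop counters are not written to in the bodies of their loops, and passes are not nested. -/
def Prog.wf : Prog → Bool
  | .set _ _ _ => true
  | .seq p q => p.wf && q.wf
  | .onlyIf _ p => p.wf
  | .forDown x _ b => b.wf && !(b.writes.contains x)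
  | .pass b => b.wf && b.noPass && !(b.writes.contains 3)

theorem iterDown_frame {f : ℕ → Store → Store} {k : ℕ} (h : ∀ j m, f j m k = m k) (c : ℕ)
    (m : Store) : iterDown f c m k = m k := by
  induction c generalizing m with
  | zero => rfl
  | succ j ih => rw [iterDown, ih, h]

theorem passRun_frame {f : Store → Store} {k : ℕ} (h : ∀ m, f m k = m k) (h3 : k ≠ 3) (h4 : k ≠ 4)
    (h5 : k ≠ 5) (l : List (ℕ × ℕ)) (m : Store) : passRun f l m k = m k := by
  induction l generalizing m with
  | nil => simp [passRun, Store.upd_of_ne, h3]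
  | cons t ts ih => simp [passRun, ih, h, Store.upd_of_ne, h3, h4, h5]

theorem run_frame (E : Env) (p : Prog) (m : Store) {k : ℕ} (hk : k ∉ p.writes) :
    run E p m k = m k := by
  induction p generalizing m with
  | set k' i e =>
    simp only [Prog.writes, List.mem_singleton] at hk
    simp [run, Store.upd_of_ne, hk]
  | seq p q ihp ihq =>
    simp only [Prog.writes, List.mem_append, not_or] at hk
    simp [run, ihp _ hk.1, ihq _ hk.2]
  | onlyIf e p ihp =>
    simp only [run]
    split_ifs
    · rfl
    · exact ihp _ hk
  | forDown x e b ih =>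
    simp only [Prog.writes, List.mem_cons, not_or] at hk
    simp only [run]
    rw [iterDown_frame (fun j m => by rw [ih _ hk.2, Store.upd_of_ne _ _ _ hk.1]),
      Store.upd_of_ne _ _ _ hk.1]
  | pass b ih =>
    simp only [Prog.writes, List.mem_cons, not_or] at hk
    exact passRun_frame (fun m => ih m hk.2.2.2) hk.1 hk.2.1 hk.2.2.1 _ _

theorem sumDown_eq_zero {f : ℕ → Store → Store} {g : ℕ → Store → ℕ} (h : ∀ j m, g j m = 0) (c : ℕ)
    (m : Store) : sumDown f g c m = 0 := by
  induction c generalizing m with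
  | zero => rfl
  | succ j ih => rw [sumDown, ih, h]

theorem np_eq_zero (E : Env) (p : Prog) (m : Store) (hp : p.noPass = true) : np E p m = 0 := by
  induction p generalizing m with
  | set => rfl
  | seq p q ihp ihq =>
    simp only [Prog.noPass, Bool.and_eq_true] at hp
    simp [np, ihp _ hp.1, ihq _ hp.2]
  | onlyIf e p ihp =>
    simp only [np]
    split_ifs
    · rfl
    · exact ihp _ hp
  | forDown x e b ih => exact sumDown_eq_zero (fun j m => ih _ hp) _ _
  | pass b ih => simp [Prog.noPass] at hp

/-! ### Compilation to the streaming machine -/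

/-- The machine program of a loop program; `g` and `v` are expressions for the bounds on the indices
and on the values. In a pass, cell `0` of array `3` tells whether a token has been read, and the
orientation of the token is reversed between the two runs of the body. -/
def compile (g v : Expr) : Prog → Cmd
  | .set k i e => .set k (.mod i g) (.mod e v)
  | .seq p q => .seq (compile g v p) (compile g v q)
  | .onlyIf e p => .cond e (compile g v p) .skip
  | .forDown x e b =>
    .seq (.set x (.const 0) (.mod e v))
      (.loop (.get x (.const 0))
        (.seq (.set x (.const 0) (.sub (.get x (.const 0)) (.const 1))) (compile g v b)))
  | .pass b =>
    .seq .rewind (.seq (.next 3) (.loop (.get 3 (.const 0))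
      (.seq (.set 4 (.const 0) (.get 3 (.const 1)))
      (.seq (.set 5 (.const 0) (.get 3 (.const 2)))
      (.seq (compile g v b)
      (.seq (.set 4 (.const 0) (.get 3 (.const 2)))
      (.seq (.set 5 (.const 0) (.get 3 (.const 1)))
      (.seq (compile g v b) (.next 3)))))))))

/-- `size (value of e) ≤ e.wt * size V` if all cells hold values below `V`. -/
def Expr.wt : Expr → ℕ
  | .const c => Nat.size c
  | .get _ _ => 1
  | .add a b => a.wt + b.wt + 1
  | .sub a _ => a.wt
  | .mul a b => a.wt + b.wt
  | .div a _ => a.wt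
  | .mod a _ => a.wt

/-- `cost of e ≤ e.cw * size V` if all cells hold values below `V`. -/
def Expr.cw : Expr → ℕ
  | .const c => 1 + Nat.size c
  | .get _ e => 2 + e.cw
  | .add a b => 1 + (a.wt + b.wt + 1) + a.cw + b.cw
  | .sub a b => 1 + a.wt + a.cw + b.cw
  | .mul a b => 1 + (a.wt + b.wt) + a.cw + b.cw
  | .div a b => 1 + a.wt + a.cw + b.cw
  | .mod a b => 1 + a.wt + a.cw + b.cw

/-- A bound, in units of `size V`, on the cost of a single step of the compiled program. -/
def Prog.kap (g v : Expr) : Prog → ℕ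
  | .set _ i e => 1 + (Expr.mod i g).cw + (Expr.mod e v).cw
  | .seq p q => p.kap g v + q.kap g v
  | .onlyIf e p => 1 + e.cw + p.kap g v
  | .forDown _ e b => 20 + (Expr.mod e v).cw + b.kap g v
  | .pass b => 20 + b.kap g v

/-- A bound on the running time of the compiled program, where `κ` bounds the cost of a single step,
`V` the values of the cells, and `l` the length of the stream. -/
def Prog.tm {R : Type} [CommSemiring R] (κ V l : R) : Prog → R
  | .set _ _ _ => κ
  | .seq p q => p.tm κ V l + q.tm κ V l
  | .onlyIf _ p => κ + p.tm κ V l + κ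
  | .forDown _ _ b => κ + (V * (κ + κ + b.tm κ V l) + κ)
  | .pass b => κ + (κ + (l * (κ + κ + κ + b.tm κ V l + κ + κ + b.tm κ V l + κ) + κ))

/-- The store that a memory represents. -/
def view (m : Mem) : Store := fun k i => m (k, i)

theorem ev_view (m : Mem) (e : Expr) : ev (view m) e = e.eval m := by
  induction e with
  | const c => rfl
  | get k e ih => simp [ev, Expr.eval, ih, view]
  | add a b iha ihb => simp [ev, Expr.eval, iha, ihb]
  | sub a b iha ihb => simp [ev, Expr.eval, iha, ihb]
  | mul a b iha ihb => simp [ev, Expr.eval, iha, ihb]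
  | div a b iha ihb => simp [ev, Expr.eval, iha, ihb]
  | mod a b iha ihb => simp [ev, Expr.eval, iha, ihb]

theorem view_update (m : Mem) (k i v : ℕ) : view (m.update (k, i) v) = (view m).upd k i v := by
  funext k' i'
  by_cases h : (k', i') = (k, i)
  · simp only [Prod.mk.injEq] at h
    simp [view, Store.upd, h]
  · have h' : ¬ (k' = k ∧ i' = i) := by simpa using h
    simp [view, Store.upd, h', Finsupp.update_apply]

/-- The nonzero cells lie in the first `N` cells of the first `K` arrays, and their values are
below `V`. -/
structure Box (K N V : ℕ) (m : Mem) : Prop where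
  supp : ∀ a, m a ≠ 0 → a.1 < K ∧ a.2 < N
  val : ∀ a, m a < V

theorem Box.update {K N V : ℕ} {m : Mem} (h : Box K N V m) {k i v : ℕ} (hk : k < K) (hi : i < N)
    (hv : v < V) : Box K N V (m.update (k, i) v) := by
  constructor
  · intro a ha
    by_cases h' : a = (k, i)
    · subst h'; exact ⟨hk, hi⟩
    · apply h.supp
      simpa [Finsupp.update_apply, h'] using ha
  · intro a
    by_cases h' : a = (k, i)
    · subst h'; simpa using hv
    · simpa [Finsupp.update_apply, h'] using h.val a

theorem Box.bits_le {K N V : ℕ} {m : Mem} (h : Box K N V m) :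
    m.bits ≤ K * N * (Nat.size K + Nat.size N + Nat.size V) := by
  unfold Mem.bits Finsupp.sum
  have hsub : m.support ⊆ Finset.range K ×ˢ Finset.range N := by
    intro a ha
    have := h.supp a (by simpa using ha)
    simp [this]
  calc _ ≤ ∑ a ∈ m.support, (Nat.size K + Nat.size N + Nat.size V) := by
        refine Finset.sum_le_sum fun a ha => ?_
        have := h.supp a (by simpa using ha)
        have h3 := h.val a
        exact Nat.add_le_add (Nat.add_le_add (Nat.size_le_size this.1.le)
          (Nat.size_le_size this.2.le)) (Nat.size_le_size h3.le)
    _ ≤ _ := by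
        rw [Finset.sum_const, smul_eq_mul]
        gcongr
        simpa using Finset.card_le_card hsub

theorem size_add_le (a b : ℕ) : Nat.size (a + b) ≤ Nat.size a + Nat.size b + 1 := by
  rw [Nat.size_le]
  have ha := Nat.lt_size_self a
  have hb := Nat.lt_size_self b
  have h1 : 2 ^ Nat.size a ≤ 2 ^ (Nat.size a + Nat.size b) := Nat.pow_le_pow_right (by norm_num) (by omega)
  have h2 : 2 ^ Nat.size b ≤ 2 ^ (Nat.size a + Nat.size b) := Nat.pow_le_pow_right (by norm_num) (by omega)
  rw [pow_succ]
  omega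

theorem size_mul_le (a b : ℕ) : Nat.size (a * b) ≤ Nat.size a + Nat.size b := by
  rw [Nat.size_le, pow_add]
  exact Nat.mul_lt_mul'' (Nat.lt_size_self a) (Nat.lt_size_self b)

theorem size_eval_le {V : ℕ} {m : Mem} (hm : ∀ a, m a < V) (hV : 1 < V) (e : Expr) :
    Nat.size (e.eval m) ≤ e.wt * Nat.size V := by
  have hL : 1 ≤ Nat.size V := Nat.size_pos.2 (by omega)
  induction e with
  | const c => exact Nat.le_mul_of_pos_right _ hL
  | get k e ih =>
    simp only [Expr.eval, Expr.wt, one_mul]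
    exact Nat.size_le_size (hm _).le
  | add a b iha ihb =>
    simp only [Expr.eval, Expr.wt]
    have := size_add_le (a.eval m) (b.eval m)
    linarith
  | mul a b iha ihb =>
    simp only [Expr.eval, Expr.wt]
    have := size_mul_le (a.eval m) (b.eval m)
    linarith
  | sub a b iha ihb => exact (Nat.size_le_size (Nat.sub_le _ _)).trans iha
  | div a b iha ihb => exact (Nat.size_le_size (Nat.div_le_self _ _)).trans iha
  | mod a b iha ihb => exact (Nat.size_le_size (Nat.mod_le _ _)).trans iha

theorem cost_le {V : ℕ} {m : Mem} (hm : ∀ a, m a < V) (hV : 1 < V) (e : Expr) :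
    e.cost m ≤ e.cw * Nat.size V := by
  have hL : 1 ≤ Nat.size V := Nat.size_pos.2 (by omega)
  induction e with
  | const c => exact Nat.le_mul_of_pos_right _ hL
  | get k e ih =>
    have := size_eval_le hm hV (.get k e)
    simp only [Expr.cost, Expr.cw, Expr.wt] at *
    linarith
  | add a b iha ihb =>
    have := size_eval_le hm hV (.add a b)
    simp only [Expr.cost, Expr.cw, Expr.wt] at *
    linarith
  | mul a b iha ihb =>
    have := size_eval_le hm hV (.mul a b)
    simp only [Expr.cost, Expr.cw, Expr.wt] at *
    linarith
  | sub a b iha ihb =>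
    have := size_eval_le hm hV (.sub a b)
    simp only [Expr.cost, Expr.cw, Expr.wt] at *
    linarith
  | div a b iha ihb =>
    have := size_eval_le hm hV (.div a b)
    simp only [Expr.cost, Expr.cw, Expr.wt] at *
    linarith
  | mod a b iha ihb =>
    have := size_eval_le hm hV (.mod a b)
    simp only [Expr.cost, Expr.cw, Expr.wt] at *
    linarith

/-- The resources that compiled programs have to respect: the number `K` of arrays, the peak `Bd`,
and the cost `κ` of a single step. The peak suffices for the largest memory in the box together with
the temporary values of a single step. -/
structure Limits (E : Env) (K Bd κ : ℕ) : Prop where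
  three_le_N : 3 ≤ E.N
  one_lt_V : 1 < E.V
  input_lt : ∀ t ∈ E.input, t.1 < E.V ∧ t.2 < E.V
  bits : K * E.N * (Nat.size K + Nat.size E.N + Nat.size E.V) + κ ≤ Bd

/-- `Runs E K Bd c m r m' r' π τ`: started within the box with the store `m` and the unread tokens `r`, the machine
program `c` halts with the store `m'` and the unread tokens `r'` after `π` passes and at most `τ` time
units, without exceeding the peak `Bd`. -/
def Runs (E : Env) (K Bd : ℕ) (c : Cmd) (m : Store) (r : List (ℕ × ℕ)) (m' : Store)
    (r' : List (ℕ × ℕ)) (π τ : ℕ) : Prop :=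
  ∀ s : State, Box K E.N E.V s.mem → view s.mem = m → s.rest = r → s.peak ≤ Bd →
    ∃ t : State, Exec E.input c s t ∧ Box K E.N E.V t.mem ∧ view t.mem = m' ∧ t.rest = r' ∧
      t.passes = s.passes + π ∧ t.time ≤ s.time + τ ∧ t.peak ≤ Bd

section Runs

variable {E : Env} {K Bd κ : ℕ}

theorem Runs.seq {p q : Cmd} {m₁ m₂ m₃ : Store} {r₁ r₂ r₃ : List (ℕ × ℕ)} {π π' τ τ' : ℕ}
    (hp : Runs E K Bd p m₁ r₁ m₂ r₂ π τ) (hq : Runs E K Bd q m₂ r₂ m₃ r₃ π' τ') :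
    Runs E K Bd (.seq p q) m₁ r₁ m₃ r₃ (π + π') (τ + τ') := by
  intro s hb hm hr hs
  obtain ⟨t, ht, tb, tm, tr, tp, tt, tk⟩ := hp s hb hm hr hs
  obtain ⟨u, hu, ub, um, ur, up, ut, uk⟩ := hq t tb tm tr tk
  exact ⟨u, .seq ht hu, ub, um, ur, by omega, by omega, uk⟩

theorem Runs.mono {p : Cmd} {m m' : Store} {r r' : List (ℕ × ℕ)} {π π' τ τ' : ℕ}
    (hp : Runs E K Bd p m r m' r' π τ) (hπ : π = π') (h : τ ≤ τ') :
    Runs E K Bd p m r m' r' π' τ' := by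
  intro s hb hm hr hs
  obtain ⟨t, ht, tb, tm, tr, tp, tt, tk⟩ := hp s hb hm hr hs
  exact ⟨t, ht, tb, tm, tr, by omega, by omega, tk⟩

theorem Limits.charge_peak (h : Limits E K Bd κ) {s : State} (hb : Box K E.N E.V s.mem)
    (hs : s.peak ≤ Bd) {c : ℕ} (hc : c ≤ κ) : (s.charge c).peak ≤ Bd := by
  have := hb.bits_le
  have := h.bits
  simp only [State.charge]
  omega

theorem Limits.write_peak (h : Limits E K Bd κ) {s : State} (hb : Box K E.N E.V s.mem)
    (hs : s.peak ≤ Bd) {k i v : ℕ} (hk : k < K) (hi : i < E.N) (hv : v < E.V) :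
    (s.write k i v).peak ≤ Bd := by
  have := (hb.update hk hi hv).bits_le
  have := h.bits
  simp only [State.write]
  omega

theorem Limits.size_V_pos (h : Limits E K Bd κ) : 1 ≤ Nat.size E.V :=
  Nat.size_pos.2 (by have := h.one_lt_V; omega)

theorem Limits.runs_skip (h : Limits E K Bd κ) (hκ : 1 ≤ κ) (m : Store) (r : List (ℕ × ℕ)) :
    Runs E K Bd .skip m r m r 0 κ := by
  intro s hb hm hr hs
  exact ⟨_, .skip s, hb, hm, hr, rfl, Nat.add_le_add_left hκ _, h.charge_peak hb hs hκ⟩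

theorem Limits.runs_set (h : Limits E K Bd κ) {k : ℕ} {i e : Expr} {m : Store}
    (r : List (ℕ × ℕ)) (hκ : (1 + i.cw + e.cw) * Nat.size E.V ≤ κ) (hk : k < K) (hi : ev m i < E.N)
    (he : ev m e < E.V) :
    Runs E K Bd (.set k i e) m r (m.upd k (ev m i) (ev m e)) r 0 κ := by
  intro s hb hm hr hs
  subst hm
  rw [ev_view] at hi he
  have h1 := cost_le hb.val h.one_lt_V i
  have h2 := cost_le hb.val h.one_lt_V e
  have h3 := h.size_V_pos
  have hc : 1 + i.cost s.mem + e.cost s.mem ≤ κ := by linarith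
  refine ⟨_, .set k i e s, hb.update hk hi he, ?_, hr, rfl, Nat.add_le_add_left hc _, ?_⟩
  · rw [ev_view, ev_view]
    exact view_update _ _ _ _
  · exact h.write_peak (s := s.charge _) hb (h.charge_peak hb hs hc) hk hi he

theorem Limits.runs_cond_true (h : Limits E K Bd κ) {e : Expr} {p q : Cmd} {m m' : Store}
    {r r' : List (ℕ × ℕ)} {π τ : ℕ} (hκ : (1 + e.cw) * Nat.size E.V ≤ κ) (he : ev m e ≠ 0)
    (hp : Runs E K Bd p m r m' r' π τ) : Runs E K Bd (.cond e p q) m r m' r' π (κ + τ) := by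
  intro s hb hm hr hs
  subst hm
  rw [ev_view] at he
  have h1 := cost_le hb.val h.one_lt_V e
  have h3 := h.size_V_pos
  have hc : 1 + e.cost s.mem ≤ κ := by linarith
  obtain ⟨t, ht, tb, tm, tr, tp, tt, tk⟩ :=
    hp (s.charge (1 + e.cost s.mem)) hb rfl hr (h.charge_peak hb hs hc)
  refine ⟨t, .cond_true he ht, tb, tm, tr, tp, ?_, tk⟩
  simp only [State.charge] at tt
  omega

theorem Limits.runs_cond_false (h : Limits E K Bd κ) {e : Expr} {p q : Cmd} {m m' : Store}
    {r r' : List (ℕ × ℕ)} {π τ : ℕ} (hκ : (1 + e.cw) * Nat.size E.V ≤ κ) (he : ev m e = 0)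
    (hq : Runs E K Bd q m r m' r' π τ) : Runs E K Bd (.cond e p q) m r m' r' π (κ + τ) := by
  intro s hb hm hr hs
  subst hm
  rw [ev_view] at he
  have h1 := cost_le hb.val h.one_lt_V e
  have h3 := h.size_V_pos
  have hc : 1 + e.cost s.mem ≤ κ := by linarith
  obtain ⟨t, ht, tb, tm, tr, tp, tt, tk⟩ :=
    hq (s.charge (1 + e.cost s.mem)) hb rfl hr (h.charge_peak hb hs hc)
  refine ⟨t, .cond_false he ht, tb, tm, tr, tp, ?_, tk⟩
  simp only [State.charge] at tt
  omega

theorem Limits.runs_loop_true (h : Limits E K Bd κ) {e : Expr} {p : Cmd} {m m' m'' : Store}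
    {r r' r'' : List (ℕ × ℕ)} {π τ π' τ' : ℕ} (hκ : (1 + e.cw) * Nat.size E.V ≤ κ) (he : ev m e ≠ 0)
    (hp : Runs E K Bd p m r m' r' π τ) (hl : Runs E K Bd (.loop e p) m' r' m'' r'' π' τ') :
    Runs E K Bd (.loop e p) m r m'' r'' (π + π') (κ + τ + τ') := by
  intro s hb hm hr hs
  subst hm
  rw [ev_view] at he
  have h1 := cost_le hb.val h.one_lt_V e
  have h3 := h.size_V_pos
  have hc : 1 + e.cost s.mem ≤ κ := by linarith
  obtain ⟨t, ht, tb, tm, tr, tp, tt, tk⟩ :=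
    hp (s.charge (1 + e.cost s.mem)) hb rfl hr (h.charge_peak hb hs hc)
  obtain ⟨u, hu, ub, um, ur, up, ut, uk⟩ := hl t tb tm tr tk
  simp only [State.charge] at tt tp
  exact ⟨u, .loop_true he ht hu, ub, um, ur, by omega, by omega, uk⟩

theorem Limits.runs_loop_false (h : Limits E K Bd κ) {e : Expr} {p : Cmd} {m : Store}
    (r : List (ℕ × ℕ)) (hκ : (1 + e.cw) * Nat.size E.V ≤ κ) (he : ev m e = 0) :
    Runs E K Bd (.loop e p) m r m r 0 κ := by
  intro s hb hm hr hs
  subst hm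
  rw [ev_view] at he
  have h1 := cost_le hb.val h.one_lt_V e
  have h3 := h.size_V_pos
  have hc : 1 + e.cost s.mem ≤ κ := by linarith
  exact ⟨_, .loop_false he, hb, rfl, hr, rfl, Nat.add_le_add_left hc _, h.charge_peak hb hs hc⟩

theorem Limits.runs_rewind (h : Limits E K Bd κ) (hκ : 1 ≤ κ) (m : Store) (r : List (ℕ × ℕ)) :
    Runs E K Bd .rewind m r m E.input 1 κ := by
  intro s hb hm hr hs
  exact ⟨_, .rewind s, hb, hm, rfl, rfl, Nat.add_le_add_left hκ _, h.charge_peak hb hs hκ⟩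

theorem Limits.runs_next_nil (h : Limits E K Bd κ) (hκ : 1 ≤ κ) {k : ℕ} (hk : k < K) (m : Store) :
    Runs E K Bd (.next k) m [] (m.upd k 0 0) [] 0 κ := by
  intro s hb hm hr hs
  have hN := h.three_le_N
  have hV := h.one_lt_V
  refine ⟨_, .next k s, ?_⟩
  simp only [State.next, hr]
  refine ⟨hb.update hk (by omega) (by omega), ?_, hr, rfl, Nat.add_le_add_left hκ _, ?_⟩
  · subst hm; exact view_update _ _ _ _
  · exact h.write_peak (s := s.charge _) hb (h.charge_peak hb hs hκ) hk (by omega) (by omega)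

theorem Limits.runs_next_cons (h : Limits E K Bd κ) (hκ : 3 * Nat.size E.V ≤ κ) {k : ℕ} (hk : k < K)
    (m : Store) {t : ℕ × ℕ} (ts : List (ℕ × ℕ)) (ht : t.1 < E.V ∧ t.2 < E.V) :
    Runs E K Bd (.next k) m (t :: ts) (((m.upd k 0 1).upd k 1 t.1).upd k 2 t.2) ts 0 κ := by
  intro s hb hm hr hs
  have hN := h.three_le_N
  have hV := h.one_lt_V
  have h1 := Nat.size_le_size ht.1.le
  have h2 := Nat.size_le_size ht.2.le
  have h3 := h.size_V_pos
  have hc : 1 + Nat.size t.1 + Nat.size t.2 ≤ κ := by linarith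
  have b0 := hb.update hk (i := 0) (v := 1) (by omega) (by omega)
  have b1 := b0.update hk (i := 1) (v := t.1) (by omega) ht.1
  have b2 := b1.update hk (i := 2) (v := t.2) (by omega) ht.2
  refine ⟨_, .next k s, ?_⟩
  simp only [State.next, hr]
  refine ⟨b2, ?_, trivial, rfl, Nat.add_le_add_left hc _, ?_⟩
  · subst hm
    simp only [State.write, State.charge, view_update]
  · refine h.write_peak (s := ((s.charge _).write k 0 1).write k 1 t.1) b1 ?_ hk (by omega) ht.2
    refine h.write_peak (s := (s.charge _).write k 0 1) b0 ?_ hk (by omega) ht.1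
    exact h.write_peak (s := s.charge _) hb (h.charge_peak hb hs hc) hk (by omega) hV

end Runs

/-! ### Adequacy of the compilation -/

section Adequacy

variable {E : Env} {K Bd κ : ℕ}

/-- The loop of a compiled `forDown`, for a body that satisfies the conclusion of `Limits.adequate` on
all stores with the invariant `I`; `P` stands for the assertion that the body makes no pass. -/
theorem Limits.runs_loop_iterDown (h : Limits E K Bd κ) {x : ℕ} {c : Cmd} {b : Prog} {τ : ℕ}
    (I : Store → Prop) (P : Prop) (hx : x < K) (hxb : x ∉ b.writes)
    (hκ : 20 * Nat.size E.V ≤ κ)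
    (hI : ∀ m j, I m → I (run E b (m.upd x 0 j)))
    (hb : ∀ m j r, I m → ∃ r', Runs E K Bd c (m.upd x 0 j) r (run E b (m.upd x 0 j)) r'
      (np E b (m.upd x 0 j)) τ ∧ (P → r' = r)) (n : ℕ) (hn : n < E.V) (m : Store) (hm : m x 0 = n)
    (hIm : I m) (r : List (ℕ × ℕ)) :
    ∃ r', Runs E K Bd (.loop (.get x (.const 0))
        (.seq (.set x (.const 0) (.sub (.get x (.const 0)) (.const 1))) c)) m r
      (iterDown (fun j m => run E b (m.upd x 0 j)) n m) r'
      (sumDown (fun j m => run E b (m.upd x 0 j)) (fun j m => np E b (m.upd x 0 j)) n m)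
      (n * (κ + κ + τ) + κ) ∧ (P → r' = r) := by
  have hN := h.three_le_N
  have h3 := h.size_V_pos
  have hcond : (1 + (Expr.get x (.const 0)).cw) * Nat.size E.V ≤ κ := by
    refine le_trans (Nat.mul_le_mul_right _ ?_) hκ
    simp [Expr.cw]
  induction n generalizing m r with
  | zero => exact ⟨r, (h.runs_loop_false r hcond (by simp [ev, hm])).mono rfl (by omega), fun _ => rfl⟩
  | succ j ih =>
    have hset : Runs E K Bd (.set x (.const 0) (.sub (.get x (.const 0)) (.const 1))) m r
        (m.upd x 0 j) r 0 κ := by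
      have := h.runs_set (k := x) (i := .const 0) (e := .sub (.get x (.const 0)) (.const 1)) (m := m)
        r ?_ hx (by simp only [ev]; omega) (by simp only [ev, hm]; omega)
      · simpa [ev, hm] using this
      · refine le_trans (Nat.mul_le_mul_right _ ?_) hκ
        simp [Expr.cw, Expr.wt]
    have hx' : run E b (m.upd x 0 j) x 0 = j := by
      rw [run_frame E b _ hxb]
      simp [Store.upd]
    obtain ⟨r₁, hr₁, n₁⟩ := hb m j r hIm
    obtain ⟨r₂, hr₂, n₂⟩ := ih (by omega) _ hx' (hI _ j hIm) r₁
    refine ⟨r₂, ?_, fun hP => (n₂ hP).trans (n₁ hP)⟩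
    refine (h.runs_loop_true hcond (by simp [ev, hm]) (hset.seq hr₁) hr₂).mono ?_ ?_
    · simp [sumDown]
    · rw [Nat.add_mul]; omega

/-- The store after the first of the tokens `ts` has been read into array `3`. -/
def nextStore (m : Store) : List (ℕ × ℕ) → Store
  | [] => m.upd 3 0 0
  | t :: _ => ((m.upd 3 0 1).upd 3 1 t.1).upd 3 2 t.2

theorem Limits.runs_next (h : Limits E K Bd κ) (hκ : 20 * Nat.size E.V ≤ κ) (hK : 3 < K)
    (m : Store) {ts : List (ℕ × ℕ)} (hts : ∀ t ∈ ts, t.1 < E.V ∧ t.2 < E.V) :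
    Runs E K Bd (.next 3) m ts (nextStore m ts) ts.tail 0 κ := by
  have h3 := h.size_V_pos
  cases ts with
  | nil => exact h.runs_next_nil (by omega) hK m
  | cons t ts => exact h.runs_next_cons (by omega) hK m ts (hts t (by simp))

/-- The loop of a compiled `pass`, entered after the first token has been read. -/
theorem Limits.runs_loop_passRun (h : Limits E K Bd κ) {c : Cmd} {b : Prog} {τ : ℕ}
    (I : Store → Prop) (hK : 5 < K) (hb3 : 3 ∉ b.writes) (hκ : 20 * Nat.size E.V ≤ κ)
    (hI : ∀ m k i v, k = 3 ∨ k = 4 ∨ k = 5 → I m → I (m.upd k i v))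
    (hIb : ∀ m, I m → I (run E b m))
    (hb : ∀ m r, I m → Runs E K Bd c m r (run E b m) r 0 τ) (ts : List (ℕ × ℕ))
    (hts : ∀ t ∈ ts, t.1 < E.V ∧ t.2 < E.V) (m : Store) (hIm : I m) :
    Runs E K Bd (.loop (.get 3 (.const 0))
      (.seq (.set 4 (.const 0) (.get 3 (.const 1)))
      (.seq (.set 5 (.const 0) (.get 3 (.const 2)))
      (.seq c
      (.seq (.set 4 (.const 0) (.get 3 (.const 2)))
      (.seq (.set 5 (.const 0) (.get 3 (.const 1)))
      (.seq c (.next 3)))))))) (nextStore m ts) ts.tail (passRun (run E b) ts m) [] 0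
      (ts.length * (κ + κ + κ + τ + κ + κ + τ + κ) + κ) := by
  have hN := h.three_le_N
  have hV := h.one_lt_V
  have h3 := h.size_V_pos
  have hcond : (1 + (Expr.get 3 (.const 0)).cw) * Nat.size E.V ≤ κ := by
    refine le_trans (Nat.mul_le_mul_right _ ?_) hκ
    simp [Expr.cw]
  have key : ∀ (k : ℕ) (hk : k < K) (j : ℕ) (m : Store) (r : List (ℕ × ℕ)) (w : ℕ), m 3 j = w →
      j ≤ 2 → w < E.V → Runs E K Bd (.set k (.const 0) (.get 3 (.const j))) m r (m.upd k 0 w) r 0 κ := by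
    intro k hk j m r w hw hj hwV
    have := h.runs_set (k := k) (i := .const 0) (e := .get 3 (.const j)) (m := m)
        r ?_ hk (by simp only [ev]; omega) (by simp only [ev, hw]; exact hwV)
    · simpa [ev, hw] using this
    · refine le_trans (Nat.mul_le_mul_right _ ?_) hκ
      have : Nat.size j ≤ Nat.size 2 := Nat.size_le_size hj
      have : Nat.size 2 = 2 := by decide
      simp [Expr.cw]
      omega
  induction ts generalizing m with
  | nil => exact (h.runs_loop_false _ hcond (by simp [ev, nextStore, Store.upd])).mono rfl (by simp)
  | cons t ts ih =>
    have ht := hts t (by simp)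
    have g1 := key 4 (by omega) 1 (nextStore m (t :: ts)) ts t.1 (by simp [nextStore, Store.upd])
      (by omega) ht.1
    have g2 := key 5 (by omega) 2 ((nextStore m (t :: ts)).upd 4 0 t.1) ts t.2
      (by simp [nextStore, Store.upd]) (by omega) ht.2
    set m₀ := ((nextStore m (t :: ts)).upd 4 0 t.1).upd 5 0 t.2 with hm₀
    have hI₀ : I m₀ := by
      refine hI _ _ _ _ (by simp) (hI _ _ _ _ (by simp) (hI _ _ _ _ (by simp) (hI _ _ _ _ (by simp)
        (hI _ _ _ _ (by simp) hIm))))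
    -- The body leaves the token in array `3` alone, so that it can be read again in reverse.
    have hf : run E b m₀ 3 = m₀ 3 := run_frame E b _ hb3
    have g3 := key 4 (by omega) 2 (run E b m₀) ts t.2 (by rw [hf]; simp [m₀, nextStore, Store.upd])
      (by omega) ht.2
    have g4 := key 5 (by omega) 1 ((run E b m₀).upd 4 0 t.2) ts t.1
      (by simp only [Store.upd, hf]; simp [m₀, nextStore, Store.upd]) (by omega) ht.1
    have hI₂ : I (((run E b m₀).upd 4 0 t.2).upd 5 0 t.1) :=
      hI _ _ _ _ (by simp) (hI _ _ _ _ (by simp) (hIb _ hI₀))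
    have hts' : ∀ t ∈ ts, t.1 < E.V ∧ t.2 < E.V := fun t ht => hts t (by simp [ht])
    have hbody := g1.seq (g2.seq ((hb m₀ ts hI₀).seq (g3.seq (g4.seq ((hb _ ts hI₂).seq
      (h.runs_next hκ (by omega) _ hts'))))))
    refine (h.runs_loop_true hcond (by simp [ev, nextStore, Store.upd]) hbody
      (ih hts' _ (hIb _ hI₂))).mono rfl ?_
    rw [List.length_cons, Nat.add_mul]
    omega

/-- The compiled program computes what the loop program does, within the resources that its syntax
suggests. The bounds `g` and `v` have to evaluate to `E.N` and `E.V` as long as only the arrays in `W`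
change, and these are all that the program writes to. -/
theorem Limits.adequate (h : Limits E K Bd κ) {g v : Expr} {W : List ℕ} {m₀ : Store}
    (hgv : ∀ m : Store, (∀ k ∉ W, m k = m₀ k) → ev m g = E.N ∧ ev m v = E.V) (hK : ∀ k ∈ W, k < K)
    (p : Prog) (hW : ∀ k ∈ p.writes, k ∈ W) (hwf : p.wf = true)
    (hκ : p.kap g v * Nat.size E.V ≤ κ) (m : Store) (hm : ∀ k ∉ W, m k = m₀ k)
    (r : List (ℕ × ℕ)) :
    ∃ r', Runs E K Bd (compile g v p) m r (run E p m) r' (np E p m)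
      (p.tm κ E.V E.input.length) ∧ (p.noPass = true → r' = r) := by
  have hN := h.three_le_N
  have hV := h.one_lt_V
  have h3 := h.size_V_pos
  have frame : ∀ (p : Prog), (∀ k ∈ p.writes, k ∈ W) → ∀ m : Store, (∀ k ∉ W, m k = m₀ k) →
      ∀ k ∉ W, run E p m k = m₀ k := by
    intro p hp m hm k hk
    rw [run_frame E p m (fun h => hk (hp k h)), hm k hk]
  have updI : ∀ (m : Store) (k i w : ℕ), k ∈ W → (∀ k ∉ W, m k = m₀ k) →
      ∀ k' ∉ W, m.upd k i w k' = m₀ k' := by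
    intro m k i w hk hm k' hk'
    rw [Store.upd_of_ne _ _ _ (by rintro rfl; exact hk' hk), hm k' hk']
  have mulle : ∀ {a b : ℕ}, a ≤ b → a * Nat.size E.V ≤ b * Nat.size E.V :=
    fun h => Nat.mul_le_mul_right _ h
  induction p generalizing m r with
  | set k i e =>
    obtain ⟨eg, evv⟩ := hgv m hm
    refine ⟨r, ?_, fun _ => rfl⟩
    have := h.runs_set (k := k) (i := .mod i g) (e := .mod e v) (m := m) r hκ
      (hK _ (hW k (by simp [Prog.writes])))
      (by simp only [ev, eg]; exact Nat.mod_lt _ (by omega))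
      (by simp only [ev, evv]; exact Nat.mod_lt _ (by omega))
    simpa [run, ev, eg, evv, compile, np, Prog.tm] using this
  | seq p q ihp ihq =>
    simp only [Prog.writes, List.mem_append] at hW
    simp only [Prog.wf, Bool.and_eq_true] at hwf
    simp only [Prog.kap] at hκ
    obtain ⟨r₁, h₁, n₁⟩ := ihp (fun k hk => hW k (.inl hk)) hwf.1
      ((mulle (by omega)).trans hκ) m hm r
    obtain ⟨r₂, h₂, n₂⟩ := ihq (fun k hk => hW k (.inr hk)) hwf.2
      ((mulle (by omega)).trans hκ) _ (frame p (fun k hk => hW k (.inl hk)) m hm) r₁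
    refine ⟨r₂, h₁.seq h₂, ?_⟩
    intro hp
    simp only [Prog.noPass, Bool.and_eq_true] at hp
    rw [n₂ hp.2, n₁ hp.1]
  | onlyIf e p ihp =>
    simp only [Prog.writes] at hW
    simp only [Prog.wf] at hwf
    simp only [Prog.kap] at hκ
    by_cases he : ev m e = 0
    · refine ⟨r, ?_, fun hp => rfl⟩
      simp only [run, np, he, if_true]
      refine (h.runs_cond_false ((mulle (by omega)).trans hκ) he (h.runs_skip ?_ m r)).mono rfl
        (by simp only [Prog.tm]; omega)
      exact le_trans (by nlinarith) hκ
    · obtain ⟨r₁, h₁, n₁⟩ := ihp hW hwf ((mulle (by omega)).trans hκ) m hm r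
      refine ⟨r₁, ?_, fun hp => n₁ hp⟩
      simp only [run, np, he, if_false]
      exact (h.runs_cond_true ((mulle (by omega)).trans hκ) he h₁).mono rfl
        (by simp only [Prog.tm]; omega)
  | forDown x e b ih =>
    simp only [Prog.writes, List.mem_cons, forall_eq_or_imp] at hW
    simp only [Prog.wf, Bool.and_eq_true, Bool.not_eq_true', List.contains_eq_mem,
      decide_eq_false_iff_not] at hwf
    simp only [Prog.kap] at hκ
    obtain ⟨eg, evv⟩ := hgv m hm
    have hset : Runs E K Bd (.set x (.const 0) (.mod e v)) m r
        (m.upd x 0 (ev m e % E.V)) r 0 κ := by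
      have := h.runs_set (k := x) (i := .const 0) (e := .mod e v) (m := m)
        r ?_ (hK _ hW.1) (by simp only [ev]; omega)
        (by simp only [ev, evv]; exact Nat.mod_lt _ (by omega))
      · simpa [ev, evv] using this
      · exact (mulle (by simp only [Expr.cw]; simp; omega)).trans hκ
    obtain ⟨r', hl, n'⟩ := h.runs_loop_iterDown (x := x) (c := compile g v b) (b := b)
      (τ := b.tm κ E.V E.input.length) (fun m => ∀ k ∉ W, m k = m₀ k) (b.noPass = true) (hK _ hW.1)
      hwf.2 ((mulle (by omega)).trans hκ)
      (fun m j hm => frame b hW.2 _ (updI _ _ _ _ hW.1 hm))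
      (fun m j r hm => ih hW.2 hwf.1 ((mulle (by omega)).trans hκ) (m.upd x 0 j)
          (updI _ _ _ _ hW.1 hm) r)
      (ev m e % E.V) (Nat.mod_lt _ (by omega)) (m.upd x 0 (ev m e % E.V)) (by simp [Store.upd])
      (updI _ _ _ _ hW.1 hm) r
    refine ⟨r', (hset.seq hl).mono (by simp [np]) ?_, n'⟩
    simp only [Prog.tm]
    gcongr
    exact (Nat.mod_lt _ (by omega)).le
  | pass b ih =>
    simp only [Prog.writes, List.mem_cons, forall_eq_or_imp] at hW
    simp only [Prog.wf, Bool.and_eq_true, Bool.not_eq_true', List.contains_eq_mem,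
      decide_eq_false_iff_not] at hwf
    simp only [Prog.kap] at hκ
    have hκ' : 20 * Nat.size E.V ≤ κ := (mulle (by omega)).trans hκ
    have hl := h.runs_loop_passRun (c := compile g v b) (b := b)
      (τ := b.tm κ E.V E.input.length) (fun m => ∀ k ∉ W, m k = m₀ k) (hK _ hW.2.2.1) hwf.2 hκ'
      (fun m k i v hk hm => updI _ _ _ _ (by rcases hk with rfl | rfl | rfl <;> tauto) hm)
      (fun m hm => frame b hW.2.2.2 _ hm)
      (fun m r hm => by
        obtain ⟨r', h', n'⟩ := ih hW.2.2.2 hwf.1.1 ((mulle (by omega)).trans hκ) m hm r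
        rw [n' hwf.1.2, np_eq_zero E b _ hwf.1.2] at h'
        exact h') E.input h.input_lt m hm
    refine ⟨[], ((h.runs_rewind (by omega) m r).seq
      ((h.runs_next hκ' (hK _ hW.1) m h.input_lt).seq hl)).mono rfl ?_, ?_⟩
    · simp only [Prog.tm]
      exact le_rfl
    · simp [Prog.noPass]

end Adequacy

/-! ### Reasoning about loops and passes -/

/-- Both orientations of every token, in the order in which `Prog.pass` visits them. -/
def darts (ts : List (ℕ × ℕ)) : List (ℕ × ℕ) :=
  ts.flatMap fun t => [(t.1, t.2), (t.2, t.1)]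

/-- Invariant rule for `forDown`: `I j` holds when the iterations from `c - 1` to `j` are over. The
equation `hp` allows `p` to be a named program. -/
theorem run_forDown_inv (E : Env) (p : Prog) {x : ℕ} {e : Expr} {b : Prog}
    (hp : p = .forDown x e b) (m : Store) (I : ℕ → Store → Prop) {c : ℕ} (hc : ev m e = c)
    (hcV : c < E.V) (h0 : I c (m.upd x 0 c))
    (hstep : ∀ j < c, ∀ m' : Store, (∀ k ∉ x :: b.writes, m' k = m k) → I (j + 1) m' →
      I j (run E b (m'.upd x 0 j))) : I 0 (run E p m) := by
  subst hp
  simp only [run, hc, Nat.mod_eq_of_lt hcV]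
  have key : ∀ j ≤ c, ∀ m' : Store, (∀ k ∉ x :: b.writes, m' k = m k) → I j m' →
      I 0 (iterDown (fun j m => run E b (m.upd x 0 j)) j m') := by
    intro j
    induction j with
    | zero => intro _ m' _ h; exact h
    | succ j ih =>
      intro hj m' hm' h
      refine ih (by omega) _ ?_ (hstep j (by omega) m' hm' h)
      intro k hk
      have hk' := hk
      simp only [List.mem_cons, not_or] at hk
      change run E b (m'.upd x 0 j) k = m k
      rw [run_frame E b _ hk.2, Store.upd_of_ne _ _ _ hk.1, hm' k hk']
  refine key c le_rfl _ ?_ h0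
  intro k hk
  simp only [List.mem_cons, not_or] at hk
  rw [Store.upd_of_ne _ _ _ hk.1]

/-- Invariant rule for `pass`: `I l` holds when the darts in `l` have been processed. It must not
depend on array `3`, which the pass itself writes to. -/
theorem run_pass_inv (E : Env) (p : Prog) {b : Prog} (hp : p = .pass b) (m : Store)
    (I : List (ℕ × ℕ) → Store → Prop)
    (h3 : ∀ l m i v, I l m → I l (m.upd 3 i v)) (h0 : I [] m)
    (hstep : ∀ l x y, l ++ [(x, y)] <+: darts E.input → ∀ m' : Store,
      (∀ k ∉ 3 :: 4 :: 5 :: b.writes, m' k = m k) → I l m' →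
      I (l ++ [(x, y)]) (run E b ((m'.upd 4 0 x).upd 5 0 y))) :
    I (darts E.input) (run E p m) := by
  subst hp
  simp only [run]
  have fr : ∀ (m' : Store) (k i v : ℕ), k = 3 ∨ k = 4 ∨ k = 5 →
      (∀ k ∉ 3 :: 4 :: 5 :: b.writes, m' k = m k) →
      (∀ k' ∉ 3 :: 4 :: 5 :: b.writes, m'.upd k i v k' = m k') := by
    intro m' k i v hk h k' hk'
    have := hk'
    simp only [List.mem_cons, not_or] at hk'
    rw [Store.upd_of_ne _ _ _ (by omega), h k' this]
  have frb : ∀ m' : Store, (∀ k ∉ 3 :: 4 :: 5 :: b.writes, m' k = m k) →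
      (∀ k ∉ 3 :: 4 :: 5 :: b.writes, run E b m' k = m k) := by
    intro m' h k' hk'
    rw [run_frame E b _ (by simp only [List.mem_cons, not_or] at hk'; exact hk'.2.2.2), h k' hk']
  have key : ∀ (ts : List (ℕ × ℕ)) (l : List (ℕ × ℕ)), l ++ darts ts = darts E.input →
      ∀ m' : Store, (∀ k ∉ 3 :: 4 :: 5 :: b.writes, m' k = m k) → I l m' →
      I (darts E.input) (passRun (run E b) ts m') := by
    intro ts
    induction ts with
    | nil =>
      intro l hl m' hm' h
      simp only [darts, List.flatMap_nil, List.append_nil] at hl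
      simp only [passRun]
      rw [← darts] at hl
      subst hl
      exact h3 _ _ _ _ h
    | cons t ts ih =>
      intro l hl m' hm' h
      have hd : darts (t :: ts) = (t.1, t.2) :: (t.2, t.1) :: darts ts := rfl
      rw [hd] at hl
      simp only [passRun]
      have hm1 := fr _ 3 2 t.2 (by simp) (fr _ 3 1 t.1 (by simp) (fr _ 3 0 1 (by simp) hm'))
      have h1 := hstep l t.1 t.2 ⟨(t.2, t.1) :: darts ts, by simpa using hl⟩ _ hm1
        (h3 _ _ _ _ (h3 _ _ _ _ (h3 _ _ _ _ h)))
      have hm2 := frb _ (fr _ 5 0 t.2 (by simp) (fr _ 4 0 t.1 (by simp) hm1))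
      have h2 := hstep (l ++ [(t.1, t.2)]) t.2 t.1 ⟨darts ts, by simpa using hl⟩ _ hm2 h1
      refine ih (l ++ [(t.1, t.2)] ++ [(t.2, t.1)]) (by simpa using hl) _ ?_ h2
      exact frb _ (fr _ 5 0 t.1 (by simp) (fr _ 4 0 t.2 (by simp) hm2))
  exact key E.input [] rfl m (fun _ _ => rfl) h0

theorem np_forDown_le (E : Env) (p : Prog) {x : ℕ} {e : Expr} {b : Prog}
    (hp : p = .forDown x e b) (m : Store) (f : ℕ → ℕ) {c : ℕ}
    (hc : ev m e = c) (hcV : c < E.V)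
    (hstep : ∀ j < c, ∀ m' : Store, (∀ k ∉ x :: b.writes, m' k = m k) →
      np E b (m'.upd x 0 j) ≤ f j) :
    np E p m ≤ ∑ j ∈ Finset.range c, f j := by
  subst hp
  simp only [np, hc, Nat.mod_eq_of_lt hcV]
  have key : ∀ j ≤ c, ∀ m' : Store, (∀ k ∉ x :: b.writes, m' k = m k) →
      sumDown (fun j m => run E b (m.upd x 0 j)) (fun j m => np E b (m.upd x 0 j)) j m' ≤
        ∑ i ∈ Finset.range j, f i := by
    intro j
    induction j with
    | zero => intro _ m' _; exact le_rfl
    | succ j ih =>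
      intro hj m' hm'
      simp only [sumDown]
      rw [Finset.sum_range_succ, add_comm]
      refine add_le_add (ih (by omega) _ ?_) (hstep j (by omega) m' hm')
      intro k hk
      have hk' := hk
      simp only [List.mem_cons, not_or] at hk
      change run E b (m'.upd x 0 j) k = m k
      rw [run_frame E b _ hk.2, Store.upd_of_ne _ _ _ hk.1, hm' k hk']
  refine key c le_rfl _ ?_
  intro k hk
  simp only [List.mem_cons, not_or] at hk
  rw [Store.upd_of_ne _ _ _ hk.1]

theorem upd_lt {m : Store} {V : ℕ} (h : ∀ k i, m k i < V) {v : ℕ} (hv : v < V) (k i : ℕ) :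
    ∀ k' i', m.upd k i v k' i' < V := by
  intro k' i'
  unfold Store.upd
  split_ifs
  · exact hv
  · exact h k' i'

/-- All cells stay below `E.V`. -/
theorem run_lt {E : Env} (hV : 1 < E.V) (hin : ∀ t ∈ E.input, t.1 < E.V ∧ t.2 < E.V) (p : Prog)
    {m : Store} (h : ∀ k i, m k i < E.V) : ∀ k i, run E p m k i < E.V := by
  have hmod : ∀ a, a % E.V < E.V := fun a => Nat.mod_lt _ (by omega)
  induction p generalizing m with
  | set k i e => exact upd_lt h (hmod _) _ _
  | seq p q ihp ihq => exact ihq (ihp h)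
  | onlyIf e p ih =>
    simp only [run]
    split_ifs
    · exact h
    · exact ih h
  | forDown x e b ih =>
    have key : ∀ c < E.V, ∀ m : Store, (∀ k i, m k i < E.V) →
        ∀ k i, iterDown (fun j m => run E b (m.upd x 0 j)) c m k i < E.V := by
      intro c
      induction c with
      | zero => intro _ m h; exact h
      | succ j ihj => intro hj m h; exact ihj (by omega) _ (ih (upd_lt h (by omega) _ _))
    exact key _ (hmod _) _ (upd_lt h (hmod _) _ _)
  | pass b ih =>
    have key : ∀ ts : List (ℕ × ℕ), (∀ t ∈ ts, t.1 < E.V ∧ t.2 < E.V) → ∀ m : Store,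
        (∀ k i, m k i < E.V) → ∀ k i, passRun (run E b) ts m k i < E.V := by
      intro ts
      induction ts with
      | nil => intro _ m h; exact upd_lt h (by omega) _ _
      | cons t ts iht =>
        intro hts m h
        have ht := hts t (by simp)
        refine iht (fun t ht => hts t (by simp [ht])) _ (ih (upd_lt (upd_lt (ih ?_) ht.2 _ _) ht.1 _ _))
        exact upd_lt (upd_lt (upd_lt (upd_lt (upd_lt h hV _ _) ht.1 _ _) ht.2 _ _) ht.1 _ _) ht.2 _ _
    exact key _ hin _ h

/-! ### The coloring program -/

instance : Add Expr := ⟨.add⟩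
instance : Sub Expr := ⟨.sub⟩
instance : Mul Expr := ⟨.mul⟩
instance : Div Expr := ⟨.div⟩
instance : Mod Expr := ⟨.mod⟩
instance (c : ℕ) : OfNat Expr c := ⟨.const c⟩

/-- The scalar variable `k`, kept in cell `0` of array `k`. -/
def rd (k : ℕ) : Expr := .get k (.const 0)

/-- Assignment to the scalar variable `k`. -/
def assign (k : ℕ) (e : Expr) : Prog := .set k (.const 0) e

/-- Nonzero if and only if `a < b`. -/
def ltE (a b : Expr) : Expr := b - a
/-- Nonzero if and only if `a ≤ b`. -/
def leE (a b : Expr) : Expr := b + 1 - a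
/-- Nonzero if and only if `a = b`. -/
def eqE (a b : Expr) : Expr := 1 - ((a - b) + (b - a))
/-- Nonzero if and only if `a = 0`. -/
def notE (a : Expr) : Expr := 1 - a

section ev
variable (m : Store) (a b e : Expr) (k : ℕ)
@[simp] theorem ev_add : ev m (a + b) = ev m a + ev m b := rfl
@[simp] theorem ev_sub : ev m (a - b) = ev m a - ev m b := rfl
@[simp] theorem ev_mul : ev m (a * b) = ev m a * ev m b := rfl
@[simp] theorem ev_div : ev m (a / b) = ev m a / ev m b := rfl
@[simp] theorem ev_mod : ev m (a % b) = ev m a % ev m b := rfl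
@[simp] theorem ev_zero : ev m (0 : Expr) = 0 := rfl
@[simp] theorem ev_one : ev m (1 : Expr) = 1 := rfl
@[simp] theorem ev_two : ev m (2 : Expr) = 2 := rfl
@[simp] theorem ev_three : ev m (3 : Expr) = 3 := rfl
@[simp] theorem ev_four : ev m (4 : Expr) = 4 := rfl
@[simp] theorem ev_eight : ev m (8 : Expr) = 8 := rfl
@[simp] theorem ev_const (c : ℕ) : ev m (.const c) = c := rfl
@[simp] theorem ev_get : ev m (.get k e) = m k (ev m e) := rfl
@[simp] theorem ev_rd : ev m (rd k) = m k 0 := rfl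
@[simp] theorem ev_ltE : ev m (ltE a b) = 0 ↔ ¬ ev m a < ev m b := by
  simp only [ltE, ev_sub]; omega
@[simp] theorem ev_leE : ev m (leE a b) = 0 ↔ ¬ ev m a ≤ ev m b := by
  simp only [leE, ev_sub, ev_add, ev_one]; omega
@[simp] theorem ev_eqE : ev m (eqE a b) = 0 ↔ ¬ ev m a = ev m b := by
  simp only [eqE, ev_sub, ev_add, ev_one]; omega
@[simp] theorem ev_notE : ev m (notE a) = 0 ↔ ¬ ev m a = 0 := by
  simp only [notE, ev_sub, ev_one]; omega
end ev

section run
variable (E : Env) (m : Store)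
@[simp] theorem run_assign (k : ℕ) (e : Expr) :
    run E (assign k e) m = m.upd k 0 (ev m e % E.V) := by simp [run, assign]
@[simp] theorem run_set (k : ℕ) (i e : Expr) :
    run E (.set k i e) m = m.upd k (ev m i % E.N) (ev m e % E.V) := rfl
@[simp] theorem run_seq (p q : Prog) : run E (.seq p q) m = run E q (run E p m) := rfl
@[simp] theorem run_onlyIf (e : Expr) (p : Prog) :
    run E (.onlyIf e p) m = if ev m e = 0 then m else run E p m := rfl
end run

infixr:50 " ;; " => Prog.seq

-- Numbers of the arrays and of the scalar variables. Array `0` holds the input `n`, array `1` the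
-- output, and array `3` is reserved for the token that has been read last. `aDone v` is nonzero if `v`
-- has been colored. The vertex `v` proposes the colors congruent to `aRes v` modulo `aMod`, and
-- `aBranch` is the number of refinements of such a set. The slacks of the refinements of `v` are in
-- row `aRank v` of the table `aSlack`, and their sum is in `aTotal v`.
notation "aVert" => 0
notation "aCol" => 1
notation "aSize" => 2
notation "aX" => 4
notation "aY" => 5
notation "aDone" => 6
notation "aDeg" => 7
notation "aMax" => 8
notation "aLog" => 9
notation "aPrime" => 10
notation "aBranch" => 11
notation "aRank" => 12
notation "aRes" => 13
notation "aMod" => 14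
notation "aSlack" => 15
notation "aTotal" => 16
notation "aPick" => 17
notation "aScore" => 18
notation "aScore₂" => 19
notation "aBest" => 20
notation "aBest₂" => 21
notation "aKeep" => 22
notation "aSrc" => 23
notation "aDst" => 24
notation "aCount" => 25
notation "aV" => 26
notation "aJ" => 27
notation "aC" => 28
notation "aA" => 29
notation "aB" => 30
notation "aUnit" => 31
notation "aAcc" => 32
notation "aFlag" => 33
notation "aI" => 34
notation "aStage" => 35
notation "aRep" => 36
notation "aBlock" => 37
notation "aWeight" => 38

/-- Computes the degrees, the maximum degree `Δ`, the binary length `ℓ` of `Δ`, and the bound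
`8 (n + 1) (ℓ + 1) + 3` on the indices that `mainProg` uses. -/
def preludeProg : Prog :=
  .pass (.set aDeg (rd aX) (.get aDeg (rd aX) + 1)) ;;
  .forDown aV (rd aVert)
    (.onlyIf (ltE (rd aMax) (.get aDeg (rd aV))) (assign aMax (.get aDeg (rd aV)))) ;;
  assign aMod 1 ;;
  .forDown aV (rd aVert) (.onlyIf (leE (rd aMod) (rd aMax))
    (assign aMod (rd aMod * 2) ;; assign aLog (rd aLog + 1))) ;;
  assign aSize (8 * (rd aVert + 1) * (rd aLog + 1) + 3)

/-- Clears the flag if `c` has a divisor `j` with `1 < j < c`. -/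
def divisorProg : Prog :=
  .forDown aJ (rd aC) (.onlyIf (ltE 1 (rd aJ) * eqE (rd aC % rd aJ) 0) (assign aFlag 0))

/-- Finds a prime `p` with `m < p ≤ 2 m`, where `m = 4 (n + 1) (ℓ + 1)`, by trial division. Since
`p` exceeds `n`, the hash functions modulo `p` are pairwise independent on the vertices, and since it
exceeds `4 n (ℓ + 1)`, rounding to multiples of `1 / p` does no harm. -/
def primeProg : Prog :=
  .forDown aV (4 * (rd aVert + 1) * (rd aLog + 1))
    (assign aC (4 * (rd aVert + 1) * (rd aLog + 1) + 1 + rd aV) ;;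
    assign aFlag 1 ;; divisorProg ;; .onlyIf (rd aFlag) (assign aPrime (rd aC)))

/-- Numbers the uncolored vertices, and lets every vertex propose all colors. -/
def initProg : Prog :=
  assign aCount 0 ;;
  .forDown aV (rd aVert)
    (.onlyIf (notE (.get aDone (rd aV)))
      (.set aRank (rd aV) (rd aCount) ;; assign aCount (rd aCount + 1)) ;;
    .set aRes (rd aV) 0) ;;
  assign aMod 1

/-- The cell for branch `j` of vertex `x` in the table of slacks. -/
def cellE (x j : Expr) : Expr := .get aRank x * rd aBranch + j

/-- Counts the colors of branch `j` at the vertex `v`. -/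
def slackCellProg : Prog :=
  .forDown aC (rd aMax + 1)
    (.onlyIf (eqE (rd aC % (rd aMod * rd aBranch)) (.get aRes (rd aV) + rd aJ * rd aMod))
      (.set aSlack (cellE (rd aV) (rd aJ)) (.get aSlack (cellE (rd aV) (rd aJ)) + 1)))

/-- Counts the colors of all branches at the vertex `v`. -/
def slackRowProg : Prog :=
  .forDown aJ (rd aBranch) (.set aSlack (cellE (rd aV) (rd aJ)) 0 ;; slackCellProg)

/-- Decrements the slack of the branch at `x` to which the color of `y` belongs. -/
def slackDartProg : Prog :=
  .forDown aJ (rd aBranch)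
    (.onlyIf (eqE (.get aCol (rd aY) % (rd aMod * rd aBranch)) (.get aRes (rd aX) + rd aJ * rd aMod))
      (.set aSlack (cellE (rd aX) (rd aJ)) (.get aSlack (cellE (rd aX) (rd aJ)) - 1)))

/-- Computes the slacks of the refinements of the proposed sets of colors. -/
def slackProg : Prog :=
  .forDown aV (rd aVert) (.onlyIf (notE (.get aDone (rd aV))) slackRowProg) ;;
  .pass (.onlyIf (notE (.get aDone (rd aX)) * .get aDone (rd aY)) slackDartProg)

/-- Sums the slacks of all refinements of the vertex `v`. -/
def totalRowProg : Prog :=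
  .forDown aJ (rd aBranch)
    (.set aTotal (rd aV) (.get aTotal (rd aV) + .get aSlack (cellE (rd aV) (rd aJ))))

/-- Sums the slacks of all refinements, for every vertex. -/
def totalProg : Prog :=
  .forDown aV (rd aVert) (.set aTotal (rd aV) 0 ;; totalRowProg)

/-- Finds the refinement of the vertex `v` whose interval contains the number in `aUnit`. -/
def pickRowProg : Prog :=
  .forDown aJ (rd aBranch)
    (.onlyIf (leE (rd aAcc) (rd aUnit)) (.set aPick (rd aV) (rd aJ)) ;;
    assign aAcc (rd aAcc + .get aSlack (cellE (rd aV) (rd aJ))))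

/-- Evaluates, for every vertex, the refinement that the hash function `x ↦ a x + b` selects. -/
def pickProg : Prog :=
  .forDown aV (rd aVert)
    (assign aAcc 0 ;;
    assign aUnit ((rd aA * rd aV + rd aB) % rd aPrime % .get aTotal (rd aV)) ;; pickRowProg)

/-- Adds the weight of the dart `(x, y)` under the hash function `x ↦ a x + b` to the scores. -/
def scoreCellProg : Prog :=
  pickProg ;;
  .onlyIf (eqE (.get aPick (rd aX)) (.get aPick (rd aY)))
    (assign aWeight (rd aPrime / .get aSlack (cellE (rd aX) (.get aPick (rd aX)))) ;;
    .set aScore (rd aA) (.get aScore (rd aA) + rd aWeight) ;;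
    .onlyIf (eqE (rd aA) (rd aBest)) (.set aScore₂ (rd aB) (.get aScore₂ (rd aB) + rd aWeight)))

/-- Adds the weights of the dart `(x, y)` under all hash functions with the coefficient `a` to the
scores. -/
def scoreRowProg : Prog :=
  .forDown aB (rd aPrime) scoreCellProg

/-- Adds the weights of the dart `(x, y)` under all hash functions to the scores. -/
def scoreDartProg : Prog :=
  .forDown aA (rd aPrime) scoreRowProg

/-- The potential of the hash functions: summed over all `b` for every `a`, and for the current best
`a` for every `b`. The first run serves to find the best `a`, the second one the best `b`. -/
def scoreProg : Prog :=
  .forDown aI (rd aPrime) (.set aScore (rd aI) 0 ;; .set aScore₂ (rd aI) 0) ;;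
  .pass (.onlyIf (notE (.get aDone (rd aX)) * (notE (.get aDone (rd aY)) *
      eqE (.get aRes (rd aX)) (.get aRes (rd aY))))
    scoreDartProg)

/-- Stores in `dst` the position of the least of the first `p` cells of the array `src`. -/
def argminProg (src dst : ℕ) : Prog :=
  assign dst 0 ;;
  .forDown aI (rd aPrime) (.onlyIf (ltE (.get src (rd aI)) (.get src (rd dst))) (assign dst (rd aI)))

/-- Replaces the proposed sets by the refinements that the best hash function selects. -/
def refineProg : Prog :=
  assign aA (rd aBest) ;; assign aB (rd aBest₂) ;; pickProg ;;
  .forDown aV (rd aVert)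
    (.set aRes (rd aV) (.get aRes (rd aV) + .get aPick (rd aV) * rd aMod)) ;;
  assign aMod (rd aMod * rd aBranch)

/-- One refinement of all proposed sets of colors. -/
def stageProg : Prog :=
  slackProg ;; totalProg ;;
  scoreProg ;; argminProg aScore aBest ;; scoreProg ;; argminProg aScore₂ aBest₂ ;; refineProg

/-- Colors every vertex with its proposed color unless a larger neighbor proposes the same. -/
def commitProg : Prog :=
  .forDown aV (rd aVert) (.set aKeep (rd aV) 1) ;;
  .pass (.onlyIf (notE (.get aDone (rd aX)) * (notE (.get aDone (rd aY)) *
      (eqE (.get aRes (rd aX)) (.get aRes (rd aY)) * ltE (rd aX) (rd aY))))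
    (.set aKeep (rd aX) 0)) ;;
  .forDown aV (rd aVert) (.onlyIf (notE (.get aDone (rd aV)) * .get aKeep (rd aV))
    (.set aCol (rd aV) (.get aRes (rd aV)) ;; .set aDone (rd aV) 1))

/-- Colors at least a quarter of the uncolored vertices. With the branching factor `2 ^ k`, where
`k = ℓ - aBlock`, the proposed sets are single colors after `ℓ / k + 1` stages. -/
def epochProg : Prog :=
  initProg ;;
  .forDown aStage (rd aLog / (rd aLog - rd aBlock) + 1) stageProg ;;
  commitProg

/-- Clears the flag if a neighbor of `v` has the color `c`. -/
def usedProg : Prog :=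
  .forDown aI (rd aCount)
    (.onlyIf (eqE (.get aSrc (rd aI)) (rd aV) * (.get aDone (.get aDst (rd aI)) *
      eqE (.get aCol (.get aDst (rd aI))) (rd aC))) (assign aFlag 0))

/-- Colors `v` with its least free color. -/
def greedyVertProg : Prog :=
  .forDown aC (rd aMax + 1)
    (assign aFlag 1 ;; usedProg ;; .onlyIf (rd aFlag) (.set aCol (rd aV) (rd aC)))

/-- Stores the edges at the remaining uncolored vertices, and colors these greedily. -/
def greedyProg : Prog :=
  assign aCount 0 ;;
  .pass (.onlyIf (notE (.get aDone (rd aX)))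
    (.set aSrc (rd aCount) (rd aX) ;; .set aDst (rd aCount) (rd aY) ;;
    assign aCount (rd aCount + 1))) ;;
  .forDown aV (rd aVert) (.onlyIf (notE (.get aDone (rd aV)))
    (greedyVertProg ;; .set aDone (rd aV) 1))

/-- Three epochs for each branching factor `2, 4, …, 2 ^ ℓ`, and a greedy completion. When `U` is
the set of uncolored vertices, the branching factor is at most `2 n / |U|`, so that the table of slacks
has at most `2 n` cells. -/
def mainProg : Prog :=
  primeProg ;; assign aBranch 1 ;;
  .forDown aBlock (rd aLog)
    (assign aBranch (rd aBranch * 2) ;; .forDown aRep 3 epochProg) ;;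
  greedyProg

theorem preludeProg_wf : preludeProg.wf = true := by decide
theorem mainProg_wf : mainProg.wf = true := by decide
theorem mainProg_writes_lt : ∀ k ∈ mainProg.writes, k < 39 := by decide

open Finset

/-! ### Correctness of the selection of refinements -/

theorem run_pickRowProg_of_ne {E : Env} {m : Store} {w : ℕ} (hvN : m aV 0 < E.N)
    (hBV : m aBranch 0 < E.V) (hw : w ≠ m aV 0) : run E pickRowProg m aPick w = m aPick w := by
  have key := run_forDown_inv E pickRowProg rfl m (c := m aBranch 0)
    (fun (_ : ℕ) (m' : Store) => m' aPick w = m aPick w)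
    rfl hBV (by simp [Store.upd]) <| by
    intro j hj m' hfr h
    have f26 := hfr aV (by decide)
    simp only [run_seq, run_onlyIf]
    split_ifs <;> simp [Store.upd, f26, h, Nat.mod_eq_of_lt hvN, hw]
  exact key

theorem run_pickRowProg {E : Env} {m : Store} {v u B : ℕ} {T : ℕ → ℕ} (hv : m aV 0 = v)
    (hvN : v < E.N) (hacc : m aAcc 0 = 0) (hu : m aUnit 0 = u) (hB : m aBranch 0 = B)
    (hB0 : 0 < B) (hBV : B < E.V) (hT : ∀ j < B, m aSlack (m aRank v * B + j) = T j)
    (hsum : ∑ j ∈ range B, T j < E.V) : run E pickRowProg m aPick v = pick T B u := by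
  have key := run_forDown_inv E pickRowProg rfl m (c := B)
    (fun (j : ℕ) (m' : Store) => m' aAcc 0 = ∑ i ∈ Ico j B, T i ∧
      (j < B → ∑ i ∈ Ico (m' aPick v + 1) B, T i ≤ u ∧
        ∀ i, j ≤ i → i < m' aPick v → u < ∑ k ∈ Ico (i + 1) B, T k))
    (by simpa using hB) hBV (by simp [Store.upd, hacc]) <| by
    rintro j hj m' hfr ⟨h1, h2⟩
    have f26 := hfr aV (by decide)
    have f31 := hfr aUnit (by decide)
    have f11 := hfr aBranch (by decide)
    have f12 := hfr aRank (by decide)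
    have f15 := hfr aSlack (by decide)
    have hTj := hT j hj
    have hle : ∑ i ∈ Ico j B, T i ≤ ∑ i ∈ range B, T i := by
      rw [range_eq_Ico]
      exact sum_le_sum_of_subset (Ico_subset_Ico_left (Nat.zero_le _))
    have hsj := sum_eq_sum_Ico_succ_bot hj T
    by_cases hc : ∑ i ∈ Ico (j + 1) B, T i ≤ u
    · simp [cellE, Store.upd, f26, f31, f11, f12, f15, hv, hu, hB, h1, hc, hTj,
        Nat.mod_eq_of_lt hvN, Nat.mod_eq_of_lt (hj.trans hBV)]
      refine ⟨?_, fun _ i h1 h2 => by omega⟩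
      rw [add_comm, ← hsj, Nat.mod_eq_of_lt (by omega)]
    · simp [cellE, Store.upd, f26, f31, f11, f12, f15, hv, hu, hB, h1, hc, hTj]
      refine ⟨by rw [add_comm, ← hsj, Nat.mod_eq_of_lt (by omega)], fun _ => ?_⟩
      have hj' : j + 1 < B := by
        by_contra h
        rw [Ico_eq_empty (by omega)] at hc
        simp at hc
      refine ⟨(h2 hj').1, fun i hi hi' => ?_⟩
      rcases hi.eq_or_lt with rfl | hi
      · omega
      · exact (h2 hj').2 i hi hi'
  obtain ⟨h4, h5⟩ := key.2 hB0
  exact (pick_eq h4 (fun i hi => h5 i (Nat.zero_le _) hi)).symm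

theorem run_pickProg {E : Env} {m : Store} {n p a b B : ℕ} {T : ℕ → ℕ → ℕ} (hn : m aVert 0 = n)
    (hnN : n ≤ E.N) (hnV : n < E.V) (hp : m aPrime 0 = p) (hp0 : 0 < p) (hpV : p < E.V)
    (ha : m aA 0 = a) (hb : m aB 0 = b) (hB : m aBranch 0 = B) (hB0 : 0 < B) (hBV : B < E.V)
    {v : ℕ} (hv : v < n) (hT : ∀ j < B, m aSlack (m aRank v * B + j) = T v j)
    (hsum : ∑ j ∈ range B, T v j < E.V) (htot : m aTotal v = ∑ j ∈ range B, T v j) :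
    run E pickProg m aPick v = choice p B T a b v := by
  have key := run_forDown_inv E pickProg rfl m (c := n)
    (fun (j : ℕ) (m' : Store) => j ≤ v → m' aPick v = choice p B T a b v)
    (by simpa using hn) hnV (by omega) <| by
    intro j hj m' hfr h hjv
    have f29 := hfr aA (by decide)
    have f30 := hfr aB (by decide)
    have f10 := hfr aPrime (by decide)
    have f16 := hfr aTotal (by decide)
    have f11 := hfr aBranch (by decide)
    have f12 := hfr aRank (by decide)
    have f15 := hfr aSlack (by decide)
    simp only [run_seq]
    rcases hjv.eq_or_lt with rfl | hjv
    · refine run_pickRowProg (by simp [Store.upd]) (hj.trans_le hnN) (by simp [Store.upd]) ?_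
        (by simpa [Store.upd, f11] using hB) hB0 hBV
        (by simpa [Store.upd, f15, f12] using hT) hsum
      simp only [run_assign, ev_mod, ev_add, ev_mul, ev_rd, ev_get]
      simp only [Store.upd, f29, f30, f10, f16, ha, hb, hp]
      simp [htot]
      refine Nat.mod_eq_of_lt (lt_of_le_of_lt (Nat.mod_le _ _) ?_)
      exact (Nat.mod_lt _ hp0).trans hpV
    · rw [run_pickRowProg_of_ne]
      · simpa [Store.upd] using h (by omega)
      · simpa [Store.upd] using hj.trans_le hnN
      · simpa [Store.upd, f11, hB] using hBV
      · simp [Store.upd]; omega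
  exact key (Nat.zero_le _)

/-! ### Correctness of the table of slacks -/

theorem run_totalRowProg {E : Env} {m : Store} {v B : ℕ} {T : ℕ → ℕ} (hv : m aV 0 = v)
    (hvN : v < E.N) (htot : m aTotal v = 0) (hB : m aBranch 0 = B) (hBV : B < E.V)
    (hT : ∀ j < B, m aSlack (m aRank v * B + j) = T j) (hsum : ∑ j ∈ range B, T j < E.V) :
    run E totalRowProg m aTotal v = ∑ j ∈ range B, T j := by
  have key := run_forDown_inv E totalRowProg rfl m (c := B)
    (fun (j : ℕ) (m' : Store) => m' aTotal v = ∑ i ∈ Ico j B, T i)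
    (by simpa using hB) hBV (by simp [Store.upd, htot]) <| by
    intro j hj m' hfr h
    have f26 := hfr aV (by decide)
    have f11 := hfr aBranch (by decide)
    have f12 := hfr aRank (by decide)
    have f15 := hfr aSlack (by decide)
    have hle : ∑ i ∈ Ico j B, T i ≤ ∑ i ∈ range B, T i := by
      rw [range_eq_Ico]
      exact sum_le_sum_of_subset (Ico_subset_Ico_left (Nat.zero_le _))
    have hsj := sum_eq_sum_Ico_succ_bot hj T
    simp [cellE, Store.upd, f26, f11, f12, f15, hv, hB, h, hT j hj, Nat.mod_eq_of_lt hvN]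
    rw [add_comm, ← hsj, Nat.mod_eq_of_lt (by omega)]
  rw [range_eq_Ico]
  exact key

theorem run_totalRowProg_of_ne {E : Env} {m : Store} {w : ℕ} (hvN : m aV 0 < E.N)
    (hBV : m aBranch 0 < E.V) (hw : w ≠ m aV 0) : run E totalRowProg m aTotal w = m aTotal w := by
  have key := run_forDown_inv E totalRowProg rfl m (c := m aBranch 0)
    (fun (_ : ℕ) (m' : Store) => m' aTotal w = m aTotal w)
    rfl hBV (by simp [Store.upd]) <| by
    intro j hj m' hfr h
    have f26 := hfr aV (by decide)
    simp [Store.upd, f26, h, Nat.mod_eq_of_lt hvN, hw]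
  exact key

theorem run_totalProg {E : Env} {m : Store} {n B : ℕ} {T : ℕ → ℕ} (hn : m aVert 0 = n)
    (hnN : n ≤ E.N) (hnV : n < E.V) (hB : m aBranch 0 = B) (hBV : B < E.V)
    {v : ℕ} (hv : v < n) (hT : ∀ j < B, m aSlack (m aRank v * B + j) = T j)
    (hsum : ∑ j ∈ range B, T j < E.V) :
    run E totalProg m aTotal v = ∑ j ∈ range B, T j := by
  have key := run_forDown_inv E totalProg rfl m (c := n)
    (fun (j : ℕ) (m' : Store) => j ≤ v → m' aTotal v = ∑ j ∈ range B, T j)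
    (by simpa using hn) hnV (by omega) <| by
    intro j hj m' hfr h hjv
    have f11 := hfr aBranch (by decide)
    have f12 := hfr aRank (by decide)
    have f15 := hfr aSlack (by decide)
    have hjN := hj.trans_le hnN
    simp only [run_seq]
    rcases hjv.eq_or_lt with rfl | hjv
    · exact run_totalRowProg (by simp [Store.upd]) hjN (by simp [Store.upd, Nat.mod_eq_of_lt hjN])
        (by simpa [Store.upd, f11] using hB) hBV
        (by simpa [Store.upd, f15, f12] using hT) hsum
    · rw [run_totalRowProg_of_ne]
      · have : v ≠ j := by omega
        simpa [Store.upd, Nat.mod_eq_of_lt hjN, this] using h (by omega)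
      · simpa [Store.upd] using hjN
      · simpa [Store.upd, f11, hB] using hBV
      · simp [Store.upd]; omega
  exact key (Nat.zero_le _)

theorem cell_inj {B r r' i i' : ℕ} (hi : i < B) (hi' : i' < B) (h : r * B + i = r' * B + i') :
    r = r' := by
  have hB : 0 < B := by omega
  have h1 := congrArg (· / B) h
  simpa only [Nat.add_comm (_ * B), Nat.add_mul_div_right _ _ hB,
    Nat.div_eq_of_lt hi, Nat.div_eq_of_lt hi', zero_add] using h1

theorem run_slackCellProg {E : Env} {m : Store} {Δ B M r i₀ : ℕ} (hΔ : m aMax 0 = Δ)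
    (hΔV : Δ + 1 < E.V) (hB : m aBranch 0 = B) (hM : m aMod 0 = M)
    (hr : m aRes (m aV 0) + m aJ 0 * M = r) (hi₀ : m aRank (m aV 0) * B + m aJ 0 = i₀)
    (hi₀N : i₀ < E.N) (h0 : m aSlack i₀ = 0) :
    run E slackCellProg m aSlack i₀ = #{c ∈ range (Δ + 1) | c % (M * B) = r} ∧
      ∀ i, i ≠ i₀ → run E slackCellProg m aSlack i = m aSlack i := by
  have key := run_forDown_inv E slackCellProg rfl m (c := Δ + 1)
    (fun c m' => m' aSlack i₀ = #{k ∈ Ico c (Δ + 1) | k % (M * B) = r} ∧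
      ∀ i, i ≠ i₀ → m' aSlack i = m aSlack i)
    (by simpa using hΔ) hΔV (by simp [Store.upd, h0]) <| by
    rintro c hc m' hfr ⟨h1, h2⟩
    have f26 := hfr aV (by decide)
    have f27 := hfr aJ (by decide)
    have f11 := hfr aBranch (by decide)
    have f12 := hfr aRank (by decide)
    have f13 := hfr aRes (by decide)
    have f14 := hfr aMod (by decide)
    have hle : #{k ∈ Ico (c + 1) (Δ + 1) | k % (M * B) = r} ≤ Δ := by
      refine (card_filter_le _ _).trans ?_
      simp
    rw [← insert_Ico_add_one_left_eq_Ico hc, filter_insert]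
    by_cases hcr : c % (M * B) = r
    · rw [if_pos hcr, card_insert_of_notMem (by simp)]
      simp [cellE, Store.upd, f26, f27, f11, f12, f13, f14, hB, hM, hr, hi₀, hcr, h1,
        Nat.mod_eq_of_lt hi₀N]
      refine ⟨Nat.mod_eq_of_lt (by omega), fun i hi => ?_⟩
      rw [if_neg hi, h2 i hi]
    · rw [if_neg hcr]
      simp [Store.upd, f26, f27, f11, f13, f14, hB, hM, hr, hcr, h1]
      exact h2
  rw [range_eq_Ico]
  exact key

/-- The number of colors congruent to `r` modulo `M`. -/
def numColors (Δ M r : ℕ) : ℕ := #{c ∈ range (Δ + 1) | c % M = r}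

theorem numColors_lt {Δ M r V : ℕ} (h : Δ + 1 < V) : numColors Δ M r < V := by
  refine lt_of_le_of_lt ((card_filter_le _ _).trans ?_) h
  simp

theorem run_slackRowProg {E : Env} {m : Store} {Δ B M v : ℕ} (hΔ : m aMax 0 = Δ)
    (hΔV : Δ + 1 < E.V) (hB : m aBranch 0 = B) (hBV : B < E.V) (hM : m aMod 0 = M)
    (hv : m aV 0 = v) (hN : m aRank v * B + B ≤ E.N) :
    (∀ j < B, run E slackRowProg m aSlack (m aRank v * B + j) =
      numColors Δ (M * B) (m aRes v + j * M)) ∧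
      ∀ i, (∀ j < B, i ≠ m aRank v * B + j) → run E slackRowProg m aSlack i = m aSlack i := by
  have key := run_forDown_inv E slackRowProg rfl m (c := B)
    (fun k m' => (∀ j < B, k ≤ j → m' aSlack (m aRank v * B + j) =
      numColors Δ (M * B) (m aRes v + j * M)) ∧
      ∀ i, (∀ j < B, i ≠ m aRank v * B + j) → m' aSlack i = m aSlack i)
    (by simpa using hB) hBV ⟨by omega, by simp [Store.upd]⟩ <| by
    rintro k hk m' hfr ⟨h1, h2⟩
    have f8 := hfr aMax (by decide)
    have f26 := hfr aV (by decide)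
    have f11 := hfr aBranch (by decide)
    have f12 := hfr aRank (by decide)
    have f13 := hfr aRes (by decide)
    have f14 := hfr aMod (by decide)
    have hi : m aRank v * B + k < E.N := by omega
    simp only [run_seq]
    obtain ⟨s1, s2⟩ := run_slackCellProg (E := E) (Δ := Δ) (B := B) (M := M)
      (r := m aRes v + k * M) (i₀ := m aRank v * B + k)
      (m := run E (.set aSlack (cellE (rd aV) (rd aJ)) 0) (m'.upd aJ 0 k))
      (by simpa [Store.upd, f8] using hΔ) hΔV (by simpa [Store.upd, f11] using hB)
      (by simpa [Store.upd, f14] using hM) (by simp [Store.upd, f26, f13, hv])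
      (by simp [Store.upd, f26, f12, hv]) hi
      (by simp [cellE, Store.upd, f26, f12, f11, hv, hB, Nat.mod_eq_of_lt hi])
    constructor
    · intro j hj hkj
      rcases hkj.eq_or_lt with rfl | hkj
      · exact s1
      · rw [s2 _ (by omega)]
        have : j ≠ k := by omega
        simp [cellE, Store.upd, f26, f12, f11, hv, hB, Nat.mod_eq_of_lt hi, this]
        exact h1 j hj hkj
    · intro i hij
      have := hij k hk
      rw [s2 _ this]
      simp [cellE, Store.upd, f26, f12, f11, hv, hB, Nat.mod_eq_of_lt hi, this]
      exact h2 i hij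
  exact ⟨fun j hj => key.1 j hj (Nat.zero_le _), key.2⟩

theorem run_slackDartProg {E : Env} {m : Store} {B M x y : ℕ}
    (hB : m aBranch 0 = B) (hBV : B < E.V) (hM : m aMod 0 = M) (hV : ∀ i, m aSlack i < E.V)
    (hx : m aX 0 = x) (hy : m aY 0 = y) (hN : m aRank x * B + B ≤ E.N) :
    (∀ j < B, run E slackDartProg m aSlack (m aRank x * B + j) = m aSlack (m aRank x * B + j) -
      if m aCol y % (M * B) = m aRes x + j * M then 1 else 0) ∧
      ∀ i, (∀ j < B, i ≠ m aRank x * B + j) → run E slackDartProg m aSlack i = m aSlack i := by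
  have key := run_forDown_inv E slackDartProg rfl m (c := B)
    (fun k m' => (∀ j < B, m' aSlack (m aRank x * B + j) = m aSlack (m aRank x * B + j) -
      if k ≤ j ∧ m aCol y % (M * B) = m aRes x + j * M then 1 else 0) ∧
      ∀ i, (∀ j < B, i ≠ m aRank x * B + j) → m' aSlack i = m aSlack i)
    (by simpa using hB) hBV ⟨by
      intro j hj
      rw [if_neg (by omega)]
      simp [Store.upd], by simp [Store.upd]⟩ <| by
    rintro k hk m' hfr ⟨h1, h2⟩
    have f1 := hfr aCol (by decide)
    have f4 := hfr aX (by decide)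
    have f5 := hfr aY (by decide)
    have f11 := hfr aBranch (by decide)
    have f12 := hfr aRank (by decide)
    have f13 := hfr aRes (by decide)
    have f14 := hfr aMod (by decide)
    have hi : m aRank x * B + k < E.N := by omega
    by_cases hc : m aCol y % (M * B) = m aRes x + k * M
    · simp [cellE, Store.upd, f1, f4, f5, f11, f12, f13, f14, hx, hy, hB, hM, eq_true hc,
        Nat.mod_eq_of_lt hi]
      constructor
      · intro j hj
        rcases eq_or_ne j k with rfl | hjk
        · rw [if_pos rfl, h1 j hj, if_neg (by omega), if_pos ⟨le_rfl, hc⟩]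
          exact Nat.mod_eq_of_lt (lt_of_le_of_lt (by omega) (hV (m aRank x * B + j)))
        · rw [if_neg hjk, h1 j hj]
          congr 2
          simp only [eq_iff_iff, and_congr_left_iff]
          omega
      · intro i hij
        rw [if_neg (hij k hk), h2 i hij]
    · simp [Store.upd, f1, f4, f5, f11, f13, f14, hx, hy, hB, hM, hc]
      refine ⟨?_, h2⟩
      intro j hj
      rw [h1 j hj]
      rcases eq_or_ne j k with rfl | hjk
      · rw [if_neg (by omega), if_neg (by tauto)]
      · congr 2
        simp only [eq_iff_iff, and_congr_left_iff]
        omega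
  refine ⟨fun j hj => ?_, key.2⟩
  rw [key.1 j hj]
  simp

/-- The uncolored vertices. -/
def undone (n : ℕ) (m : Store) : Finset ℕ := {v ∈ range n | m aDone v = 0}

theorem mem_undone {n v : ℕ} {m : Store} : v ∈ undone n m ↔ v < n ∧ m aDone v = 0 := by
  simp [undone]

/-- The uncolored vertices have distinct ranks, and the rows of the table of slacks that belong to these
ranks, `B` cells each, lie in the first `N` cells. -/
structure Ranked (n N B : ℕ) (m : Store) : Prop where
  inj : ∀ v w, v ∈ undone n m → w ∈ undone n m → m aRank v = m aRank w → v = w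
  le : ∀ v ∈ undone n m, m aRank v * B + B ≤ N

theorem run_slackProg {E : Env} {m : Store} {n Δ B M : ℕ} (hn : m aVert 0 = n) (hnV : n < E.V)
    (hΔ : m aMax 0 = Δ) (hΔV : Δ + 1 < E.V) (hB : m aBranch 0 = B) (hBV : B < E.V)
    (hM : m aMod 0 = M) (hR : Ranked n E.N B m) (hlt : ∀ d ∈ darts E.input, d.1 < n ∧ d.2 < n)
    (hnd : (darts E.input).Nodup) (hV : ∀ i, m aSlack i < E.V)
    {v j : ℕ} (hv : v ∈ undone n m) (hj : j < B) :
    run E slackProg m aSlack (m aRank v * B + j) =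
      slack (darts E.input).toFinset (undone n m) (m aCol) Δ (M * B) (m aRes v + j * M) v := by
  set p₁ : Prog := .forDown aV (rd aVert) (.onlyIf (notE (.get aDone (rd aV))) slackRowProg) with hp₁
  set p₂ : Prog := .pass (.onlyIf (notE (.get aDone (rd aX)) * .get aDone (rd aY)) slackDartProg)
    with hp₂
  have sep : ∀ v ∈ undone n m, ∀ w ∈ undone n m, v ≠ w → ∀ i < B, ∀ i' < B,
      m aRank v * B + i ≠ m aRank w * B + i' := by
    intro v hv w hw hvw i hi i' hi' h
    exact hvw (hR.inj v w hv hw (cell_inj hi hi' h))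
  have key₁ := run_forDown_inv E p₁ rfl m (c := n)
    (fun k m' => (∀ i, m' aSlack i < E.V) ∧ ∀ v ∈ undone n m, k ≤ v → ∀ j < B,
      m' aSlack (m aRank v * B + j) = numColors Δ (M * B) (m aRes v + j * M))
    (by simpa using hn) hnV ⟨by simpa [Store.upd] using hV, by
      intro v hv hkv
      have := (mem_undone.1 hv).1
      omega⟩ <| by
    rintro k hk m' hfr ⟨h0, h1⟩
    have f6 := hfr aDone (by decide)
    have f8 := hfr aMax (by decide)
    have f11 := hfr aBranch (by decide)
    have f12 := hfr aRank (by decide)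
    have f13 := hfr aRes (by decide)
    have f14 := hfr aMod (by decide)
    by_cases hc : m aDone k = 0
    · have hku : k ∈ undone n m := mem_undone.2 ⟨hk, hc⟩
      obtain ⟨s1, s2⟩ := run_slackRowProg (E := E) (Δ := Δ) (B := B) (M := M) (v := k)
        (m := m'.upd aV 0 k) (by simpa [Store.upd, f8] using hΔ) hΔV
        (by simpa [Store.upd, f11] using hB) hBV (by simpa [Store.upd, f14] using hM)
        (by simp [Store.upd]) (by simpa [Store.upd, f12] using hR.le k hku)
      have e12 : m'.upd aV 0 k aRank = m aRank := by rw [Store.upd_of_ne _ _ _ (by decide), f12]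
      have e13 : m'.upd aV 0 k aRes = m aRes := by rw [Store.upd_of_ne _ _ _ (by decide), f13]
      have e15 : m'.upd aV 0 k aSlack = m' aSlack := by rw [Store.upd_of_ne _ _ _ (by decide)]
      rw [e12, e13] at s1
      rw [e12, e15] at s2
      simp only [run_onlyIf, ev_notE, ev_get, ev_rd]
      rw [if_neg (by simpa [Store.upd, f6] using hc)]
      constructor
      · intro i
        by_cases hi : ∀ j < B, i ≠ m aRank k * B + j
        · rw [s2 i hi]; exact h0 i
        · push Not at hi
          obtain ⟨j, hj, rfl⟩ := hi
          rw [s1 j hj]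
          exact numColors_lt hΔV
      · intro v hv hkv j hj
        rcases hkv.eq_or_lt with rfl | hkv
        · exact s1 j hj
        · rw [s2 _ (fun i hi => sep v hv k hku (by omega) j hj i hi)]
          exact h1 v hv hkv j hj
    · simp only [run_onlyIf, ev_notE, ev_get, ev_rd]
      rw [if_pos (by simpa [Store.upd, f6] using hc)]
      refine ⟨by simpa [Store.upd] using h0, fun v hv hkv j hj => ?_⟩
      have : v ≠ k := by
        rintro rfl
        exact hc (mem_undone.1 hv).2
      simpa [Store.upd] using h1 v hv (by omega) j hj
  have fr : ∀ k ∉ p₁.writes, run E p₁ m k = m k := fun k hk => run_frame E p₁ m hk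
  have key₂ := run_pass_inv E p₂ rfl (run E p₁ m)
    (fun l m' => (∀ i, m' aSlack i < E.V) ∧ ∀ v ∈ undone n m, ∀ j < B,
      m' aSlack (m aRank v * B + j) = numColors Δ (M * B) (m aRes v + j * M) -
        l.countP (fun d => d.1 = v ∧ m aDone d.2 ≠ 0 ∧ m aCol d.2 % (M * B) = m aRes v + j * M))
    (fun l m i v h => by simpa [Store.upd] using h)
    ⟨key₁.1, fun v hv j hj => by rw [key₁.2 v hv (Nat.zero_le _) j hj]; simp⟩ <| by
    rintro l x y hl m' hfr ⟨h0, h1⟩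
    have f1 := (hfr aCol (by decide)).trans (fr aCol (by decide))
    have f6 := (hfr aDone (by decide)).trans (fr aDone (by decide))
    have f11 := (hfr aBranch (by decide)).trans (fr aBranch (by decide))
    have f12 := (hfr aRank (by decide)).trans (fr aRank (by decide))
    have f13 := (hfr aRes (by decide)).trans (fr aRes (by decide))
    have f14 := (hfr aMod (by decide)).trans (fr aMod (by decide))
    have hxn := hlt (x, y) (hl.subset (by simp))
    simp only [run_onlyIf, List.countP_append, List.countP_singleton]
    by_cases hc : m aDone x = 0 ∧ m aDone y ≠ 0
    · have hxu : x ∈ undone n m := mem_undone.2 ⟨hxn.1, hc.1⟩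
      rw [if_neg (by simpa [Store.upd, f6] using hc)]
      obtain ⟨s1, s2⟩ := run_slackDartProg (E := E) (B := B) (M := M) (x := x) (y := y)
        (m := (m'.upd aX 0 x).upd aY 0 y) (by simpa [Store.upd, f11] using hB) hBV
        (by simpa [Store.upd, f14] using hM) (by simpa [Store.upd] using h0)
        (by simp [Store.upd]) (by simp [Store.upd])
        (by simpa [Store.upd, f12] using hR.le x hxu)
      have e : ∀ k, k ≠ 4 → k ≠ 5 → (m'.upd aX 0 x).upd aY 0 y k = m' k := fun k h4 h5 => by
        rw [Store.upd_of_ne _ _ _ h5, Store.upd_of_ne _ _ _ h4]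
      rw [e 1 (by decide) (by decide), e 12 (by decide) (by decide), e 13 (by decide) (by decide),
        e 15 (by decide) (by decide), f1, f12, f13] at s1
      rw [e 12 (by decide) (by decide), e 15 (by decide) (by decide), f12] at s2
      constructor
      · intro i
        by_cases hi : ∀ j < B, i ≠ m aRank x * B + j
        · rw [s2 i hi]; exact h0 i
        · push Not at hi
          obtain ⟨j, hj, rfl⟩ := hi
          rw [s1 j hj]
          exact (Nat.sub_le _ _).trans_lt (h0 _)
      · intro v hv j hj
        by_cases hvx : v = x
        · subst hvx
          -- Truncated decrements add up to a single truncated subtraction.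
          rw [s1 j hj, h1 v hv j hj, Nat.sub_sub]
          simp [hc.2]
        · rw [s2 _ (fun i hi => sep v hv x hxu hvx j hj i hi), h1 v hv j hj]
          have : x ≠ v := fun h => hvx h.symm
          simp [this]
    · rw [if_pos (by
        simp only [ev_mul, mul_eq_zero, ev_notE, ev_get, ev_rd]
        simp only [Store.upd, f6]
        simp
        tauto)]
      refine ⟨by simpa [Store.upd] using h0, fun v hv j hj => ?_⟩
      have := h1 v hv j hj
      have h2 : ¬ (x = v ∧ m aDone y ≠ 0 ∧ m aCol y % (M * B) = m aRes v + j * M) := by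
        rintro ⟨rfl, h, -⟩
        exact hc ⟨(mem_undone.1 hv).2, h⟩
      simp [Store.upd, h2, this]
  refine (key₂.2 v hv j hj).trans ?_
  unfold slack numColors
  congr 1
  rw [List.countP_eq_length_filter, ← List.toFinset_card_of_nodup (hnd.filter _),
    List.toFinset_filter]
  congr 1
  ext d
  simp only [mem_filter, List.mem_toFinset, mem_undone, decide_eq_true_eq]
  constructor
  · rintro ⟨h1, h2, h3, h4⟩
    exact ⟨h1, h2, fun h => h3 h.2, h4⟩
  · rintro ⟨h1, h2, h3, h4⟩
    exact ⟨h1, h2, fun h => h3 ⟨(hlt d h1).2, h⟩, h4⟩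

/-! ### Correctness of the search for a hash function -/

/-- The table of slacks and its row sums are set up, with the contents `T`. -/
structure Table (E : Env) (n p B : ℕ) (T : ℕ → ℕ → ℕ) (m : Store) : Prop where
  vert : m aVert 0 = n
  prime : m aPrime 0 = p
  branch : m aBranch 0 = B
  n_le : n ≤ E.N
  n_lt : n < E.V
  p_pos : 0 < p
  p_le : p ≤ E.N
  p_lt : p < E.V
  B_pos : 0 < B
  B_lt : B < E.V
  slack : ∀ v ∈ undone n m, ∀ j < B, m aSlack (m aRank v * B + j) = T v j
  sum_lt : ∀ v ∈ undone n m, ∑ j ∈ range B, T v j < E.V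
  total : ∀ v ∈ undone n m, m aTotal v = ∑ j ∈ range B, T v j

section

variable {E : Env} {n p B : ℕ} {T : ℕ → ℕ → ℕ} {m m' : Store}

theorem undone_congr (h : m' aDone = m aDone) : undone n m' = undone n m := by
  unfold undone
  rw [h]

theorem Table.congr (h : Table E n p B T m)
    (hm : ∀ k ∈ [aVert, aDone, aPrime, aBranch, aRank, aSlack, aTotal], m' k = m k) :
    Table E n p B T m' := by
  simp only [List.mem_cons, List.not_mem_nil, or_false, forall_eq_or_imp, forall_eq] at hm
  obtain ⟨h0, h6, h10, h11, h12, h15, h16⟩ := hm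
  constructor
  · rw [h0]; exact h.vert
  · rw [h10]; exact h.prime
  · rw [h11]; exact h.branch
  · exact h.n_le
  · exact h.n_lt
  · exact h.p_pos
  · exact h.p_le
  · exact h.p_lt
  · exact h.B_pos
  · exact h.B_lt
  · rw [undone_congr h6, h12, h15]; exact h.slack
  · rw [undone_congr h6]; exact h.sum_lt
  · rw [undone_congr h6, h16]; exact h.total

theorem Table.run_pickProg (h : Table E n p B T m) {v : ℕ} (hv : v ∈ undone n m) :
    run E pickProg m aPick v = choice p B T (m aA 0) (m aB 0) v :=
  Streaming.run_pickProg h.vert h.n_le h.n_lt h.prime h.p_pos h.p_lt rfl rfl h.branch h.B_pos h.B_lt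
    (mem_undone.1 hv).1 (h.slack v hv) (h.sum_lt v hv) (h.total v hv)

theorem choice_lt {a b v : ℕ} (hT : 0 < ∑ j ∈ range B, T v j) : choice p B T a b v < B :=
  pick_lt (Nat.mod_lt _ hT)

/-- The scores are followed modulo `E.V` only: that they stay below `E.V` is known when the pass is
complete and the whole sums can be estimated. -/
theorem Table.run_scoreCellProg (h : Table E n p B T m)
    (hT : ∀ v ∈ undone n m, 0 < ∑ j ∈ range B, T v j) {x y a b : ℕ} (hx : x ∈ undone n m)
    (hy : y ∈ undone n m) (hmx : m aX 0 = x) (hmy : m aY 0 = y) (ha : m aA 0 = a) (hb : m aB 0 = b)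
    (hap : a < p) (hbp : b < p) (i : ℕ) :
    run E scoreCellProg m aScore i ≡
        m aScore i + (if i = a then weight p B T a b (x, y) else 0) [MOD E.V] ∧
      run E scoreCellProg m aScore₂ i ≡
        m aScore₂ i + (if i = b ∧ a = m aBest 0 then weight p B T a b (x, y) else 0) [MOD E.V] := by
  have fr : ∀ k ∉ pickProg.writes, run E pickProg m k = m k := fun k hk => run_frame E pickProg m hk
  have f4 := fr aX (by decide)
  have f5 := fr aY (by decide)
  have f10 := fr aPrime (by decide)
  have f11 := fr aBranch (by decide)
  have f12 := fr aRank (by decide)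
  have f15 := fr aSlack (by decide)
  have f18 := fr aScore (by decide)
  have f19 := fr aScore₂ (by decide)
  have f20 := fr aBest (by decide)
  have f29 := fr aA (by decide)
  have f30 := fr aB (by decide)
  have jx := h.run_pickProg hx
  have jy := h.run_pickProg hy
  rw [ha, hb] at jx jy
  have haN : a % E.N = a := Nat.mod_eq_of_lt (hap.trans_le h.p_le)
  have hbN : b % E.N = b := Nat.mod_eq_of_lt (hbp.trans_le h.p_le)
  have hw : p / T x (choice p B T a b x) < E.V := (Nat.div_le_self _ _).trans_lt h.p_lt
  have hsl := h.slack x hx _ (choice_lt (p := p) (a := a) (b := b) (hT x hx))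
  unfold weight
  by_cases hc : choice p B T a b x = choice p B T a b y
  · by_cases hab : a = m aBest 0
    · simp only [scoreCellProg, run_seq, run_onlyIf, ev_eqE, ev_get, ev_rd, f4, f5, hmx, hmy, jx, jy,
        hc, not_true_eq_false, if_false, run_assign, run_set, ev_div, ev_add, cellE, ev_mul]
      rw [hc] at hsl jx
      rw [hc] at hw
      simp [Store.upd, f10, f11, f12, f15, f18, f19, f20, f29, f30, ha, hb, haN, hbN,
        h.branch, h.prime, hsl, Nat.mod_eq_of_lt hw, ← hab]
      constructor
      · split_ifs with h1
        · subst h1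
          simp [Nat.ModEq]
        · rfl
      · split_ifs with h1
        · subst h1
          simp [Nat.ModEq]
        · rfl
    · have hab' : a ≠ m aBest 0 := hab
      simp only [scoreCellProg, run_seq, run_onlyIf, ev_eqE, ev_get, ev_rd, f4, f5, hmx, hmy, jx, jy,
        hc, not_true_eq_false, if_false, run_assign, run_set, ev_div, ev_add, cellE, ev_mul]
      rw [hc] at hsl jx
      rw [hc] at hw
      simp [Store.upd, f10, f11, f12, f15, f18, f19, f20, f29, ha, haN,
        h.branch, h.prime, hsl, Nat.mod_eq_of_lt hw, hab']
      constructor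
      · split_ifs with h1
        · subst h1
          simp [Nat.ModEq]
        · rfl
      · rfl
  · simp [scoreCellProg, f4, f5, hmx, hmy, jx, jy, hc, f18, f19, Nat.ModEq]

theorem Table.run_scoreRowProg (h : Table E n p B T m)
    (hT : ∀ v ∈ undone n m, 0 < ∑ j ∈ range B, T v j) {x y a : ℕ} (hx : x ∈ undone n m)
    (hy : y ∈ undone n m) (hmx : m aX 0 = x) (hmy : m aY 0 = y) (ha : m aA 0 = a)
    (hap : a < p) (i : ℕ) :
    run E scoreRowProg m aScore i ≡
        m aScore i + (if i = a then ∑ b ∈ range p, weight p B T a b (x, y) else 0) [MOD E.V] ∧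
      run E scoreRowProg m aScore₂ i ≡
        m aScore₂ i + (if i < p ∧ a = m aBest 0 then weight p B T a i (x, y) else 0) [MOD E.V] := by
  have key := run_forDown_inv E scoreRowProg rfl m (c := p)
    (fun k m' => m' aScore i ≡
        m aScore i + (if i = a then ∑ b ∈ Ico k p, weight p B T a b (x, y) else 0) [MOD E.V] ∧
      m' aScore₂ i ≡ m aScore₂ i +
        (if k ≤ i ∧ i < p ∧ a = m aBest 0 then weight p B T a i (x, y) else 0) [MOD E.V])
    (by simpa using h.prime) h.p_lt (by
      have : ¬ (p ≤ i ∧ i < p ∧ a = m 20 0) := by omega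
      simp [Store.upd, this, Nat.ModEq]) <| by
    rintro k hk m' hfr ⟨h1, h2⟩
    have f6 : m'.upd aB 0 k aDone = m aDone := by
      rw [Store.upd_of_ne _ _ _ (by decide), hfr aDone (by decide)]
    have hT' : Table E n p B T (m'.upd aB 0 k) := h.congr (by
      intro k' hk'
      have h27 : k' ≠ 30 := by rintro rfl; revert hk'; decide
      rw [Store.upd_of_ne _ _ _ h27]
      refine hfr k' ?_
      clear * - hk'
      revert k'
      decide)
    have f4 := hfr aX (by decide)
    have f5 := hfr aY (by decide)
    have f20 := hfr aBest (by decide)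
    have f29 := hfr aA (by decide)
    obtain ⟨s1, s2⟩ := hT'.run_scoreCellProg (x := x) (y := y) (a := a) (b := k)
      (by rw [undone_congr f6]; exact hT) (by rwa [undone_congr f6]) (by rwa [undone_congr f6])
      (by simpa [Store.upd, f4] using hmx) (by simpa [Store.upd, f5] using hmy)
      (by simpa [Store.upd, f29] using ha) (by simp [Store.upd]) hap hk i
    have e18 : m'.upd aB 0 k aScore i = m' aScore i := by simp [Store.upd]
    have e19 : m'.upd aB 0 k aScore₂ i = m' aScore₂ i := by simp [Store.upd]
    have e20 : m'.upd aB 0 k aBest 0 = m aBest 0 := by simp [Store.upd, f20]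
    rw [e18] at s1
    rw [e19, e20] at s2
    constructor
    · refine s1.trans ((h1.add_right _).trans ?_)
      split_ifs with hi
      · rw [sum_eq_sum_Ico_succ_bot hk, add_assoc, add_comm (weight _ _ _ _ _ _)]
      · rfl
    · refine s2.trans ((h2.add_right _).trans ?_)
      by_cases hik : i = k
      · subst hik
        simp [hk, Nat.ModEq]
      · have : (k + 1 ≤ i ∧ i < p ∧ a = m aBest 0) ↔ (k ≤ i ∧ i < p ∧ a = m aBest 0) := by omega
        simp only [hik, this, false_and, if_false, add_zero]
        rfl
  rw [range_eq_Ico]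
  simpa using key

theorem Table.run_scoreDartProg (h : Table E n p B T m)
    (hT : ∀ v ∈ undone n m, 0 < ∑ j ∈ range B, T v j) {x y : ℕ} (hx : x ∈ undone n m)
    (hy : y ∈ undone n m) (hmx : m aX 0 = x) (hmy : m aY 0 = y) (i : ℕ) (hi : i < p) :
    run E scoreDartProg m aScore i ≡
        m aScore i + ∑ b ∈ range p, weight p B T i b (x, y) [MOD E.V] ∧
      (m aBest 0 < p → run E scoreDartProg m aScore₂ i ≡
        m aScore₂ i + weight p B T (m aBest 0) i (x, y) [MOD E.V]) := by
  have key := run_forDown_inv E scoreDartProg rfl m (c := p)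
    (fun k m' => m' aScore i ≡
        m aScore i + (if k ≤ i then ∑ b ∈ range p, weight p B T i b (x, y) else 0) [MOD E.V] ∧
      (m aBest 0 < p → m' aScore₂ i ≡ m aScore₂ i +
        (if k ≤ m aBest 0 then weight p B T (m aBest 0) i (x, y) else 0) [MOD E.V]))
    (by simpa using h.prime) h.p_lt (by
      refine ⟨?_, fun hb => ?_⟩
      · rw [if_neg (by omega)]
        simp [Store.upd, Nat.ModEq]
      · rw [if_neg (by omega)]
        simp [Store.upd, Nat.ModEq]) <| by
    rintro k hk m' hfr ⟨h1, h2⟩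
    have f6 : m'.upd aA 0 k aDone = m aDone := by
      rw [Store.upd_of_ne _ _ _ (by decide), hfr aDone (by decide)]
    have hT' : Table E n p B T (m'.upd aA 0 k) := h.congr (by
      intro k' hk'
      have h27 : k' ≠ 29 := by rintro rfl; revert hk'; decide
      rw [Store.upd_of_ne _ _ _ h27]
      refine hfr k' ?_
      clear * - hk'
      revert k'
      decide)
    have f4 := hfr aX (by decide)
    have f5 := hfr aY (by decide)
    have f20 := hfr aBest (by decide)
    obtain ⟨s1, s2⟩ := hT'.run_scoreRowProg (x := x) (y := y) (a := k)
      (by rw [undone_congr f6]; exact hT) (by rwa [undone_congr f6]) (by rwa [undone_congr f6])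
      (by simpa [Store.upd, f4] using hmx) (by simpa [Store.upd, f5] using hmy)
      (by simp [Store.upd]) hk i
    have e18 : m'.upd aA 0 k aScore i = m' aScore i := by simp [Store.upd]
    have e19 : m'.upd aA 0 k aScore₂ i = m' aScore₂ i := by simp [Store.upd]
    have e20 : m'.upd aA 0 k aBest 0 = m aBest 0 := by simp [Store.upd, f20]
    rw [e18] at s1
    rw [e19, e20] at s2
    constructor
    · refine s1.trans ((h1.add_right _).trans ?_)
      by_cases hik : i = k
      · subst hik
        simp [Nat.ModEq]
      · have : k + 1 ≤ i ↔ k ≤ i := by omega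
        simp [hik, this, Nat.ModEq]
    · intro hb
      refine s2.trans (((h2 hb).add_right _).trans ?_)
      by_cases hik : k = m aBest 0
      · rw [← hik]
        simp [hi, Nat.ModEq]
      · have : k + 1 ≤ m aBest 0 ↔ k ≤ m aBest 0 := by omega
        simp [hik, this, Nat.ModEq]
  refine ⟨by simpa using key.1, fun hb => by simpa using key.2 hb⟩

end

section

variable {E : Env} {n Δ ℓ p B M s : ℕ} {T : ℕ → ℕ → ℕ} {m m' : Store}

theorem sum_mono_le {U : Finset ℕ} {q : ℕ → ℕ} {A : Finset (ℕ × ℕ)}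
    (hlt : ∀ d ∈ A, d.1 < n ∧ d.2 < n) (f : ℕ × ℕ → ℕ) {c : ℕ} (hf : ∀ d, f d ≤ c) :
    ∑ d ∈ mono A U q, f d ≤ n * n * c := by
  calc ∑ d ∈ mono A U q, f d ≤ #(mono A U q) * c := by
        simpa using sum_le_card_nsmul (mono A U q) f c (fun d _ => hf d)
    _ ≤ #(range n ×ˢ range n) * c := by
        refine Nat.mul_le_mul_right _ (card_le_card fun d hd => ?_)
        have := hlt d (mem_filter.1 hd).1
        simpa using this
    _ = n * n * c := by simp

theorem weight_le (p B : ℕ) (T : ℕ → ℕ → ℕ) (a b : ℕ) (d : ℕ × ℕ) : weight p B T a b d ≤ p := by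
  unfold weight
  split_ifs
  · exact Nat.div_le_self _ _
  · exact Nat.zero_le _

theorem Table.run_scoreProg (h : Table E n p B T m)
    (hT : ∀ v ∈ undone n m, 0 < ∑ j ∈ range B, T v j)
    (hlt : ∀ d ∈ darts E.input, d.1 < n ∧ d.2 < n) (hnd : (darts E.input).Nodup)
    (hV : 1 < E.V) (hin : ∀ t ∈ E.input, t.1 < E.V ∧ t.2 < E.V) (hm : ∀ k i, m k i < E.V)
    (hbig : n * n * (p * p) < E.V) :
    (∀ i < p, run E scoreProg m aScore i =
      ∑ d ∈ mono (darts E.input).toFinset (undone n m) (m aRes), ∑ b ∈ range p, weight p B T i b d) ∧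
      (m aBest 0 < p → ∀ i < p, run E scoreProg m aScore₂ i =
        ∑ d ∈ mono (darts E.input).toFinset (undone n m) (m aRes), weight p B T (m aBest 0) i d) := by
  set p₁ : Prog := .forDown aI (rd aPrime) (.set aScore (rd aI) 0 ;; .set aScore₂ (rd aI) 0) with hp₁
  set p₂ : Prog := .pass (.onlyIf (notE (.get aDone (rd aX)) * (notE (.get aDone (rd aY)) *
      eqE (.get aRes (rd aX)) (.get aRes (rd aY)))) scoreDartProg) with hp₂
  have hrun : run E scoreProg m = run E p₂ (run E p₁ m) := rfl
  have key₁ := run_forDown_inv E p₁ rfl m (c := p)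
    (fun k m' => ∀ i < p, k ≤ i → m' aScore i = 0 ∧ m' aScore₂ i = 0)
    (by simpa using h.prime) h.p_lt (by intro i hi hi'; omega) <| by
    intro k hk m' hfr h' i hi hki
    have hkN : k % E.N = k := Nat.mod_eq_of_lt (hk.trans_le h.p_le)
    rcases hki.eq_or_lt with rfl | hki
    · simp [Store.upd, hkN]
    · have : i ≠ k := by omega
      simpa [Store.upd, hkN, this] using h' i hi hki
  have fr : ∀ k ∉ p₁.writes, run E p₁ m k = m k := fun k hk => run_frame E p₁ m hk
  let f : (ℕ × ℕ → ℕ) → ℕ × ℕ → ℕ := fun w d =>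
    if d.1 ∈ undone n m ∧ d.2 ∈ undone n m ∧ m aRes d.1 = m aRes d.2 then w d else 0
  have key₂ := run_pass_inv E p₂ rfl (run E p₁ m)
    (fun l m' => ∀ i < p,
      m' aScore i ≡ (l.map (f fun d => ∑ b ∈ range p, weight p B T i b d)).sum [MOD E.V] ∧
      (m aBest 0 < p →
        m' aScore₂ i ≡ (l.map (f fun d => weight p B T (m aBest 0) i d)).sum [MOD E.V]))
    (fun l m i v h => by simpa [Store.upd] using h)
    (fun i hi => by
      have := key₁ i hi (Nat.zero_le _)
      simp [this, Nat.ModEq]) <| by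
    intro l x y hl m' hfr h1 i hi
    have f6 := (hfr aDone (by decide)).trans (fr aDone (by decide))
    have f13 := (hfr aRes (by decide)).trans (fr aRes (by decide))
    have f20 := (hfr aBest (by decide)).trans (fr aBest (by decide))
    have hxn := hlt (x, y) (hl.subset (by simp))
    obtain ⟨h1a, h1b⟩ := h1 i hi
    simp only [run_onlyIf, List.map_append, List.map_singleton, List.sum_append, List.sum_singleton]
    by_cases hc : x ∈ undone n m ∧ y ∈ undone n m ∧ m aRes x = m aRes y
    · have hc1 := (mem_undone.1 hc.1).2
      have hc2 := (mem_undone.1 hc.2.1).2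
      rw [if_neg (by simp [Store.upd, f6, f13, hc1, hc2, hc.2.2])]
      have e6 : ((m'.upd aX 0 x).upd aY 0 y) aDone = m aDone := by
        rw [Store.upd_of_ne _ _ _ (by decide), Store.upd_of_ne _ _ _ (by decide), f6]
      have hT' : Table E n p B T ((m'.upd aX 0 x).upd aY 0 y) := h.congr (by
        intro k' hk'
        have h5 : k' ≠ 5 := by rintro rfl; revert hk'; decide
        have h4 : k' ≠ 4 := by rintro rfl; revert hk'; decide
        rw [Store.upd_of_ne _ _ _ h5, Store.upd_of_ne _ _ _ h4]
        refine (hfr k' ?_).trans (fr k' ?_) <;>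
        · clear * - hk'
          revert k'
          decide)
      obtain ⟨s1, s2⟩ := hT'.run_scoreDartProg (x := x) (y := y)
        (by rw [undone_congr e6]; exact hT) (by rw [undone_congr e6]; exact hc.1)
        (by rw [undone_congr e6]; exact hc.2.1) (by simp [Store.upd]) (by simp [Store.upd]) i hi
      have e18 : ((m'.upd aX 0 x).upd aY 0 y) aScore i = m' aScore i := by simp [Store.upd]
      have e19 : ((m'.upd aX 0 x).upd aY 0 y) aScore₂ i = m' aScore₂ i := by simp [Store.upd]
      have e20 : ((m'.upd aX 0 x).upd aY 0 y) aBest 0 = m aBest 0 := by simp [Store.upd, f20]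
      rw [e18] at s1
      rw [e19, e20] at s2
      simp only [f, hc, and_self, if_true]
      simp only [f] at h1a h1b
      exact ⟨s1.trans (h1a.add_right _), fun hb => (s2 hb).trans ((h1b hb).add_right _)⟩
    · rw [if_pos (by
        simp only [mem_undone, hxn, true_and] at hc
        simp only [ev_mul, mul_eq_zero, ev_notE, ev_get, ev_rd, ev_eqE]
        simp only [Store.upd, f6, f13]
        simp
        tauto)]
      have e1 : f (fun d => ∑ b ∈ range p, weight p B T i b d) (x, y) = 0 := if_neg hc
      have e2 : f (fun d => weight p B T (m aBest 0) i d) (x, y) = 0 := if_neg hc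
      rw [e1, e2]
      simpa [Store.upd] using And.intro h1a h1b
  have hrl : ∀ k i, run E scoreProg m k i < E.V := run_lt hV hin _ hm
  have hsum : ∀ w : ℕ × ℕ → ℕ, ((darts E.input).map (f w)).sum =
      ∑ d ∈ mono (darts E.input).toFinset (undone n m) (m aRes), w d := by
    intro w
    rw [← List.sum_toFinset _ hnd, mono, sum_filter]
  have hA : ∀ d ∈ (darts E.input).toFinset, d.1 < n ∧ d.2 < n := fun d hd =>
    hlt d (List.mem_toFinset.1 hd)
  -- Both sides of the congruences are below `E.V`, so that they are equalities.
  refine ⟨fun i hi => ?_, fun hb i hi => ?_⟩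
  · have := (key₂ i hi).1
    rw [hsum, ← hrun] at this
    refine Nat.ModEq.eq_of_lt_of_lt this (hrl _ _) (lt_of_le_of_lt ?_ hbig)
    refine sum_mono_le hA _ fun d => ?_
    simpa using sum_le_card_nsmul (range p) (fun b => weight p B T i b d) p
      (fun b _ => weight_le _ _ _ _ _ _)
  · have := (key₂ i hi).2 hb
    rw [hsum, ← hrun] at this
    refine Nat.ModEq.eq_of_lt_of_lt this (hrl _ _) (lt_of_le_of_lt ?_ hbig)
    exact sum_mono_le hA _ fun d => (weight_le _ _ _ _ _ _).trans (Nat.le_mul_of_pos_left _ h.p_pos)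

theorem run_argminProg {src dst : ℕ} (hp : m aPrime 0 = p) (hp0 : 0 < p) (hpV : p < E.V)
    (h1 : src ≠ dst) (h2 : src ≠ aI) (h3 : dst ≠ aI) (h4 : dst ≠ aPrime) :
    run E (argminProg src dst) m dst 0 < p ∧
      ∀ i < p, m src (run E (argminProg src dst) m dst 0) ≤ m src i := by
  set p₁ : Prog := .forDown aI (rd aPrime)
    (.onlyIf (ltE (.get src (rd aI)) (.get src (rd dst))) (assign dst (rd aI))) with hp₁
  have h1' := h1.symm
  have h2' := h2.symm
  have h4' := h4.symm
  have key := run_forDown_inv E p₁ rfl (m.upd dst 0 0) (c := p)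
    (fun k m' => m' dst 0 < p ∧ ∀ i < p, k ≤ i → m src (m' dst 0) ≤ m src i)
    (by simpa [Store.upd, h4'] using hp) hpV (by
      simp [Store.upd, h3, hp0]
      intro i hi hi'
      omega) <| by
    rintro k hk m' hfr ⟨s1, s2⟩
    have fs : m' src = m src := by
      rw [hfr src (by simp [Prog.writes, assign, h1, h2]), Store.upd_of_ne _ _ _ h1]
    have hkV : k % E.V = k := Nat.mod_eq_of_lt (hk.trans hpV)
    by_cases hc : m src k < m src (m' dst 0)
    · simp [Store.upd, fs, hc, h2, h3, hkV, hk]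
      intro i hi hki
      rcases hki.eq_or_lt with rfl | hki
      · exact le_rfl
      · exact hc.le.trans (s2 i hi hki)
    · simp [Store.upd, fs, hc, h2, h3, s1]
      intro i hi hki
      rcases hki.eq_or_lt with rfl | hki
      · exact not_lt.1 hc
      · exact s2 i hi hki
  have hrun : run E (argminProg src dst) m = run E p₁ (m.upd dst 0 0) := by
    simp [argminProg, hp₁]
  rw [hrun]
  exact ⟨key.1, fun i hi => key.2 i hi (Nat.zero_le _)⟩

theorem Table.run_refineProg (h : Table E n p B T m) {a b : ℕ} (ha : m aBest 0 = a)
    (hb : m aBest₂ 0 = b) (hap : a < p) (hbp : b < p) (hM : m aMod 0 = M) (hMB : M * B < E.V)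
    (hq : ∀ v ∈ undone n m, m aRes v < M) (hT : ∀ v ∈ undone n m, 0 < ∑ j ∈ range B, T v j) :
    run E refineProg m aMod 0 = M * B ∧ ∀ v ∈ undone n m,
      run E refineProg m aRes v = m aRes v + choice p B T a b v * M := by
  set p₁ : Prog := .forDown aV (rd aVert)
    (.set aRes (rd aV) (.get aRes (rd aV) + .get aPick (rd aV) * rd aMod)) with hp₁
  set m₁ : Store := (m.upd aA 0 a).upd aB 0 b with hm₁
  have haV : a % E.V = a := Nat.mod_eq_of_lt (hap.trans h.p_lt)
  have hbV : b % E.V = b := Nat.mod_eq_of_lt (hbp.trans h.p_lt)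
  have hrun : run E refineProg m =
      (run E p₁ (run E pickProg m₁)).upd aMod 0
        (run E p₁ (run E pickProg m₁) aMod 0 * run E p₁ (run E pickProg m₁) aBranch 0 % E.V) := by
    simp [refineProg, ha, haV, Store.upd_of_ne, hb, hbV, hm₁, hp₁]
  have fr : ∀ k ∉ pickProg.writes, k ≠ 29 → k ≠ 30 → run E pickProg m₁ k = m k := by
    intro k hk h29 h30
    rw [run_frame E pickProg m₁ hk, hm₁, Store.upd_of_ne _ _ _ h30, Store.upd_of_ne _ _ _ h29]
  have e6 : m₁ aDone = m aDone := by simp [hm₁, Store.upd_of_ne]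
  have hT' : Table E n p B T m₁ := h.congr (by
    intro k' hk'
    have h30 : k' ≠ 30 := by rintro rfl; revert hk'; decide
    have h29 : k' ≠ 29 := by rintro rfl; revert hk'; decide
    rw [hm₁, Store.upd_of_ne _ _ _ h30, Store.upd_of_ne _ _ _ h29])
  have hpick : ∀ v ∈ undone n m, run E pickProg m₁ aPick v = choice p B T a b v := by
    intro v hv
    have := hT'.run_pickProg (v := v) (by rwa [undone_congr e6])
    simpa [hm₁, Store.upd] using this
  have key := run_forDown_inv E p₁ rfl (run E pickProg m₁) (c := n)
    (fun k m' => ∀ v ∈ undone n m, m' aRes v =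
      m aRes v + if k ≤ v then choice p B T a b v * M else 0)
    (by simpa [fr aVert (by decide) (by decide) (by decide)] using h.vert) h.n_lt
    (by
      intro v hv
      rw [if_neg (by have := (mem_undone.1 hv).1; omega), Store.upd_of_ne _ _ _ (by decide),
        fr aRes (by decide) (by decide) (by decide), add_zero]) <| by
    intro k hk m' hfr h1 v hv
    have f14 := (hfr aMod (by decide)).trans (fr aMod (by decide) (by decide) (by decide))
    have f17 := hfr aPick (by decide)
    have hkN : k % E.N = k := Nat.mod_eq_of_lt (hk.trans_le h.n_le)
    by_cases hvk : v = k
    · subst hvk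
      have hlt : m aRes v + choice p B T a b v * M < E.V := by
        have h1 := hq v hv
        have h2 := choice_lt (p := p) (a := a) (b := b) (hT v hv)
        have h3 : (choice p B T a b v + 1) * M ≤ B * M := Nat.mul_le_mul_right M h2
        rw [add_mul] at h3
        rw [mul_comm M B] at hMB
        omega
      have := h1 v hv
      simp [Store.upd, hkN, f14, f17, hpick v hv, hM, this]
      exact Nat.mod_eq_of_lt hlt
    · have h2 : k + 1 ≤ v ↔ k ≤ v := by omega
      simp only [run_set, ev_rd, ev_add, ev_get, ev_mul]
      simp [Store.upd, hkN, hvk, h1 v hv]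
      by_cases h3 : k ≤ v
      · rw [if_pos h3, if_pos (by omega)]
      · rw [if_neg h3, if_neg (by omega)]
  constructor
  · rw [hrun, run_frame E p₁ _ (k := 14) (by decide), run_frame E p₁ _ (k := 11) (by decide),
      fr aMod (by decide) (by decide) (by decide), fr aBranch (by decide) (by decide) (by decide), hM,
      h.branch]
    simp [Store.upd, Nat.mod_eq_of_lt hMB]
  · intro v hv
    rw [hrun, Store.upd_of_ne _ _ _ (by decide), key v hv]
    simp

/-! ### Correctness of a stage -/

/-- The assumptions on the stream and on the parameters: the maximum degree is at most `Δ`, the binary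
length of `Δ` at most `ℓ`, and `p` is the modulus of the hash functions. The bound `big` keeps the scores
below `E.V`, and `pow_lt` the moduli of the proposed sets. -/
structure Sizes (E : Env) (n Δ ℓ p : ℕ) : Prop where
  dart : IsDartSet n Δ (darts E.input).toFinset
  nodup : (darts E.input).Nodup
  prime : p.Prime
  lt_p : 4 * (n + 1) * (ℓ + 1) < p
  Δ_lt : Δ < 2 ^ ℓ
  Δ_le : Δ ≤ n
  p_le : p ≤ E.N
  big : n * n * (p * p) < E.V
  p_lt : p < E.V
  pow_lt : 2 ^ (2 * ℓ) < E.V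
  input : ∀ t ∈ E.input, t.1 < E.V ∧ t.2 < E.V

theorem Sizes.darts_lt (h : Sizes E n Δ ℓ p) : ∀ d ∈ darts E.input, d.1 < n ∧ d.2 < n := by
  intro d hd
  have hd' := List.mem_toFinset.2 hd
  exact ⟨h.dart.lt d hd', h.dart.lt _ (h.dart.symm d hd')⟩

/-- The values of the scalar variables that are fixed after the prime has been found. -/
structure Ctx (E : Env) (n Δ ℓ p : ℕ) (m : Store) : Prop where
  vert : m aVert 0 = n
  max : m aMax 0 = Δ
  log : m aLog 0 = ℓ
  prime : m aPrime 0 = p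
  lt : ∀ k i, m k i < E.V

theorem Ctx.run (hS : Sizes E n Δ ℓ p) (h : Ctx E n Δ ℓ p m) (q : Prog)
    (hq : ∀ k ∈ q.writes, k ∉ [aVert, aMax, aLog, aPrime]) : Ctx E n Δ ℓ p (run E q m) := by
  have fr : ∀ k ∈ [aVert, aMax, aLog, aPrime], Streaming.run E q m k = m k := fun k hk =>
    run_frame E q m (fun h => hq k h hk)
  refine ⟨?_, ?_, ?_, ?_, ?_⟩
  · rw [fr aVert (by decide)]; exact h.vert
  · rw [fr aMax (by decide)]; exact h.max
  · rw [fr aLog (by decide)]; exact h.log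
  · rw [fr aPrime (by decide)]; exact h.prime
  · have := hS.p_lt
    have := hS.prime.two_le
    exact run_lt (by omega) hS.input q h.lt

/-- One stage preserves `Proposal`. -/
theorem run_stageProg (hS : Sizes E n Δ ℓ p) (hC : Ctx E n Δ ℓ p m) (hB : m aBranch 0 = B)
    (hB0 : 0 < B) (hM : m aMod 0 = M) (hMB : M * B < E.V) (hBV : B < E.V)
    (hR : Ranked n E.N B m)
    (hP : Proposal (darts E.input).toFinset (undone n m) (m aCol) Δ p M s (m aRes)) :
    run E stageProg m aMod 0 = M * B ∧
      Proposal (darts E.input).toFinset (undone n m) (m aCol) Δ p (M * B) (s + 1)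
        (run E stageProg m aRes) := by
  have hbig := hS.big
  have hpV := hS.p_lt
  have hlp := hS.lt_p
  have hp2 := hS.prime.two_le
  have hnp : 4 * (n + 1) ≤ p := by nlinarith
  have hΔ := hS.Δ_le
  set A := (darts E.input).toFinset with hA
  set U := undone n m with hU
  let T : ℕ → ℕ → ℕ := fun v j => slack A U (m aCol) Δ (M * B) (m aRes v + j * M) v
  have hTpos : ∀ v ∈ U, 0 < ∑ j ∈ range B, T v j := fun v hv =>
    (hP.pos v hv).trans_le (slack_le_sum v (hP.lt v hv) hB0)
  have hTlt : ∀ v ∈ U, ∑ j ∈ range B, T v j < E.V := by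
    intro v hv
    calc ∑ j ∈ range B, T v j
        ≤ ∑ j ∈ range B, #{c ∈ range (Δ + 1) | id c % (M * B) = m aRes v + j * M} :=
          sum_le_sum fun j _ => Nat.sub_le _ _
      _ = numColors Δ M (m aRes v) := sum_card_refine _ _ (hP.lt v hv) hB0
      _ < E.V := numColors_lt (by omega)
  set m₁ := run E slackProg m with hm₁
  set m₂ := run E totalProg m₁ with hm₂
  set m₃ := run E scoreProg m₂ with hm₃
  set m₄ := run E (argminProg aScore aBest) m₃ with hm₄
  set m₅ := run E scoreProg m₄ with hm₅
  set m₆ := run E (argminProg aScore₂ aBest₂) m₅ with hm₆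
  have hrun : run E stageProg m = run E refineProg m₆ := rfl
  have fr₁ : ∀ k ∉ slackProg.writes, m₁ k = m k := fun k hk => run_frame E _ _ hk
  have fr₂ : ∀ k ∉ totalProg.writes, m₂ k = m₁ k := fun k hk => run_frame E _ _ hk
  have fr₃ : ∀ k ∉ scoreProg.writes, m₃ k = m₂ k := fun k hk => run_frame E _ _ hk
  have fr₄ : ∀ k ∉ (argminProg aScore aBest).writes, m₄ k = m₃ k := fun k hk => run_frame E _ _ hk
  have fr₅ : ∀ k ∉ scoreProg.writes, m₅ k = m₄ k := fun k hk => run_frame E _ _ hk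
  have fr₆ : ∀ k ∉ (argminProg aScore₂ aBest₂).writes, m₆ k = m₅ k := fun k hk => run_frame E _ _ hk
  have hslack : ∀ v ∈ U, ∀ j < B, m₁ aSlack (m₁ aRank v * B + j) = T v j := by
    intro v hv j hj
    rw [fr₁ aRank (by decide)]
    exact run_slackProg hC.vert (by omega) hC.max (by omega) hB hBV hM hR hS.darts_lt hS.nodup
      (hC.lt _) hv hj
  have hV1 : 1 < E.V := by omega
  have hlt₂ : ∀ k i, m₂ k i < E.V := run_lt hV1 hS.input _ (run_lt hV1 hS.input _ hC.lt)
  have hpN := hS.p_le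
  -- The table of slacks is complete after `totalProg`, and the later parts of the stage preserve it.
  have hT₂ : Table E n p B T m₂ := by
    have e6 : m₂ aDone = m aDone := (fr₂ aDone (by decide)).trans (fr₁ aDone (by decide))
    refine ⟨?_, ?_, ?_, by omega, by omega, by omega, hpN, by omega, hB0, hBV, ?_, ?_, ?_⟩
    · rw [fr₂ aVert (by decide), fr₁ aVert (by decide)]; exact hC.vert
    · rw [fr₂ aPrime (by decide), fr₁ aPrime (by decide)]; exact hC.prime
    · rw [fr₂ aBranch (by decide), fr₁ aBranch (by decide)]; exact hB
    · rw [undone_congr e6, fr₂ aSlack (by decide), fr₂ aRank (by decide)]; exact hslack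
    · rw [undone_congr e6]; exact hTlt
    · rw [undone_congr e6]
      intro v hv
      exact run_totalProg (by rw [fr₁ aVert (by decide)]; exact hC.vert) (by omega) (by omega)
        (by rw [fr₁ aBranch (by decide)]; exact hB) hBV (mem_undone.1 hv).1 (hslack v hv) (hTlt v hv)
  have frk : ∀ k ∈ [aVert, aCol, aDone, aMax, aLog, aPrime, aBranch, aRank, aRes, aMod, aSlack, aTotal],
      m₄ k = m₂ k ∧ m₆ k = m₂ k := by
    intro k hk
    have h1 : m₄ k = m₂ k := by
      rw [fr₄ k (by clear * - hk; revert k; decide), fr₃ k (by clear * - hk; revert k; decide)]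
    refine ⟨h1, ?_⟩
    rw [fr₆ k (by clear * - hk; revert k; decide), fr₅ k (by clear * - hk; revert k; decide), h1]
  have hT₄ : Table E n p B T m₄ := hT₂.congr fun k hk => (frk k (by clear * - hk; revert k; decide)).1
  have hT₆ : Table E n p B T m₆ := hT₂.congr fun k hk => (frk k (by clear * - hk; revert k; decide)).2
  have u₂ : undone n m₂ = U := undone_congr ((fr₂ aDone (by decide)).trans (fr₁ aDone (by decide)))
  have u₄ : undone n m₄ = U := by rw [undone_congr (frk aDone (by decide)).1, u₂]
  have u₆ : undone n m₆ = U := by rw [undone_congr (frk aDone (by decide)).2, u₂]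
  have r₂ : m₂ aRes = m aRes := (fr₂ aRes (by decide)).trans (fr₁ aRes (by decide))
  have r₄ : m₄ aRes = m aRes := by rw [(frk aRes (by decide)).1, r₂]
  have r₆ : m₆ aRes = m aRes := by rw [(frk aRes (by decide)).2, r₂]
  have hlt₄ : ∀ k i, m₄ k i < E.V := run_lt hV1 hS.input _ (run_lt hV1 hS.input _ hlt₂)
  obtain ⟨sA, -⟩ := hT₂.run_scoreProg (by rw [u₂]; exact hTpos) hS.darts_lt hS.nodup hV1 hS.input hlt₂
    (by omega)
  obtain ⟨a1, a2⟩ := run_argminProg (E := E) (m := m₃) (p := p) (src := aScore) (dst := aBest)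
    (by rw [fr₃ aPrime (by decide)]; exact hT₂.prime) (by omega) (by omega)
    (by decide) (by decide) (by decide) (by decide)
  obtain ⟨-, sC⟩ := hT₄.run_scoreProg (by rw [u₄]; exact hTpos) hS.darts_lt hS.nodup hV1 hS.input hlt₄
    (by omega)
  obtain ⟨b1, b2⟩ := run_argminProg (E := E) (m := m₅) (p := p) (src := aScore₂) (dst := aBest₂)
    (by rw [fr₅ aPrime (by decide)]; exact hT₄.prime) (by omega) (by omega)
    (by decide) (by decide) (by decide) (by decide)
  rw [← hm₃, u₂, r₂] at sA
  rw [← hm₅, u₄, r₄] at sC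
  rw [← hm₄] at a1 a2
  rw [← hm₆] at b1 b2
  set a := m₄ aBest 0 with ha
  set b := m₆ aBest₂ 0 with hb
  have hab := score_le_of_argmin (B := B) hS.prime T (mono A U (m aRes)) (a := a) (b := b)
    (by
      intro d hd
      simp only [mono, mem_filter] at hd
      have h1 := hS.darts_lt d (List.mem_toFinset.1 hd.1)
      exact ⟨by omega, by omega, hS.dart.irrefl d hd.1, hTpos _ hd.2.1⟩)
    (fun a' ha' => by rw [← sA a a1, ← sA a' ha']; exact a2 a' ha')
    (fun b' hb' => by rw [← sC a1 b b1, ← sC a1 b' hb']; exact b2 b' hb')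
  obtain ⟨x1, x2⟩ := hT₆.run_refineProg (a := a) (b := b) (M := M)
    (by rw [fr₆ aBest (by decide), fr₅ aBest (by decide)]) rfl a1 b1
    (by rw [(frk aMod (by decide)).2, fr₂ aMod (by decide), fr₁ aMod (by decide)]; exact hM) hMB
    (by rw [u₆, r₆]; exact hP.lt) (by rw [u₆]; exact hTpos)
  rw [u₆, r₆] at x2
  rw [hrun]
  exact ⟨x1, hP.refine hS.dart hB0 (T := T) (fun x _ j _ => rfl) hab x2⟩

end

/-! ### Correctness of an epoch -/

section

variable {E : Env} {n Δ ℓ p B M s : ℕ} {m m' : Store}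

theorem run_initProg (hn : m aVert 0 = n) (hnN : n ≤ E.N) (hnV : n < E.V) (hV : 1 < E.V)
    (hB : #(undone n m) * B ≤ E.N) :
    Ranked n E.N B (run E initProg m) ∧ run E initProg m aMod 0 = 1 ∧
      ∀ v < n, run E initProg m aRes v = 0 := by
  set U := undone n m with hU
  set p₁ : Prog := .forDown aV (rd aVert)
    (.onlyIf (notE (.get aDone (rd aV)))
      (.set aRank (rd aV) (rd aCount) ;; assign aCount (rd aCount + 1)) ;;
    .set aRes (rd aV) 0) with hp₁
  have hrun : run E initProg m = (run E p₁ (m.upd aCount 0 0)).upd aMod 0 1 := by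
    simp [initProg, hp₁, Nat.mod_eq_of_lt hV]
  have hUn : ∀ v ∈ U, v < n := fun v hv => (mem_undone.1 hv).1
  have hUcard : #U ≤ n := by
    simpa using card_le_card (fun v hv => mem_range.2 (hUn v hv) : U ⊆ range n)
  have key := run_forDown_inv E p₁ rfl (m.upd aCount 0 0) (c := n)
    (fun k m' => m' aCount 0 = #{w ∈ U | k ≤ w} ∧
      (∀ v ∈ U, k ≤ v → m' aRank v = #{w ∈ U | v < w}) ∧ ∀ v < n, k ≤ v → m' aRes v = 0)
    (by simpa [Store.upd] using hn) hnV (by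
      refine ⟨?_, fun v hv hk => ?_, fun v hv hk => by omega⟩
      · have : {w ∈ U | n ≤ w} = ∅ := filter_eq_empty_iff.2 fun w hw => by
          have := hUn w hw
          omega
        simp [Store.upd, this]
      · have := hUn v hv
        omega) <| by
    rintro k hk m' hfr ⟨h1, h2, h3⟩
    have f6 := hfr aDone (by decide)
    rw [Store.upd_of_ne _ _ _ (by decide)] at f6
    have hkN : k % E.N = k := Nat.mod_eq_of_lt (hk.trans_le hnN)
    have hlt : ∀ v, #{w ∈ U | v < w} ≤ n := fun v => (card_filter_le _ _).trans hUcard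
    have e : {w ∈ U | k + 1 ≤ w} = {w ∈ U | k < w} := rfl
    by_cases hc : m aDone k = 0
    · have hkU : k ∈ U := mem_undone.2 ⟨hk, hc⟩
      have e' : {w ∈ U | k ≤ w} = insert k {w ∈ U | k < w} := by
        ext w
        simp only [mem_filter, mem_insert]
        constructor
        · rintro ⟨hw, hkw⟩
          rcases hkw.eq_or_lt with rfl | h
          · exact .inl rfl
          · exact .inr ⟨hw, h⟩
        · rintro (rfl | ⟨hw, h⟩)
          · exact ⟨hkU, le_rfl⟩
          · exact ⟨hw, h.le⟩
      have hle : #{w ∈ U | k ≤ w} ≤ n := (card_filter_le _ _).trans hUcard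
      rw [e', card_insert_of_notMem (by simp)] at hle ⊢
      simp only [run_seq, run_onlyIf, ev_notE, ev_get, ev_rd]
      rw [if_neg (by simpa [Store.upd, f6] using hc)]
      rw [e] at h1
      simp [Store.upd, hkN, h1]
      refine ⟨Nat.mod_eq_of_lt (by omega), fun v hv hkv => ?_, fun v hv hkv hvk => ?_⟩
      · split_ifs with h
        · subst h
          exact Nat.mod_eq_of_lt ((hlt v).trans_lt hnV)
        · exact h2 v hv (by omega)
      · exact h3 v hv (by omega)
    · have hkU : k ∉ U := fun h => hc (mem_undone.1 h).2
      have e' : {w ∈ U | k ≤ w} = {w ∈ U | k < w} := by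
        refine filter_congr fun w hw => ?_
        have : w ≠ k := fun h => hkU (h ▸ hw)
        omega
      rw [e']
      simp only [run_seq, run_onlyIf, ev_notE, ev_get, ev_rd]
      rw [if_pos (by simpa [Store.upd, f6] using hc)]
      rw [e] at h1
      simp [Store.upd, hkN, h1]
      refine ⟨fun v hv hkv => ?_, fun v hv hkv hvk => ?_⟩
      · have : v ≠ k := fun h => hkU (h ▸ hv)
        exact h2 v hv (by omega)
      · exact h3 v hv (by omega)
  obtain ⟨-, h2, h3⟩ := key
  have hu : undone n (run E initProg m) = U := undone_congr (run_frame E _ _ (by decide))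
  have hrank : run E initProg m aRank = run E p₁ (m.upd aCount 0 0) aRank := by
    rw [hrun, Store.upd_of_ne _ _ _ (by decide)]
  have hlt : ∀ v ∈ U, ∀ w, v ≤ w → w ∈ U → v ≠ w → #{u ∈ U | w < u} < #{u ∈ U | v < u} := by
    intro v hv w hvw hw hne
    refine card_lt_card ?_
    rw [ssubset_iff_of_subset]
    · exact ⟨w, by simp only [mem_filter]; exact ⟨hw, by omega⟩, by simp⟩
    · intro u hu
      simp only [mem_filter] at hu ⊢
      exact ⟨hu.1, by omega⟩
  refine ⟨⟨?_, ?_⟩, ?_, ?_⟩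
  · rw [hu, hrank]
    intro v w hv hw h
    rw [h2 v hv (Nat.zero_le _), h2 w hw (Nat.zero_le _)] at h
    by_contra hne
    rcases le_total v w with hvw | hvw
    · have := hlt v hv w hvw hw hne
      omega
    · have := hlt w hw v hvw hv (Ne.symm hne)
      omega
  · rw [hu, hrank]
    intro v hv
    rw [h2 v hv (Nat.zero_le _)]
    have : #{w ∈ U | v < w} < #U := card_lt_card (filter_ssubset.2 ⟨v, hv, by simp⟩)
    calc #{w ∈ U | v < w} * B + B = (#{w ∈ U | v < w} + 1) * B := by ring
      _ ≤ #U * B := Nat.mul_le_mul_right _ this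
      _ ≤ E.N := hB
  · rw [hrun]
    simp [Store.upd]
  · intro v hv
    rw [hrun, Store.upd_of_ne _ _ _ (by decide)]
    exact h3 v hv (Nat.zero_le _)

/-- The coloring of the colored vertices is proper and uses the colors `0, …, Δ`. -/
structure Proper (A : Finset (ℕ × ℕ)) (n Δ : ℕ) (m : Store) : Prop where
  ne : ∀ d ∈ A, m aDone d.1 ≠ 0 → m aDone d.2 ≠ 0 → m aCol d.1 ≠ m aCol d.2
  le : ∀ v < n, m aDone v ≠ 0 → m aCol v ≤ Δ

/-- The vertices that have a larger neighbor with the same proposal. -/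
def conflicts (A : Finset (ℕ × ℕ)) (U : Finset ℕ) (q : ℕ → ℕ) : Finset ℕ :=
  {x ∈ U | ∃ y ∈ U, (x, y) ∈ A ∧ q x = q y ∧ x < y}

theorem run_commitProg (hn : m aVert 0 = n) (hnN : n ≤ E.N) (hnV : n < E.V) (hV : 1 < E.V)
    (hlt : ∀ d ∈ darts E.input, d.1 < n ∧ d.2 < n) (hm : ∀ i, m aRes i < E.V) (v : ℕ) :
    run E commitProg m aDone v =
        (if v ∈ undone n m ∧ v ∉ conflicts (darts E.input).toFinset (undone n m) (m aRes) then 1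
          else m aDone v) ∧
      run E commitProg m aCol v =
        if v ∈ undone n m ∧ v ∉ conflicts (darts E.input).toFinset (undone n m) (m aRes) then m aRes v
          else m aCol v := by
  set U := undone n m with hU
  set p₁ : Prog := .forDown aV (rd aVert) (.set aKeep (rd aV) 1) with hp₁
  set p₂ : Prog := .pass (.onlyIf (notE (.get aDone (rd aX)) * (notE (.get aDone (rd aY)) *
      (eqE (.get aRes (rd aX)) (.get aRes (rd aY)) * ltE (rd aX) (rd aY))))
    (.set aKeep (rd aX) 0)) with hp₂
  set p₃ : Prog := .forDown aV (rd aVert) (.onlyIf (notE (.get aDone (rd aV)) * .get aKeep (rd aV))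
    (.set aCol (rd aV) (.get aRes (rd aV)) ;; .set aDone (rd aV) 1)) with hp₃
  have hrun : run E commitProg m = run E p₃ (run E p₂ (run E p₁ m)) := rfl
  have fr₁ : ∀ k ∉ p₁.writes, run E p₁ m k = m k := fun k hk => run_frame E _ _ hk
  have fr₂ : ∀ k ∉ p₂.writes, run E p₂ (run E p₁ m) k = run E p₁ m k := fun k hk => run_frame E _ _ hk
  have key₁ := run_forDown_inv E p₁ rfl m (c := n)
    (fun k m' => ∀ v < n, k ≤ v → m' aKeep v = 1) (by simpa using hn) hnV (by omega) <| by
    intro k hk m' hfr h v hv hkv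
    have hkN : k % E.N = k := Nat.mod_eq_of_lt (hk.trans_le hnN)
    by_cases hvk : v = k
    · simp [Store.upd, hkN, hvk, Nat.mod_eq_of_lt hV]
    · simpa [Store.upd, hkN, hvk] using h v hv (by omega)
  have key₂ := run_pass_inv E p₂ rfl (run E p₁ m)
    (fun l m' => ∀ v < n, m' aKeep v ≠ 0 ↔
      ∀ d ∈ l, d.1 = v → ¬ (d.1 ∈ U ∧ d.2 ∈ U ∧ m aRes d.1 = m aRes d.2 ∧ d.1 < d.2))
    (fun l m i v h => by simpa [Store.upd] using h)
    (fun v hv => by simp [key₁ v hv (Nat.zero_le _)]) <| by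
    intro l x y hl m' hfr h v hv
    have f6 := (hfr aDone (by decide)).trans (fr₁ aDone (by decide))
    have f13 := (hfr aRes (by decide)).trans (fr₁ aRes (by decide))
    have hxn := hlt (x, y) (hl.subset (by simp))
    have hxN : x % E.N = x := Nat.mod_eq_of_lt (hxn.1.trans_le hnN)
    simp only [List.mem_append, List.mem_singleton]
    by_cases hc : x ∈ U ∧ y ∈ U ∧ m aRes x = m aRes y ∧ x < y
    · have hc1 := (mem_undone.1 hc.1).2
      have hc2 := (mem_undone.1 hc.2.1).2
      simp only [run_onlyIf]
      rw [if_neg (by simp [Store.upd, f6, f13, hc1, hc2, hc.2.2])]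
      by_cases hvx : v = x
      · subst hvx
        simp only [run_set]
        simp [Store.upd, hxN]
        exact .inr hc
      · have : x ≠ v := fun h => hvx h.symm
        have e : run E (.set aKeep (rd aX) 0) ((m'.upd aX 0 x).upd aY 0 y) aKeep v = m' aKeep v := by
          simp [Store.upd, hxN, hvx]
        rw [e, h v hv]
        constructor
        · rintro h1 d (hd | rfl) hdv
          · exact h1 d hd hdv
          · exact absurd hdv this
        · exact fun h1 d hd => h1 d (.inl hd)
    · simp only [run_onlyIf]
      rw [if_pos (by
        simp only [U, mem_undone, hxn, true_and] at hc
        simp only [ev_mul, mul_eq_zero, ev_notE, ev_get, ev_rd, ev_eqE, ev_ltE]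
        simp only [Store.upd, f6, f13]
        simp
        simpa only [not_and_or, not_lt] using hc)]
      have e : ((m'.upd aX 0 x).upd aY 0 y) aKeep v = m' aKeep v := by simp [Store.upd]
      rw [e, h v hv]
      constructor
      · rintro h1 d (hd | rfl) hdv
        · exact h1 d hd hdv
        · exact hc
      · exact fun h1 d hd => h1 d (.inl hd)
  set m₂ := run E p₂ (run E p₁ m) with hm₂
  have g6 : m₂ aDone = m aDone := (fr₂ aDone (by decide)).trans (fr₁ aDone (by decide))
  have g1 : m₂ aCol = m aCol := (fr₂ aCol (by decide)).trans (fr₁ aCol (by decide))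
  have g13 : m₂ aRes = m aRes := (fr₂ aRes (by decide)).trans (fr₁ aRes (by decide))
  have g0 : m₂ aVert = m aVert := (fr₂ aVert (by decide)).trans (fr₁ aVert (by decide))
  set W := conflicts (darts E.input).toFinset U (m aRes) with hW
  have hkeep : ∀ v ∈ U, m₂ aKeep v ≠ 0 ↔ v ∉ W := by
    intro v hv
    rw [key₂ v (mem_undone.1 hv).1]
    simp only [hW, conflicts, mem_filter, List.mem_toFinset, not_and, not_exists, Prod.forall]
    constructor
    · intro h _ y hy hd hq hlt
      exact h v y hd rfl hv hy hq hlt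
    · rintro h a b hab rfl ha hb hq hlt
      exact h hv b hb hab hq hlt
  have key₃ := run_forDown_inv E p₃ rfl m₂ (c := n)
    (fun k m' => ∀ v, (m' aDone v = if k ≤ v ∧ v ∈ U ∧ v ∉ W then 1 else m aDone v) ∧
      m' aCol v = if k ≤ v ∧ v ∈ U ∧ v ∉ W then m aRes v else m aCol v)
    (by simpa [g0] using hn) hnV (by
      intro v
      have : ¬ (n ≤ v ∧ v ∈ U ∧ v ∉ W) := by
        rintro ⟨h1, h2, -⟩
        have := (mem_undone.1 h2).1
        omega
      simp [this, Store.upd, g6, g1]) <| by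
    intro k hk m' hfr h v
    have f13 := (hfr aRes (by decide)).trans g13
    have f22 := hfr aKeep (by decide)
    have hkN : k % E.N = k := Nat.mod_eq_of_lt (hk.trans_le hnN)
    have hk6 : m' aDone k = m aDone k := by rw [(h k).1, if_neg (by omega)]
    by_cases hc : k ∈ U ∧ k ∉ W
    · have hc1 := (mem_undone.1 hc.1).2
      have hc2 := (hkeep k hc.1).2 hc.2
      simp only [run_onlyIf]
      rw [if_neg (by simp [Store.upd, hk6, hc1, f22, hc2])]
      by_cases hvk : v = k
      · subst hvk
        simp [Store.upd, hkN, f13, hc, Nat.mod_eq_of_lt hV, Nat.mod_eq_of_lt (hm v)]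
      · have h2 : k + 1 ≤ v ↔ k ≤ v := by omega
        have h' := h v
        simp only [h2] at h'
        simpa [Store.upd, hkN, hvk] using h'
    · simp only [run_onlyIf]
      rw [if_pos (by
        simp only [ev_mul, mul_eq_zero, ev_notE, ev_get, ev_rd]
        simp only [Store.upd, f22]
        simp only [show ¬ (6 = 26) by decide, show ¬ (22 = 26) by decide, if_false, and_self, if_true,
          false_and]
        by_cases hkU : k ∈ U
        · exact .inr (by_contra fun h => hc ⟨hkU, (hkeep k hkU).1 h⟩)
        · left
          rw [hk6]
          exact fun h => hkU (mem_undone.2 ⟨hk, h⟩))]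
      have h2 : (k + 1 ≤ v ∧ v ∈ U ∧ v ∉ W) ↔ (k ≤ v ∧ v ∈ U ∧ v ∉ W) := by
        constructor
        · rintro ⟨h1, h2⟩
          exact ⟨by omega, h2⟩
        · rintro ⟨h1, h2⟩
          have : v ≠ k := fun e => hc (e ▸ h2)
          exact ⟨by omega, h2⟩
      have h' := h v
      simp only [h2] at h'
      simpa [Store.upd] using h'
  have := key₃ v
  simpa [hrun] using this

theorem Proper.congr {A : Finset (ℕ × ℕ)} (h : Proper A n Δ m) (h1 : m' aCol = m aCol)
    (h6 : m' aDone = m aDone) : Proper A n Δ m' := by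
  refine ⟨?_, ?_⟩
  · rw [h1, h6]; exact h.ne
  · rw [h1, h6]; exact h.le

/-- The kept proposals extend the coloring, and at least a quarter of the proposals are kept. -/
theorem run_commitProg_proper (hS : Sizes E n Δ ℓ p) (hC : Ctx E n Δ ℓ p m) (hM : Δ < M)
    (hs : 2 * (s * Δ) ≤ p)
    (hP : Proposal (darts E.input).toFinset (undone n m) (m aCol) Δ p M s (m aRes))
    (hm : Proper (darts E.input).toFinset n Δ m) :
    Proper (darts E.input).toFinset n Δ (run E commitProg m) ∧
      4 * #(undone n (run E commitProg m)) ≤ 3 * #(undone n m) := by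
  have hlp := hS.lt_p
  have hpN := hS.p_le
  have hpV := hS.p_lt
  have hnp : 4 * (n + 1) ≤ p := by nlinarith
  have hsp := run_commitProg (E := E) hC.vert (by omega) (by omega) (by omega) hS.darts_lt (hC.lt _)
  set A := (darts E.input).toFinset with hA
  set U := undone n m with hU
  set W := conflicts A U (m aRes) with hW
  have hcard : 4 * #W ≤ 3 * #U := hP.card_conflict hS.dart hM hs hS.prime.pos
  have hundone : undone n (run E commitProg m) = W := by
    ext v
    rw [mem_undone, (hsp v).1]
    constructor
    · rintro ⟨hv, h⟩
      split_ifs at h with h1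
      · by_contra h2
        exact h1 ⟨mem_undone.2 ⟨hv, h⟩, h2⟩
    · intro hv
      have hvU := mem_undone.1 (mem_filter.1 hv).1
      rw [if_neg (fun h => h.2 hv)]
      exact hvU
  refine ⟨⟨?_, ?_⟩, by rw [hundone]; exact hcard⟩
  · -- A newly colored vertex next to one that was colored before, and two newly colored vertices.
    have old : ∀ x y, (x, y) ∈ A → x ∈ U ∧ x ∉ W → y ∉ U → m aRes x ≠ m aCol y := by
      intro x y hd hx hy
      have hyn := (hS.darts_lt (x, y) (List.mem_toFinset.1 hd)).2
      have hy6 : m aDone y ≠ 0 := fun h => hy (mem_undone.2 ⟨hyn, h⟩)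
      exact ((hP.free hM hx.1).2.2 (x, y) hd rfl hy (hm.le y hyn hy6)).symm
    have new : ∀ x y, (x, y) ∈ A → x ∈ U ∧ x ∉ W → y ∈ U ∧ y ∉ W → x < y → m aRes x ≠ m aRes y := by
      intro x y hd hx hy hlt h
      exact hx.2 (mem_filter.2 ⟨hx.1, y, hy.1, hd, h, hlt⟩)
    rintro ⟨x, y⟩ hd hx6 hy6
    have hn := hS.darts_lt (x, y) (List.mem_toFinset.1 hd)
    rw [(hsp x).1] at hx6
    rw [(hsp y).1] at hy6
    change run E commitProg m aCol x ≠ run E commitProg m aCol y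
    rw [(hsp x).2, (hsp y).2]
    by_cases hx : x ∈ U ∧ x ∉ W
    · rw [if_pos hx]
      by_cases hy : y ∈ U ∧ y ∉ W
      · rw [if_pos hy]
        have hne : x ≠ y := hS.dart.irrefl _ hd
        rcases Nat.lt_or_gt_of_ne hne with hlt | hlt
        · exact new x y hd hx hy hlt
        · exact (new y x (hS.dart.symm _ hd) hy hx hlt).symm
      · rw [if_neg hy]
        rw [if_neg hy] at hy6
        exact old x y hd hx (fun h => hy6 (mem_undone.1 h).2)
    · rw [if_neg hx]
      rw [if_neg hx] at hx6
      by_cases hy : y ∈ U ∧ y ∉ W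
      · rw [if_pos hy]
        exact (old y x (hS.dart.symm _ hd) hy (fun h => hx6 (mem_undone.1 h).2)).symm
      · rw [if_neg hy]
        rw [if_neg hy] at hy6
        exact hm.ne _ hd hx6 hy6
  · intro v hv h6
    rw [(hsp v).1] at h6
    rw [(hsp v).2]
    split_ifs at h6 ⊢ with h
    · exact (hP.free hM h.1).1
    · exact hm.le v hv h6

/-- An epoch with the branching factor `2 ^ k` colors at least a quarter of the uncolored vertices. -/
theorem run_epochProg (hS : Sizes E n Δ ℓ p) (hC : Ctx E n Δ ℓ p m) {k : ℕ} (hk : 0 < k) (hkℓ : k ≤ ℓ)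
    (hblock : m aBlock 0 = ℓ - k) (hB : m aBranch 0 = 2 ^ k) (hU : #(undone n m) * 2 ^ k ≤ 2 * n)
    (hm : Proper (darts E.input).toFinset n Δ m) :
    Proper (darts E.input).toFinset n Δ (run E epochProg m) ∧
      4 * #(undone n (run E epochProg m)) ≤ 3 * #(undone n m) := by
  have hlp := hS.lt_p
  have hpN := hS.p_le
  have hpV := hS.p_lt
  have hΔn := hS.Δ_le
  have hpow := hS.pow_lt
  have hnp : 4 * (n + 1) ≤ p := by nlinarith
  have hℓp : 4 * (ℓ + 1) ≤ p := by nlinarith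
  set r := ℓ / k + 1 with hr
  have hrℓ : r ≤ ℓ + 1 := Nat.succ_le_succ (Nat.div_le_self _ _)
  -- The last modulus `2 ^ (k * r)` is at most `2 ^ (2 * ℓ)`, but exceeds `Δ`.
  have hkr : k * r ≤ 2 * ℓ := by
    have := Nat.mul_div_le ℓ k
    rw [hr, mul_add]
    omega
  have hkr' : ℓ < k * r := Nat.lt_mul_div_succ ℓ hk
  set B := 2 ^ k with hBdef
  have hpos : ∀ j, 0 < 2 ^ j := fun j => Nat.two_pow_pos j
  have hBr : ∀ j ≤ r, B ^ j < E.V := by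
    intro j hj
    refine lt_of_le_of_lt ?_ hpow
    rw [hBdef, ← pow_mul]
    refine Nat.pow_le_pow_right (by omega) ((Nat.mul_le_mul_left k hj).trans hkr)
  have hr1 : 1 ≤ r := Nat.succ_le_succ (Nat.zero_le _)
  have hBV : B < E.V := by simpa using hBr 1 (by omega)
  have hΔr : Δ < B ^ r := by
    refine hS.Δ_lt.trans ?_
    rw [hBdef, ← pow_mul]
    exact Nat.pow_lt_pow_right (by omega) hkr'
  set m₁ := run E initProg m with hm₁
  set pl : Prog := .forDown aStage (rd aLog / (rd aLog - rd aBlock) + 1) stageProg with hpl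
  have hrun : run E epochProg m = run E commitProg (run E pl m₁) := rfl
  obtain ⟨i1, i2, i3⟩ := run_initProg (E := E) (B := B) hC.vert (by omega) (by omega) (by omega)
    (by omega)
  have fr₁ : ∀ k ∉ initProg.writes, m₁ k = m k := fun k hk => run_frame E _ _ hk
  have hC₁ : Ctx E n Δ ℓ p m₁ := hC.run hS _ (by decide)
  have u₁ : undone n m₁ = undone n m := undone_congr (fr₁ aDone (by decide))
  have key := run_forDown_inv E pl rfl m₁ (c := r)
    (fun j m' => (∀ k i, m' k i < E.V) ∧ m' aMod 0 = B ^ (r - j) ∧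
      Proposal (darts E.input).toFinset (undone n m) (m aCol) Δ p (B ^ (r - j)) (r - j) (m' aRes))
    (by
      simp only [ev_add, ev_div, ev_sub, ev_rd, ev_one, fr₁ aLog (by decide), fr₁ aBlock (by decide),
        hC.log, hblock]
      rw [Nat.sub_sub_self hkℓ])
    (by omega)
    (by
      refine ⟨upd_lt hC₁.lt (by omega) _ _, ?_, ?_⟩
      · simpa [Store.upd] using i2
      · rw [Store.upd_of_ne _ _ _ (by decide)]
        simp only [Nat.sub_self, pow_zero]
        exact Proposal.init hS.dart fun x hx => i3 x (mem_undone.1 hx).1) <| by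
    rintro j hj m' hfr ⟨h0, h1, h2⟩
    have hC' : Ctx E n Δ ℓ p (m'.upd aStage 0 j) := by
      refine ⟨?_, ?_, ?_, ?_, upd_lt h0 (by omega) _ _⟩
      · rw [Store.upd_of_ne _ _ _ (by decide), hfr aVert (by decide)]; exact hC₁.vert
      · rw [Store.upd_of_ne _ _ _ (by decide), hfr aMax (by decide)]; exact hC₁.max
      · rw [Store.upd_of_ne _ _ _ (by decide), hfr aLog (by decide)]; exact hC₁.log
      · rw [Store.upd_of_ne _ _ _ (by decide), hfr aPrime (by decide)]; exact hC₁.prime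
    have e6 : m'.upd aStage 0 j aDone = m aDone := by
      rw [Store.upd_of_ne _ _ _ (by decide), hfr aDone (by decide), fr₁ aDone (by decide)]
    have e1 : m'.upd aStage 0 j aCol = m aCol := by
      rw [Store.upd_of_ne _ _ _ (by decide), hfr aCol (by decide), fr₁ aCol (by decide)]
    have e11 : m'.upd aStage 0 j aBranch = m aBranch := by
      rw [Store.upd_of_ne _ _ _ (by decide), hfr aBranch (by decide), fr₁ aBranch (by decide)]
    have e12 : m'.upd aStage 0 j aRank = m₁ aRank := by
      rw [Store.upd_of_ne _ _ _ (by decide), hfr aRank (by decide)]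
    have e13 : m'.upd aStage 0 j aRes = m' aRes := by
      rw [Store.upd_of_ne _ _ _ (by decide)]
    have eu := undone_congr (n := n) e6
    have hrj : r - j = r - (j + 1) + 1 := by omega
    obtain ⟨x1, x2⟩ := run_stageProg (m := m'.upd aStage 0 j) (B := B) (M := B ^ (r - (j + 1)))
      (s := r - (j + 1)) hS hC' (by rw [e11]; exact hB) (hpos k) (by simpa [Store.upd] using h1)
      (by rw [← pow_succ]; exact hBr _ (by omega)) hBV
      ⟨by rw [eu, e12, ← u₁]; exact i1.inj, by rw [eu, e12, ← u₁]; exact i1.le⟩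
      (by rw [eu, e1, e13]; exact h2)
    rw [eu, e1, ← pow_succ, ← hrj] at x2
    rw [← pow_succ, ← hrj] at x1
    exact ⟨(hC'.run hS stageProg (by decide)).lt, x1, x2⟩
  obtain ⟨k0, k1, k2⟩ := key
  rw [Nat.sub_zero] at k1 k2
  have fr₂ : ∀ k ∉ pl.writes, run E pl m₁ k = m₁ k := fun k hk => run_frame E _ _ hk
  have g6 : run E pl m₁ aDone = m aDone := (fr₂ aDone (by decide)).trans (fr₁ aDone (by decide))
  have g1 : run E pl m₁ aCol = m aCol := (fr₂ aCol (by decide)).trans (fr₁ aCol (by decide))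
  have gu := undone_congr (n := n) g6
  have := run_commitProg_proper (m := run E pl m₁) (M := B ^ r) (s := r) hS
    (hC₁.run hS pl (by decide)) hΔr
    (by
      have : r * Δ ≤ (ℓ + 1) * n := Nat.mul_le_mul hrℓ hΔn
      nlinarith)
    (by rw [gu, g1]; exact k2) (hm.congr g1 g6)
  rw [gu] at this
  exact this

end

/-! ### Correctness of the greedy completion -/

section

variable {E : Env} {n Δ ℓ p : ℕ} {m m' : Store}

theorem run_usedProg {c k v : ℕ} (hk : m aCount 0 = k) (hkV : k < E.V) (hf : m aFlag 0 = 1)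
    (hv : m aV 0 = v) (hc : m aC 0 = c) :
    run E usedProg m aFlag 0 ≠ 0 ↔
      ∀ i < k, ¬ (m aSrc i = v ∧ m aDone (m aDst i) ≠ 0 ∧ m aCol (m aDst i) = c) := by
  have key := run_forDown_inv E usedProg rfl m (c := k)
    (fun j m' => m' aFlag 0 ≠ 0 ↔ ∀ i < k, j ≤ i →
      ¬ (m aSrc i = v ∧ m aDone (m aDst i) ≠ 0 ∧ m aCol (m aDst i) = c))
    (by simpa using hk) hkV (by
      simp [Store.upd, hf]
      omega) <| by
    intro j hj m' hfr h
    have f23 := hfr aSrc (by decide)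
    have f24 := hfr aDst (by decide)
    have f26 := hfr aV (by decide)
    have f6 := hfr aDone (by decide)
    have f1 := hfr aCol (by decide)
    have f28 := hfr aC (by decide)
    simp only [run_onlyIf, run_assign]
    by_cases hj' : m aSrc j = v ∧ m aDone (m aDst j) ≠ 0 ∧ m aCol (m aDst j) = c
    · rw [if_neg (by simp [Store.upd, f23, f24, f26, f6, f1, f28, hv, hc, hj'])]
      refine iff_of_false (by simp [Store.upd]) fun h => h j hj le_rfl hj'
    · rw [if_pos (by
        simp only [ev_mul, mul_eq_zero, ev_eqE, ev_get, ev_rd]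
        simp [Store.upd, f23, f24, f26, f6, f1, f28, hv, hc]
        by_contra hh
        push Not at hh
        exact hj' hh)]
      have e : m'.upd aI 0 j aFlag 0 = m' aFlag 0 := by simp [Store.upd]
      rw [e, h]
      constructor
      · intro h i hi hji
        rcases hji.eq_or_lt with rfl | hji
        · exact hj'
        · exact h i hi hji
      · exact fun h i hi hji => h i hi (by omega)
  simpa using key

theorem run_greedyVertProg {k v Δ : ℕ} (hk : m aCount 0 = k) (hkV : k < E.V) (hV : 1 < E.V)
    (hv : m aV 0 = v) (hvN : v < E.N) (hΔ : m aMax 0 = Δ) (hΔV : Δ + 1 < E.V) (hdone : m aDone v = 0) :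
    (∀ w, w ≠ v → run E greedyVertProg m aCol w = m aCol w) ∧
      ∀ c ≤ Δ, (∀ i < k, ¬ (m aSrc i = v ∧ m aDone (m aDst i) ≠ 0 ∧ m aCol (m aDst i) = c)) →
        run E greedyVertProg m aCol v ≤ Δ ∧ ∀ i < k, ¬ (m aSrc i = v ∧ m aDone (m aDst i) ≠ 0 ∧
          m aCol (m aDst i) = run E greedyVertProg m aCol v) := by
  let free : ℕ → Prop := fun c =>
    ∀ i < k, ¬ (m aSrc i = v ∧ m aDone (m aDst i) ≠ 0 ∧ m aCol (m aDst i) = c)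
  have key := run_forDown_inv E greedyVertProg rfl m (c := Δ + 1)
    (fun j m' => (∀ w, w ≠ v → m' aCol w = m aCol w) ∧
      ∀ c ≤ Δ, j ≤ c → free c → m' aCol v ≤ Δ ∧ free (m' aCol v))
    (by simpa using hΔ) hΔV (by
      refine ⟨fun w _ => by simp [Store.upd], fun c hc hc' => by omega⟩) <| by
    rintro j hj m' hfr ⟨h1, h2⟩
    have hV0 : 1 % E.V = 1 := Nat.mod_eq_of_lt hV
    set m₁ : Store := (m'.upd aC 0 j).upd aFlag 0 1 with hm₁
    have e : ∀ k, k ≠ 28 → k ≠ 33 → m₁ k = m' k := fun k h1 h2 => by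
      rw [hm₁, Store.upd_of_ne _ _ _ h2, Store.upd_of_ne _ _ _ h1]
    have f23 : m₁ aSrc = m aSrc := (e _ (by decide) (by decide)).trans (hfr aSrc (by decide))
    have f24 : m₁ aDst = m aDst := (e _ (by decide) (by decide)).trans (hfr aDst (by decide))
    have f6 : m₁ aDone = m aDone := (e _ (by decide) (by decide)).trans (hfr aDone (by decide))
    have f25 : m₁ aCount = m aCount := (e _ (by decide) (by decide)).trans (hfr aCount (by decide))
    have f26 : m₁ aV = m aV := (e _ (by decide) (by decide)).trans (hfr aV (by decide))
    have f1 : m₁ aCol = m' aCol := e _ (by decide) (by decide)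
    have hused := run_usedProg (E := E) (m := m₁) (c := j) (k := k) (v := v) (by rw [f25, hk]) hkV
      (by simp [hm₁, Store.upd]) (by rw [f26, hv]) (by simp [hm₁, Store.upd])
    -- A colored endpoint differs from `v`, so that its color has not changed.
    have hiff : run E usedProg m₁ aFlag 0 ≠ 0 ↔ free j := by
      rw [hused, f23, f24, f6, f1]
      refine forall₂_congr fun i _ => not_congr (and_congr_right fun _ => and_congr_right fun hd => ?_)
      rw [h1 _ (fun h => hd (by rw [h]; exact hdone))]
    have u26 : run E usedProg m₁ aV = m aV := (run_frame E usedProg m₁ (by decide)).trans f26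
    have u28 : run E usedProg m₁ aC 0 = j := by
      rw [run_frame E usedProg m₁ (by decide)]
      simp [hm₁, Store.upd]
    have u1 : run E usedProg m₁ aCol = m' aCol := (run_frame E usedProg m₁ (by decide)).trans f1
    have hstep : run E (assign aFlag 1 ;; usedProg ;; .onlyIf (rd aFlag) (.set aCol (rd aV) (rd aC)))
        (m'.upd aC 0 j) = if run E usedProg m₁ aFlag 0 = 0 then run E usedProg m₁ else
          (run E usedProg m₁).upd aCol v j := by
      simp [hV0, ← hm₁, u26, u28, hv, Nat.mod_eq_of_lt hvN, Nat.mod_eq_of_lt (hj.trans hΔV)]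
    rw [hstep]
    by_cases hfree : free j
    · rw [if_neg (hiff.2 hfree)]
      refine ⟨fun w hw => by simp [Store.upd, hw, u1, h1 w hw], fun c hc hjc hfc => ?_⟩
      simp only [Store.upd, and_self, if_true]
      exact ⟨by omega, hfree⟩
    · rw [if_pos (not_not.1 (fun h => hfree (hiff.1 h))), u1]
      refine ⟨h1, fun c hc hjc hfc => h2 c hc ?_ hfc⟩
      rcases hjc.eq_or_lt with rfl | h
      · exact absurd hfc hfree
      · exact h
  exact ⟨key.1, fun c hc hfc => key.2 c hc (Nat.zero_le _) hfc⟩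

/-- Some color is free at every vertex. -/
theorem exists_free {A : Finset (ℕ × ℕ)} (hA : IsDartSet n Δ A) (col : ℕ → ℕ) (v : ℕ) :
    ∃ c ≤ Δ, ∀ d ∈ A, d.1 = v → col d.2 ≠ c := by
  by_contra h
  push Not at h
  have hsub : range (Δ + 1) ⊆ ({d ∈ A | d.1 = v}).image (fun d => col d.2) := by
    intro c hc
    obtain ⟨d, hd, h1, h2⟩ := h c (by simpa [Nat.lt_succ_iff] using hc)
    exact mem_image.2 ⟨d, mem_filter.2 ⟨hd, h1⟩, h2⟩
  have := (card_le_card hsub).trans card_image_le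
  have h2 := hA.deg v
  rw [card_range] at this
  omega

/-- The darts at uncolored vertices. -/
theorem card_darts_le (hS : Sizes E n Δ ℓ p) (U : Finset ℕ) :
    ((darts E.input).filter (fun d => d.1 ∈ U)).length ≤ #U * Δ := by
  rw [← List.toFinset_card_of_nodup (hS.nodup.filter _), List.toFinset_filter,
    card_eq_sum_card_fiberwise (f := Prod.fst) (t := U)]
  · refine (sum_le_card_nsmul U _ Δ fun x _ => ?_)
    refine (card_le_card ?_).trans (hS.dart.deg x)
    intro d hd
    simp only [mem_filter] at hd ⊢
    exact ⟨hd.1.1, hd.2⟩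
  · intro d hd
    simpa using (mem_filter.1 (mem_coe.1 hd)).2

theorem run_greedyProg (hS : Sizes E n Δ ℓ p) (hC : Ctx E n Δ ℓ p m)
    (hU : #(undone n m) * Δ ≤ n) (hm : Proper (darts E.input).toFinset n Δ m) :
    Proper (darts E.input).toFinset n Δ (run E greedyProg m) ∧
      undone n (run E greedyProg m) = ∅ := by
  have hlp := hS.lt_p
  have hpN := hS.p_le
  have hpV := hS.p_lt
  have hΔn := hS.Δ_le
  have hnp : 4 * (n + 1) ≤ p := by nlinarith
  set U := undone n m with hUdef
  set p₂ : Prog := .pass (.onlyIf (notE (.get aDone (rd aX)))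
    (.set aSrc (rd aCount) (rd aX) ;; .set aDst (rd aCount) (rd aY) ;;
    assign aCount (rd aCount + 1))) with hp₂
  set p₃ : Prog := .forDown aV (rd aVert) (.onlyIf (notE (.get aDone (rd aV)))
    (greedyVertProg ;; .set aDone (rd aV) 1)) with hp₃
  set m₁ := m.upd aCount 0 0 with hm₁
  have hrun : run E greedyProg m = run E p₃ (run E p₂ m₁) := by
    simp [greedyProg, hp₂, hp₃, hm₁]
  have e : ∀ k, k ≠ 25 → m₁ k = m k := fun k hk => by rw [hm₁, Store.upd_of_ne _ _ _ hk]
  have hcard := card_darts_le hS U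
  have hpre : ∀ l : List (ℕ × ℕ), l <+: darts E.input →
      (l.filter (fun d => d.1 ∈ U)).length ≤ n := by
    intro l hl
    exact ((hl.sublist.filter _).length_le.trans hcard).trans hU
  have key₂ := run_pass_inv E p₂ rfl m₁
    (fun l m' => m' aCount 0 = (l.filter (fun d => d.1 ∈ U)).length ∧
      (List.range (m' aCount 0)).map (fun i => (m' aSrc i, m' aDst i)) =
        l.filter (fun d => d.1 ∈ U))
    (fun l m i v h => by simpa [Store.upd] using h) (by simp [hm₁, Store.upd]) <| by
    rintro l x y hl m' hfr ⟨h1, h2⟩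
    have f6 := (hfr aDone (by decide)).trans (e aDone (by decide))
    have hxn := hS.darts_lt (x, y) (hl.subset (by simp))
    have hlen := hpre _ hl
    simp only [List.filter_append, List.filter_singleton, run_onlyIf] at hlen ⊢
    by_cases hc : x ∈ U
    · rw [if_neg (by simpa [Store.upd, f6] using (mem_undone.1 hc).2)]
      simp only [hc, decide_true, List.length_append] at hlen ⊢
      rw [← h1] at hlen
      have hlen' : m' aCount 0 + 1 ≤ n := by simpa using hlen
      have hkN : m' aCount 0 % E.N = m' aCount 0 := Nat.mod_eq_of_lt (by omega)
      have hkV : (m' aCount 0 + 1) % E.V = m' aCount 0 + 1 := Nat.mod_eq_of_lt (by omega)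
      have hxV : x % E.V = x := Nat.mod_eq_of_lt (by have := hxn.1; omega)
      have hyV : y % E.V = y := Nat.mod_eq_of_lt (by have := hxn.2; omega)
      simp [Store.upd, hkN, hkV, hxV, hyV]
      rw [← h1]
      refine ⟨rfl, ?_⟩
      rw [List.range_succ, List.map_append, ← h2]
      congr 1
      · refine List.map_congr_left fun i hi => ?_
        have : i ≠ m' aCount 0 := by
          have := List.mem_range.1 hi
          omega
        simp [this]
      · simp
    · have hc6 : m aDone x ≠ 0 := fun h => hc (mem_undone.2 ⟨hxn.1, h⟩)
      rw [if_pos (by simpa [Store.upd, f6] using hc6)]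
      simp only [hc, decide_false]
      simpa [Store.upd] using And.intro h1 h2
  set m₂ := run E p₂ m₁ with hm₂
  obtain ⟨c1, c2⟩ := key₂
  have fr₂ : ∀ k ∉ p₂.writes, m₂ k = m₁ k := fun k hk => run_frame E _ _ hk
  have g : ∀ k ∉ p₂.writes, k ≠ 25 → m₂ k = m k := fun k hk h => (fr₂ k hk).trans (e k h)
  set k := m₂ aCount 0 with hk
  have hkn : k ≤ n := by
    rw [c1]
    exact hpre _ (List.prefix_refl _)
  have hmem : ∀ d ∈ darts E.input, d.1 ∈ U → ∃ i < k, m₂ aSrc i = d.1 ∧ m₂ aDst i = d.2 := by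
    intro d hd hdU
    have : d ∈ (darts E.input).filter (fun d => d.1 ∈ U) := List.mem_filter.2 ⟨hd, by simpa using hdU⟩
    rw [← c2, List.mem_map] at this
    obtain ⟨i, hi, rfl⟩ := this
    exact ⟨i, List.mem_range.1 hi, rfl, rfl⟩
  have hmem' : ∀ i < k, (m₂ aSrc i, m₂ aDst i) ∈ darts E.input := by
    intro i hi
    have : (m₂ aSrc i, m₂ aDst i) ∈ (darts E.input).filter (fun d => d.1 ∈ U) := by
      rw [← c2]
      exact List.mem_map.2 ⟨i, List.mem_range.2 hi, rfl⟩
    exact List.mem_of_mem_filter this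
  have key₃ := run_forDown_inv E p₃ rfl m₂ (c := n)
    (fun j m' => Proper (darts E.input).toFinset n Δ m' ∧ (∀ v < n, j ≤ v → m' aDone v ≠ 0) ∧
      ∀ v, m' aDone v = 0 → m aDone v = 0)
    (by simpa [g aVert (by decide) (by decide)] using hC.vert) (by omega)
    ⟨hm.congr (by rw [Store.upd_of_ne _ _ _ (by decide), g aCol (by decide) (by decide)])
      (by rw [Store.upd_of_ne _ _ _ (by decide), g aDone (by decide) (by decide)]), by omega,
      by simp [Store.upd, g aDone (by decide) (by decide)]⟩ <| by
    rintro v hv m' hfr ⟨h1, h2, h3⟩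
    have f8 := (hfr aMax (by decide)).trans (g aMax (by decide) (by decide))
    have f23 := hfr aSrc (by decide)
    have f24 := hfr aDst (by decide)
    have f25 := hfr aCount (by decide)
    have hvN : v % E.N = v := Nat.mod_eq_of_lt (by omega)
    simp only [run_onlyIf, run_seq]
    by_cases hc : m' aDone v = 0
    · rw [if_neg (by simpa [Store.upd] using hc)]
      have hvU : v ∈ U := mem_undone.2 ⟨hv, h3 v hc⟩
      obtain ⟨s1, s2⟩ := run_greedyVertProg (E := E) (m := m'.upd aV 0 v) (k := k) (v := v) (Δ := Δ)
        (by simp [Store.upd, f25, hk]) (by omega) (by omega) (by simp [Store.upd]) (by omega)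
        (by simpa [Store.upd, f8] using hC.max) (by omega) (by simpa [Store.upd] using hc)
      have e' : ∀ k, k ≠ 26 → m'.upd aV 0 v k = m' k := fun k hk => Store.upd_of_ne _ _ _ hk
      rw [e' aCol (by decide)] at s1
      rw [e' aCol (by decide), e' aSrc (by decide), e' aDst (by decide), e' aDone (by decide), f23,
        f24] at s2
      obtain ⟨c, hcΔ, hcf⟩ := exists_free hS.dart (m' aCol) v
      obtain ⟨t1, t2⟩ := s2 c hcΔ (by
        rintro i hi ⟨i1, -, i3⟩
        exact hcf _ (List.mem_toFinset.2 (hmem' i hi)) i1 i3)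
      set m₄ := run E greedyVertProg (m'.upd aV 0 v) with hm₄
      have w26 : m₄ aV 0 = v := by
        rw [hm₄, run_frame E _ _ (by decide)]
        simp [Store.upd]
      have w6 : m₄ aDone = m' aDone := by
        rw [hm₄, run_frame E _ _ (by decide), e' aDone (by decide)]
      have hfin : run E (.set aDone (rd aV) 1) m₄ = m₄.upd aDone v 1 := by
        have : 1 % E.V = 1 := Nat.mod_eq_of_lt (by omega)
        simp [w26, hvN, this]
      rw [hfin]
      have d6 : ∀ w, w ≠ v → m₄.upd aDone v 1 aDone w = m' aDone w := fun w hw => by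
        simp [Store.upd, hw, w6]
      have d6' : m₄.upd aDone v 1 aDone v = 1 := by simp [Store.upd]
      have d1 : m₄.upd aDone v 1 aCol = m₄ aCol := Store.upd_of_ne _ _ _ (by decide)
      -- The new color differs from the colors of all colored neighbors.
      have new : ∀ y, (v, y) ∈ (darts E.input).toFinset → m' aDone y ≠ 0 → m₄ aCol v ≠ m' aCol y := by
        intro y hd hy h
        obtain ⟨i, hi, i1, i2⟩ := hmem (v, y) (List.mem_toFinset.1 hd) hvU
        simp only at i1 i2
        exact t2 i hi ⟨i1, by rwa [i2], by rw [i2, h]⟩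
      refine ⟨⟨?_, ?_⟩, ?_, ?_⟩
      · rintro ⟨x, y⟩ hd hx hy
        have hne := hS.dart.irrefl _ hd
        simp only at hne hx hy ⊢
        rw [d1]
        by_cases hxv : x = v
        · subst hxv
          rw [d6 y (Ne.symm hne)] at hy
          rw [s1 y (Ne.symm hne)]
          exact new y hd hy
        · rw [d6 x hxv] at hx
          rw [s1 x hxv]
          by_cases hyv : y = v
          · subst hyv
            exact (new x (hS.dart.symm _ hd) hx).symm
          · rw [d6 y hyv] at hy
            rw [s1 y hyv]
            exact h1.ne _ hd hx hy
      · intro w hw hd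
        rw [d1]
        by_cases hwv : w = v
        · subst hwv; exact t1
        · rw [d6 w hwv] at hd
          rw [s1 w hwv]
          exact h1.le w hw hd
      · intro w hw hvw
        by_cases hwv : w = v
        · subst hwv; rw [d6']; exact one_ne_zero
        · rw [d6 w hwv]; exact h2 w hw (by omega)
      · intro w hw
        by_cases hwv : w = v
        · subst hwv; rw [d6'] at hw; exact absurd hw one_ne_zero
        · rw [d6 w hwv] at hw; exact h3 w hw
    · rw [if_pos (by simpa [Store.upd] using hc)]
      refine ⟨h1.congr (Store.upd_of_ne _ _ _ (by decide)) (Store.upd_of_ne _ _ _ (by decide)), ?_, ?_⟩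
      · intro w hw hvw
        rcases hvw.eq_or_lt with rfl | h
        · simpa [Store.upd] using hc
        · simpa [Store.upd] using h2 w hw h
      · simpa [Store.upd] using h3
  rw [hrun]
  refine ⟨key₃.1, ?_⟩
  ext v
  simp only [mem_undone, notMem_empty, iff_false, not_and]
  exact fun hv => key₃.2.1 v hv (Nat.zero_le _)

end

/-! ### Correctness of the preparations -/

section

variable {E : Env} {n Δ ℓ p : ℕ} {m m' : Store}

/-- The number of darts that leave `v`. -/
def outDeg (E : Env) (v : ℕ) : ℕ := (darts E.input).countP (fun d => d.1 = v)

theorem run_preludeProg (hn : m aVert 0 = n) (h0 : ∀ k, k ≠ 0 → ∀ i, m k i = 0)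
    (hd : ∀ d ∈ darts E.input, d.1 < n) (hN : n ≤ E.N) (hV : 8 * (n + 1) * (n + 1) + 3 < E.V)
    (hΔ : (range n).sup (outDeg E) = Δ) (hΔn : Δ ≤ n) :
    run E preludeProg m aMax 0 = Δ ∧ run E preludeProg m aLog 0 = Nat.size Δ ∧
      run E preludeProg m aSize 0 = 8 * (n + 1) * (Nat.size Δ + 1) + 3 := by
  have hnV : 8 * n + 3 < E.V := by nlinarith
  have hdeg : ∀ v < n, outDeg E v ≤ Δ := fun v hv => hΔ ▸ le_sup (f := outDeg E) (mem_range.2 hv)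
  set p₁ : Prog := .pass (.set aDeg (rd aX) (.get aDeg (rd aX) + 1)) with hp₁
  set p₂ : Prog := .forDown aV (rd aVert)
    (.onlyIf (ltE (rd aMax) (.get aDeg (rd aV))) (assign aMax (.get aDeg (rd aV)))) with hp₂
  set p₃ : Prog := .forDown aV (rd aVert) (.onlyIf (leE (rd aMod) (rd aMax))
    (assign aMod (rd aMod * 2) ;; assign aLog (rd aLog + 1))) with hp₃
  have hrun : run E preludeProg m =
      run E (assign aSize (8 * (rd aVert + 1) * (rd aLog + 1) + 3))
        (run E p₃ ((run E p₂ (run E p₁ m)).upd aMod 0 1)) := by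
    simp [preludeProg, hp₁, hp₂, hp₃, Nat.mod_eq_of_lt (by omega : 1 < E.V)]
  have key₁ := run_pass_inv E p₁ rfl m
    (fun l m' => ∀ v < n, m' aDeg v = l.countP (fun d => d.1 = v))
    (fun l m i v h => by simpa [Store.upd] using h) (by simp [h0]) <| by
    rintro l x y hl m' hfr h v hv
    have hx := hd (x, y) (hl.subset (by simp))
    simp only at hx
    have hxN : x % E.N = x := Nat.mod_eq_of_lt (by omega)
    have hle : (l ++ [(x, y)]).countP (fun d => d.1 = x) ≤ Δ :=
      (hl.sublist.countP_le).trans (hdeg x hx)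
    have hxV : (m' aDeg x + 1) % E.V = m' aDeg x + 1 := by
      rw [h x hx]
      simp only [List.countP_append, List.countP_singleton] at hle
      simp only [decide_true, if_true] at hle
      exact Nat.mod_eq_of_lt (by omega)
    by_cases hvx : v = x
    · subst hvx
      rw [h v hv] at hxV
      simp [Store.upd, hxN, hxV, List.countP_append, h v hv]
    · simp [Store.upd, hxN, List.countP_append, h v hv, hvx, Ne.symm hvx]
  set m₁ := run E p₁ m with hm₁
  have key₂ := run_forDown_inv E p₂ rfl m₁ (c := n)
    (fun j m' => m' aMax 0 = (Ico j n).sup (outDeg E))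
    (by rw [ev_rd, hm₁, run_frame E p₁ m (by decide), hn]) (by omega)
    (by simp [Store.upd, hm₁, run_frame E p₁ m (k := aMax) (by decide), h0]) <| by
    intro j hj m' hfr h
    have f7 := hfr aDeg (by decide)
    have hjd : m₁ aDeg j = outDeg E j := key₁ j hj
    have e : Ico j n = insert j (Ico (j + 1) n) := by ext; simp; omega
    rw [e, sup_insert, ← h]
    have hjV : outDeg E j % E.V = outDeg E j :=
      Nat.mod_eq_of_lt (by have := hdeg j hj; omega)
    simp only [run_onlyIf, run_assign]
    by_cases hc : m' aMax 0 < outDeg E j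
    · rw [if_neg (by simpa [Store.upd, f7, hjd] using hc)]
      simp [Store.upd, f7, hjd, hjV, max_eq_left hc.le]
    · rw [if_pos (by simpa [Store.upd, f7, hjd] using hc)]
      simp [Store.upd, max_eq_right (not_lt.1 hc)]
  set m₂ := run E p₂ m₁ with hm₂
  have max₂ : m₂ aMax 0 = Δ := by rw [key₂, Nat.Ico_zero_eq_range, hΔ]
  have vert₂ : m₂ aVert 0 = n := by
    rw [hm₂, run_frame E p₂ _ (by decide), hm₁, run_frame E p₁ _ (by decide), hn]
  have log₂ : m₂ aLog 0 = 0 := by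
    rw [hm₂, run_frame E p₂ _ (by decide), hm₁, run_frame E p₁ _ (by decide), h0 _ (by decide)]
  -- The binary length of `Δ` is at most `n`, so that `n` iterations suffice to find it.
  have hsize : Nat.size Δ ≤ n := (Nat.size_le.2 Nat.lt_two_pow_self).trans hΔn
  have key₃ := run_forDown_inv E p₃ rfl (m₂.upd aMod 0 1) (c := n)
    (fun j m' => m' aLog 0 = min (n - j) (Nat.size Δ) ∧ m' aMod 0 = 2 ^ min (n - j) (Nat.size Δ))
    (by simp [Store.upd, vert₂]) (by omega) (by simp [Store.upd, log₂]) <| by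
    rintro j hj m' hfr ⟨h1, h2⟩
    have f8 : m' aMax 0 = Δ := by
      rw [hfr aMax (by decide), Store.upd_of_ne _ _ _ (by decide), max₂]
    set k := min (n - (j + 1)) (Nat.size Δ) with hk
    have hcond : 2 ^ k ≤ Δ ↔ k < Nat.size Δ := by rw [Nat.lt_size]
    simp only [run_onlyIf, run_seq, run_assign]
    by_cases hc : 2 ^ k ≤ Δ
    · have hk' : min (n - j) (Nat.size Δ) = k + 1 := by
        have := hcond.1 hc
        omega
      rw [if_neg (by simpa [Store.upd, f8, h2] using hc), hk']
      have hkn : k < 2 ^ k := Nat.lt_two_pow_self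
      simp [Store.upd, h1, h2]
      exact ⟨Nat.mod_eq_of_lt (by omega), by rw [pow_succ]; exact Nat.mod_eq_of_lt (by omega)⟩
    · have hk' : min (n - j) (Nat.size Δ) = k := by
        have := mt hcond.2 hc
        omega
      rw [if_pos (by simpa [Store.upd, f8, h2] using hc), hk']
      simp [Store.upd, h1, h2]
  set m₃ := run E p₃ (m₂.upd aMod 0 1) with hm₃
  have fr₃ : ∀ k ∉ 14 :: p₃.writes, m₃ k = m₂ k := fun k hk => by
    rw [List.mem_cons, not_or] at hk
    rw [hm₃, run_frame E p₃ _ hk.2, Store.upd_of_ne _ _ _ hk.1]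
  have log₃ : m₃ aLog 0 = Nat.size Δ := by rw [key₃.1]; omega
  rw [hrun]
  refine ⟨?_, ?_, ?_⟩
  · simp [Store.upd, fr₃ aMax (by decide), max₂]
  · simp [Store.upd, log₃]
  · simp [Store.upd, fr₃ aVert (by decide), vert₂, log₃]
    exact Nat.mod_eq_of_lt (by nlinarith)

theorem run_divisorProg {c : ℕ} (hc : m aC 0 = c) (hcV : c < E.V) (hf : m aFlag 0 = 1) (hc2 : 2 ≤ c) :
    run E divisorProg m aFlag 0 ≠ 0 ↔ c.Prime := by
  have key := run_forDown_inv E divisorProg rfl m (c := c)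
    (fun j m' => m' aFlag 0 ≠ 0 ↔ ∀ i < c, j ≤ i → 1 < i → ¬ i ∣ c)
    (by simpa using hc) hcV (by
      simp [Store.upd, hf]
      omega) <| by
    intro j hj m' hfr h
    have f28 := hfr aC (by decide)
    simp only [run_onlyIf, run_assign]
    by_cases hj' : 1 < j ∧ j ∣ c
    · rw [if_neg (by
        simp only [ev_mul, mul_eq_zero, ev_ltE, ev_eqE, ev_rd, ev_mod, ev_zero, ev_one]
        simp [Store.upd, f28, hc, hj'.1, Nat.mod_eq_zero_of_dvd hj'.2])]
      refine iff_of_false (by simp [Store.upd]) fun h => h j hj le_rfl hj'.1 hj'.2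
    · rw [if_pos (by
        simp only [ev_mul, mul_eq_zero, ev_ltE, ev_eqE, ev_rd, ev_mod, ev_zero, ev_one]
        simp only [Store.upd, f28, hc]
        simp
        rw [← Nat.dvd_iff_mod_eq_zero]
        by_contra hh
        push Not at hh
        exact hj' hh)]
      have e : m'.upd aJ 0 j aFlag 0 = m' aFlag 0 := by simp [Store.upd]
      rw [e, h]
      constructor
      · intro h i hi hji h1 h2
        rcases hji.eq_or_lt with rfl | hji
        · exact hj' ⟨h1, h2⟩
        · exact h i hi hji h1 h2
      · exact fun h i hi hji => h i hi (by omega)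
  rw [key, Nat.prime_def_lt]
  refine ⟨fun h => ⟨hc2, fun k hk hkc => ?_⟩, fun h i hi _ h1 h2 => ?_⟩
  · have := Nat.pos_of_dvd_of_pos hkc (by omega)
    by_contra hne
    exact h k hk (Nat.zero_le _) (by omega) hkc
  · have := h.2 i hi h2
    omega

theorem run_primeProg (hn : m aVert 0 = n) (hℓ : m aLog 0 = ℓ)
    (hV : 8 * (n + 1) * (ℓ + 1) < E.V) :
    (run E primeProg m aPrime 0).Prime ∧ 4 * (n + 1) * (ℓ + 1) < run E primeProg m aPrime 0 ∧
      run E primeProg m aPrime 0 ≤ 8 * (n + 1) * (ℓ + 1) := by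
  set M := 4 * (n + 1) * (ℓ + 1) with hM
  have h8 : 8 * (n + 1) * (ℓ + 1) = 2 * M := by rw [hM]; ring
  rw [h8] at hV ⊢
  have hM4 : 4 ≤ M := by rw [hM]; nlinarith [Nat.zero_le (n * ℓ)]
  have key := run_forDown_inv E primeProg rfl m (c := M)
    -- The last prime that is found, the least one in the interval, stays in `aPrime`.
    (fun j m' => (∃ q, q.Prime ∧ M + 1 + j ≤ q ∧ q ≤ 2 * M) →
      (m' aPrime 0).Prime ∧ M < m' aPrime 0 ∧ m' aPrime 0 ≤ 2 * M)
    (by simp [hn, hℓ, hM]) (by omega) (by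
      rintro ⟨q, -, h1, h2⟩
      omega) <| by
    rintro j hj m' hfr h ⟨q, hq, hjq, hqM⟩
    have f0 := hfr aVert (by decide)
    have f9 := hfr aLog (by decide)
    set m₁ : Store := ((m'.upd aV 0 j).upd aC 0 (M + 1 + j)).upd aFlag 0 1 with hm₁
    have hjV : (M + 1 + j) % E.V = M + 1 + j := Nat.mod_eq_of_lt (by omega)
    have h1V : 1 % E.V = 1 := Nat.mod_eq_of_lt (by omega)
    have hdiv := run_divisorProg (E := E) (m := m₁) (c := M + 1 + j) (by simp [hm₁, Store.upd])
      (by omega) (by simp [hm₁, Store.upd]) (by omega)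
    have u28 : run E divisorProg m₁ aC 0 = M + 1 + j := by
      rw [run_frame E divisorProg m₁ (by decide)]
      simp [hm₁, Store.upd]
    have u10 : run E divisorProg m₁ aPrime 0 = m' aPrime 0 := by
      rw [run_frame E divisorProg m₁ (by decide)]
      simp [hm₁, Store.upd]
    have hstep : run E (assign aC (4 * (rd aVert + 1) * (rd aLog + 1) + 1 + rd aV) ;;
        assign aFlag 1 ;; divisorProg ;; .onlyIf (rd aFlag) (assign aPrime (rd aC)))
        (m'.upd aV 0 j) = if run E divisorProg m₁ aFlag 0 = 0 then run E divisorProg m₁ else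
          (run E divisorProg m₁).upd aPrime 0 (M + 1 + j) := by
      have e : run E (assign aFlag 1) (run E (assign aC
          (4 * (rd aVert + 1) * (rd aLog + 1) + 1 + rd aV)) (m'.upd aV 0 j)) = m₁ := by
        rw [run_assign, run_assign]
        have : ev (m'.upd aV 0 j) (4 * (rd aVert + 1) * (rd aLog + 1) + 1 + rd aV) = M + 1 + j := by
          simp [Store.upd, f0, f9, hn, hℓ, hM]
        rw [this, hjV, ev_one, h1V]
      simp only [run_seq]
      rw [e]
      simp [u28, hjV]
    rw [hstep]
    by_cases hp : (M + 1 + j).Prime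
    · rw [if_neg (hdiv.2 hp)]
      simp [Store.upd]
      exact ⟨hp, by omega, by omega⟩
    · rw [if_pos (not_not.1 (mt hdiv.1 hp)), u10]
      refine h ⟨q, hq, ?_, hqM⟩
      have : q ≠ M + 1 + j := fun h => hp (h ▸ hq)
      omega
  obtain ⟨q, hq, h1, h2⟩ := Nat.exists_prime_lt_and_le_two_mul M (by omega)
  exact key ⟨q, hq, by omega, h2⟩

/-! ### The number of passes -/

theorem np_seq (p q : Prog) (m : Store) : np E (p ;; q) m = np E p m + np E q (run E p m) := rfl

theorem np_pass (b : Prog) (m : Store) : np E (.pass b) m = 1 := rfl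

theorem np_preludeProg (m : Store) : np E preludeProg m = 1 := by
  simp (discharger := decide) only [preludeProg, np_seq, np_pass, np_eq_zero]

theorem np_stageProg (m : Store) : np E stageProg m = 3 := by
  simp (discharger := decide) only [stageProg, slackProg, scoreProg, np_seq, np_pass, np_eq_zero]

theorem np_greedyProg (m : Store) : np E greedyProg m = 1 := by
  simp (discharger := decide) only [greedyProg, np_seq, np_pass, np_eq_zero]

/-- An epoch with the branching factor `2 ^ k` makes three passes for each of its at most `ℓ / k + 1`
refinements, and one pass to commit colors. -/
theorem np_epochProg_le {k : ℕ} (hℓ : m aLog 0 = ℓ) (hk : 0 < k) (hkℓ : k ≤ ℓ)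
    (hblock : m aBlock 0 = ℓ - k) (hV : ℓ + 1 < E.V) :
    np E epochProg m ≤ 3 * (ℓ / k + 1) + 1 := by
  have h : np E (.forDown aStage (rd aLog / (rd aLog - rd aBlock) + 1) stageProg) (run E initProg m) ≤
      ∑ j ∈ range (ℓ / k + 1), 3 := by
    refine np_forDown_le E _ rfl _ _ (c := ℓ / k + 1) ?_ ?_ fun j _ m' _ => (np_stageProg _).le
    · have f9 := run_frame E initProg m (k := aLog) (by decide)
      have f37 := run_frame E initProg m (k := aBlock) (by decide)
      have : ℓ - (ℓ - k) = k := by omega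
      simp [f9, f37, hℓ, hblock, this]
    · have := Nat.div_le_self ℓ k
      omega
  simp only [sum_const, card_range, smul_eq_mul] at h
  simp (discharger := decide) only [epochProg, commitProg, np_seq, np_pass, np_eq_zero]
  omega

end

/-! ### Correctness and number of passes of the main program -/

section

variable {E : Env} {n Δ ℓ p : ℕ} {m m' : Store}

theorem Ctx.upd (h : Ctx E n Δ ℓ p m) {k i v : ℕ} (hk : k ∉ [aVert, aMax, aLog, aPrime])
    (hv : v < E.V) : Ctx E n Δ ℓ p (m.upd k i v) := by
  simp only [List.mem_cons, List.not_mem_nil, or_false, not_or] at hk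
  refine ⟨?_, ?_, ?_, ?_, fun k' i' => ?_⟩
  · rw [Store.upd_of_ne _ _ _ (by omega)]; exact h.vert
  · rw [Store.upd_of_ne _ _ _ (by omega)]; exact h.max
  · rw [Store.upd_of_ne _ _ _ (by omega)]; exact h.log
  · rw [Store.upd_of_ne _ _ _ (by omega)]; exact h.prime
  · have := h.lt k' i'
    unfold Store.upd
    split_ifs <;> assumption

/-- Three epochs at least halve the number of uncolored vertices. -/
theorem run_repeat_epochProg (hS : Sizes E n Δ ℓ p) (hC : Ctx E n Δ ℓ p m) {k : ℕ} (hk : 0 < k)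
    (hkℓ : k ≤ ℓ) (hblock : m aBlock 0 = ℓ - k) (hB : m aBranch 0 = 2 ^ k)
    (hU : #(undone n m) * 2 ^ k ≤ 2 * n) (hm : Proper (darts E.input).toFinset n Δ m) :
    Ctx E n Δ ℓ p (run E (.forDown aRep 3 epochProg) m) ∧
      Proper (darts E.input).toFinset n Δ (run E (.forDown aRep 3 epochProg) m) ∧
      2 * #(undone n (run E (.forDown aRep 3 epochProg) m)) ≤ #(undone n m) := by
  have hV : 4 < E.V := by
    have := hS.lt_p
    have := hS.p_lt
    nlinarith [Nat.zero_le (n * ℓ)]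
  have key := run_forDown_inv E (.forDown aRep 3 epochProg) rfl m (c := 3)
    -- The third clause keeps the table of slacks within its bounds.
    (fun j m' => Ctx E n Δ ℓ p m' ∧ Proper (darts E.input).toFinset n Δ m' ∧
      #(undone n m') ≤ #(undone n m) ∧
      4 ^ (3 - j) * #(undone n m') ≤ 3 ^ (3 - j) * #(undone n m))
    (by simp) (by omega) ⟨hC.upd (by decide) (by omega),
      hm.congr (Store.upd_of_ne _ _ _ (by decide)) (Store.upd_of_ne _ _ _ (by decide)),
      by rw [undone_congr (Store.upd_of_ne _ _ _ (by decide))],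
      by rw [undone_congr (Store.upd_of_ne _ _ _ (by decide))]; simp⟩ <| by
    rintro j hj m' hfr ⟨h1, h2, h3, h4⟩
    have f11 := hfr aBranch (by decide)
    have f37 := hfr aBlock (by decide)
    have hu : undone n (m'.upd aRep 0 j) = undone n m' :=
      undone_congr (Store.upd_of_ne _ _ _ (by decide))
    have hC' : Ctx E n Δ ℓ p (m'.upd aRep 0 j) := h1.upd (by decide) (by omega)
    obtain ⟨e1, e2⟩ := run_epochProg hS hC' hk hkℓ (by simp [Store.upd, f37, hblock])
      (by simp [Store.upd, f11, hB]) (by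
        rw [hu]
        exact (Nat.mul_le_mul_right _ h3).trans hU)
      (h2.congr (Store.upd_of_ne _ _ _ (by decide)) (Store.upd_of_ne _ _ _ (by decide)))
    rw [hu] at e2
    refine ⟨hC'.run hS epochProg (by decide), e1, by omega, ?_⟩
    have e : 3 - j = 3 - (j + 1) + 1 := by omega
    rw [e, pow_succ, pow_succ]
    calc 4 ^ (3 - (j + 1)) * 4 * #(undone n (run E epochProg (m'.upd aRep 0 j)))
        = 4 ^ (3 - (j + 1)) * (4 * #(undone n (run E epochProg (m'.upd aRep 0 j)))) := by ring
      _ ≤ 4 ^ (3 - (j + 1)) * (3 * #(undone n m')) := Nat.mul_le_mul_left _ e2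
      _ = 3 * (4 ^ (3 - (j + 1)) * #(undone n m')) := by ring
      _ ≤ 3 * (3 ^ (3 - (j + 1)) * #(undone n m)) := Nat.mul_le_mul_left _ h4
      _ = _ := by ring
  refine ⟨key.1, key.2.1, ?_⟩
  have := key.2.2.2
  norm_num at this
  omega

/-- When the epochs with the branching factor `2 ^ k` are over, at most `n / 2 ^ k` vertices are
uncolored. After the last of them, `|U| Δ ≤ n`, as the greedy completion requires. -/
theorem run_mainProg (hS : Sizes E n Δ ℓ (run E primeProg m aPrime 0)) (hn : m aVert 0 = n)
    (hΔ : m aMax 0 = Δ) (hℓ : m aLog 0 = ℓ) (hlt : ∀ k i, m k i < E.V)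
    (hdone : ∀ v, m aDone v = 0) :
    Proper (darts E.input).toFinset n Δ (run E mainProg m) ∧
      undone n (run E mainProg m) = ∅ := by
  have hlp := hS.lt_p
  have hpV := hS.p_lt
  have hℓV : ℓ < E.V := by nlinarith [Nat.zero_le (n * ℓ)]
  have hpow : ∀ k ≤ ℓ, 2 ^ k < E.V := fun k hk =>
    (Nat.pow_le_pow_right (by norm_num) (by omega)).trans_lt hS.pow_lt
  set p := run E primeProg m aPrime 0 with hp
  set m₁ := run E primeProg m with hm₁
  have hC₁ : Ctx E n Δ ℓ p m₁ := by
    refine ⟨?_, ?_, ?_, rfl, run_lt (by omega) hS.input primeProg hlt⟩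
    · rw [hm₁, run_frame E _ _ (by decide), hn]
    · rw [hm₁, run_frame E _ _ (by decide), hΔ]
    · rw [hm₁, run_frame E _ _ (by decide), hℓ]
  have done₁ : ∀ v, m₁ aDone v = 0 := fun v => by
    rw [hm₁, run_frame E _ _ (by decide), hdone]
  -- At the start no vertex is colored, so that the coloring is proper for trivial reasons.
  have hm₁P : Proper (darts E.input).toFinset n Δ (m₁.upd aBranch 0 1) :=
    ⟨fun d _ h => absurd (by simpa [Store.upd] using done₁ d.1) h,
      fun v _ h => absurd (by simpa [Store.upd] using done₁ v) h⟩
  set p₂ : Prog := .forDown aBlock (rd aLog)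
    (assign aBranch (rd aBranch * 2) ;; .forDown aRep 3 epochProg) with hp₂
  have hrun : run E mainProg m = run E greedyProg (run E p₂ (m₁.upd aBranch 0 1)) := by
    simp [mainProg, hp₂, hm₁, Nat.mod_eq_of_lt (by omega : 1 < E.V)]
  have key := run_forDown_inv E p₂ rfl (m₁.upd aBranch 0 1) (c := ℓ)
    (fun j m' => Ctx E n Δ ℓ p m' ∧ Proper (darts E.input).toFinset n Δ m' ∧
      m' aBranch 0 = 2 ^ (ℓ - j) ∧ #(undone n m') * 2 ^ (ℓ - j) ≤ n)
    (by simpa [Store.upd] using hC₁.log) hℓV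
    ⟨(hC₁.upd (by decide) (by omega)).upd (by decide) hℓV,
      hm₁P.congr (Store.upd_of_ne _ _ _ (by decide)) (Store.upd_of_ne _ _ _ (by decide)),
      by simp [Store.upd], by
        simpa using card_le_card (fun v hv => mem_range.2 (mem_undone.1 hv).1 :
          undone n ((m₁.upd aBranch 0 1).upd aBlock 0 ℓ) ⊆ range n)⟩ <| by
    rintro j hj m' hfr ⟨h1, h2, h3, h4⟩
    have e : ℓ - j = ℓ - (j + 1) + 1 := by omega
    have hB : 2 ^ (ℓ - (j + 1)) * 2 = 2 ^ (ℓ - j) := by rw [e, pow_succ]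
    have hBV : 2 ^ (ℓ - j) < E.V := hpow _ (by omega)
    set m₂ : Store := (m'.upd aBlock 0 j).upd aBranch 0 (2 ^ (ℓ - j)) with hm₂
    have hstep : run E (assign aBranch (rd aBranch * 2) ;; .forDown aRep 3 epochProg)
        (m'.upd aBlock 0 j) = run E (.forDown aRep 3 epochProg) m₂ := by
      have : (m'.upd aBlock 0 j) aBranch 0 = 2 ^ (ℓ - (j + 1)) := by simpa [Store.upd] using h3
      rw [run_seq, run_assign, ev_mul, ev_rd, ev_two, this, hB, Nat.mod_eq_of_lt hBV]
    have hC₂ : Ctx E n Δ ℓ p m₂ := (h1.upd (by decide) (by omega)).upd (by decide) hBV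
    have e6 : m₂ aDone = m' aDone := by
      rw [hm₂, Store.upd_of_ne _ _ _ (by decide), Store.upd_of_ne _ _ _ (by decide)]
    have e1 : m₂ aCol = m' aCol := by
      rw [hm₂, Store.upd_of_ne _ _ _ (by decide), Store.upd_of_ne _ _ _ (by decide)]
    have hu : undone n m₂ = undone n m' := undone_congr e6
    obtain ⟨r1, r2, r3⟩ := run_repeat_epochProg hS hC₂ (k := ℓ - j) (by omega) (by omega)
      (by simp [hm₂, Store.upd]; omega) (by simp [hm₂, Store.upd]) (by
        rw [hu, ← hB]
        nlinarith) (h2.congr e1 e6)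
    rw [hstep]
    refine ⟨r1, r2, ?_, ?_⟩
    · rw [run_frame E _ _ (by decide)]
      simp [hm₂, Store.upd]
    · rw [hu] at r3
      rw [← hB]
      nlinarith [Nat.mul_le_mul_right (2 ^ (ℓ - (j + 1))) r3]
  obtain ⟨c1, c2, -, c4⟩ := key
  rw [hrun]
  refine run_greedyProg hS c1 ((Nat.mul_le_mul_left _ ?_).trans c4) c2
  exact hS.Δ_lt.le

/-- The summand `j` belongs to the branching factor `2 ^ (ℓ - j)`. -/
theorem np_mainProg_le (hℓ : m aLog 0 = ℓ) (hV : ℓ + 3 < E.V) :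
    np E mainProg m ≤ ∑ j ∈ range ℓ, 3 * (3 * (ℓ / (ℓ - j) + 1) + 1) + 1 := by
  simp (discharger := decide) only [mainProg, np_seq, np_greedyProg, np_eq_zero]
  simp only [zero_add]
  refine Nat.add_le_add_right (np_forDown_le E _ rfl _ _ (c := ℓ) ?_ (by omega) ?_) 1
  · rw [ev_rd, run_frame E _ _ (by decide), run_frame E _ _ (by decide), hℓ]
  · intro j hj m' hfr
    have f9 : m' aLog 0 = ℓ := by
      rw [hfr aLog (by decide), run_frame E _ _ (by decide), run_frame E _ _ (by decide), hℓ]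
    simp (discharger := decide) only [np_seq, np_eq_zero, zero_add]
    refine (np_forDown_le E _ rfl _ (fun _ => 3 * (ℓ / (ℓ - j) + 1) + 1) (c := 3) (by simp)
      (by omega) ?_).trans (by simp)
    intro i hi m'' hfr'
    refine np_epochProg_le (k := ℓ - j) ?_ (by omega) (by omega) ?_ (by omega)
    · rw [Store.upd_of_ne _ _ _ (by decide), hfr' aLog (by decide), run_frame E _ _ (by decide),
        Store.upd_of_ne _ _ _ (by decide), f9]
    · rw [Store.upd_of_ne _ _ _ (by decide), hfr' aBlock (by decide), run_frame E _ _ (by decide)]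
      simp [Store.upd]
      omega

end

/-! ### Edge streams -/

section

variable {n : ℕ} {G : SimpleGraph (Fin n)} {es : List (Fin n × Fin n)}

theorem IsEdgeStream.adj (h : IsEdgeStream G es) {e : Fin n × Fin n} (he : e ∈ es) :
    G.Adj e.1 e.2 := (h.2 _ _).1 (List.mem_map_of_mem he)

theorem mem_darts_tokens {x y : ℕ} :
    (x, y) ∈ darts (tokens es) ↔
      ∃ e ∈ es, (x = e.1 ∧ y = e.2) ∨ (x = e.2 ∧ y = e.1) := by
  simp [darts, tokens, List.mem_flatMap]

theorem IsEdgeStream.mem_darts (h : IsEdgeStream G es) {x y : ℕ} :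
    (x, y) ∈ darts (tokens es) ↔ ∃ u v : Fin n, x = u ∧ y = v ∧ G.Adj u v := by
  rw [mem_darts_tokens]
  constructor
  · rintro ⟨e, he, ⟨rfl, rfl⟩ | ⟨rfl, rfl⟩⟩
    · exact ⟨_, _, rfl, rfl, h.adj he⟩
    · exact ⟨_, _, rfl, rfl, (h.adj he).symm⟩
  · rintro ⟨u, v, rfl, rfl, huv⟩
    obtain ⟨e, he, heq⟩ := List.mem_map.1 ((h.2 u v).2 huv)
    refine ⟨e, he, ?_⟩
    rcases Sym2.eq_iff.1 heq with ⟨h1, h2⟩ | ⟨h1, h2⟩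
    · exact .inl ⟨by rw [h1], by rw [h2]⟩
    · exact .inr ⟨by rw [h2], by rw [h1]⟩

theorem IsEdgeStream.nodup_darts (h : IsEdgeStream G es) : (darts (tokens es)).Nodup := by
  rw [darts, tokens, List.flatMap_map, List.nodup_flatMap]
  constructor
  · intro e he
    have := (h.adj he).ne
    have h' : (e.1 : ℕ) ≠ e.2 := fun h => this (Fin.ext h)
    simp [h']
  · have := h.1
    rw [List.Nodup, List.pairwise_map] at this
    refine this.imp fun {e e'} hne => ?_
    rw [Function.onFun, List.disjoint_left]
    intro d hd hd'
    simp only [List.mem_cons, List.not_mem_nil, or_false] at hd hd'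
    apply hne
    rw [Sym2.eq_iff]
    rcases hd with rfl | rfl <;> rcases hd' with hd' | hd' <;>
      simp only [Prod.mk.injEq, Fin.val_inj] at hd' <;> tauto

theorem IsEdgeStream.length_le (h : IsEdgeStream G es) : (tokens es).length ≤ n ^ 2 := by
  have := (List.Nodup.of_map _ h.1).length_le_card
  simpa [tokens, sq] using this

theorem tokens_lt : ∀ t ∈ tokens es, t.1 < n ∧ t.2 < n := by
  intro t ht
  obtain ⟨e, -, rfl⟩ := List.mem_map.1 ht
  exact ⟨e.1.2, e.2.2⟩

variable [DecidableRel G.Adj]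

theorem IsEdgeStream.card_darts (h : IsEdgeStream G es) (u : Fin n) :
    #{d ∈ (darts (tokens es)).toFinset | d.1 = (u : ℕ)} = G.degree u := by
  rw [← SimpleGraph.card_neighborFinset_eq_degree]
  symm
  refine card_bij (fun v _ => ((u : ℕ), (v : ℕ))) ?_ ?_ ?_
  · intro v hv
    rw [SimpleGraph.mem_neighborFinset] at hv
    exact mem_filter.2 ⟨List.mem_toFinset.2 (h.mem_darts.2 ⟨u, v, rfl, rfl, hv⟩), rfl⟩
  · intro v _ w _ hvw
    exact Fin.ext (Prod.ext_iff.1 hvw).2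
  · rintro ⟨x, y⟩ hd
    rw [mem_filter, List.mem_toFinset, h.mem_darts] at hd
    obtain ⟨⟨a, b, rfl, rfl, hab⟩, hau⟩ := hd
    obtain rfl : a = u := Fin.ext hau
    exact ⟨b, by simpa using hab, rfl⟩

theorem IsEdgeStream.isDartSet (h : IsEdgeStream G es) :
    IsDartSet n G.maxDegree (darts (tokens es)).toFinset := by
  refine ⟨?_, ?_, ?_, fun x => ?_⟩
  · rintro ⟨x, y⟩ hd
    rw [List.mem_toFinset, h.mem_darts] at hd ⊢
    obtain ⟨u, v, rfl, rfl, huv⟩ := hd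
    exact ⟨v, u, rfl, rfl, huv.symm⟩
  · rintro ⟨x, y⟩ hd
    rw [List.mem_toFinset, h.mem_darts] at hd
    obtain ⟨u, v, rfl, rfl, huv⟩ := hd
    exact fun h => huv.ne (Fin.ext h)
  · rintro ⟨x, y⟩ hd
    rw [List.mem_toFinset, h.mem_darts] at hd
    obtain ⟨u, v, rfl, rfl, huv⟩ := hd
    exact u.2
  · by_cases hx : x < n
    · exact (h.card_darts ⟨x, hx⟩).trans_le (G.degree_le_maxDegree _)
    · rw [filter_eq_empty_iff.2]
      · simp
      · rintro ⟨a, b⟩ hd rfl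
        rw [List.mem_toFinset, h.mem_darts] at hd
        obtain ⟨u, v, rfl, rfl, huv⟩ := hd
        exact hx u.2

theorem IsEdgeStream.outDeg_eq (h : IsEdgeStream G es) {E : Env} (hE : E.input = tokens es)
    (u : Fin n) : outDeg E u = G.degree u := by
  rw [← h.card_darts, outDeg, hE, List.countP_eq_length_filter,
    ← List.toFinset_card_of_nodup (h.nodup_darts.filter _), List.toFinset_filter]
  simp

theorem IsEdgeStream.sup_outDeg (h : IsEdgeStream G es) {E : Env} (hE : E.input = tokens es) :
    (range n).sup (outDeg E) = G.maxDegree := by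
  apply le_antisymm
  · refine Finset.sup_le fun v hv => ?_
    rw [mem_range] at hv
    exact (h.outDeg_eq hE ⟨v, hv⟩).trans_le (G.degree_le_maxDegree _)
  · refine G.maxDegree_le_of_forall_degree_le _ fun u => ?_
    rw [← h.outDeg_eq hE]
    exact le_sup (f := outDeg E) (mem_range.2 u.2)

theorem maxDegree_le_card (G : SimpleGraph (Fin n)) [DecidableRel G.Adj] : G.maxDegree ≤ n :=
  G.maxDegree_le_of_forall_degree_le _ fun u => by
    simpa using (G.degree_lt_card_verts u).le

end

/-! ### Asymptotic bounds -/

section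

open Real

theorem size_le_logb {a : ℕ} (ha : a ≠ 0) : (Nat.size a : ℝ) ≤ logb 2 a + 1 := by
  have h1 : 2 ^ (Nat.size a - 1) ≤ a := by
    rw [← Nat.lt_size]
    have := Nat.size_pos.2 (Nat.pos_of_ne_zero ha)
    omega
  have h2 : ((Nat.size a - 1 : ℕ) : ℝ) ≤ logb 2 a := by
    rw [Real.le_logb_iff_rpow_le (by norm_num) (by positivity), Real.rpow_natCast]
    exact_mod_cast h1
  have h3 : (Nat.size a : ℝ) ≤ ((Nat.size a - 1 : ℕ) : ℝ) + 1 := by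
    exact_mod_cast (by omega : Nat.size a ≤ Nat.size a - 1 + 1)
  linarith

theorem one_le_logb {a : ℕ} (ha : 2 ≤ a) : 1 ≤ logb 2 a := by
  rw [Real.le_logb_iff_rpow_le (by norm_num) (by positivity), Real.rpow_one]
  exact_mod_cast ha

/-- The sum over the branching factors `2 ^ k` of the numbers of stages is a harmonic sum. -/
theorem sum_div_le (ℓ : ℕ) : ((∑ j ∈ range ℓ, ℓ / (ℓ - j) : ℕ) : ℝ) ≤ ℓ * (1 + log ℓ) := by
  have h1 : ∑ j ∈ range ℓ, ℓ / (ℓ - j) = ∑ j ∈ range ℓ, ℓ / (j + 1) := by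
    rw [← sum_range_reflect]
    refine sum_congr rfl fun j hj => ?_
    have := mem_range.1 hj
    congr 1
    omega
  have h2 := harmonic_le_one_add_log ℓ
  rw [h1, Nat.cast_sum]
  calc ∑ j ∈ range ℓ, ((ℓ / (j + 1) : ℕ) : ℝ) ≤ ∑ j ∈ range ℓ, (ℓ : ℝ) * ((j : ℝ) + 1)⁻¹ := by
        refine sum_le_sum fun j _ => ?_
        rw [← div_eq_mul_inv]
        exact_mod_cast Nat.cast_div_le (α := ℝ) (m := ℓ) (n := j + 1)
    _ = ℓ * ((harmonic ℓ : ℚ) : ℝ) := by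
        rw [← mul_sum]
        simp [harmonic]
    _ ≤ _ := by gcongr

/-- The terms of the left side are the pass of `preludeProg` and the passes of `mainProg`. For `Δ ≤ 2` the
main term on the right is `0`, for `Δ = 0` by the junk value `logb 2 0 = 0`. -/
theorem passes_le (Δ : ℕ) :
    ((1 + (∑ j ∈ range (Nat.size Δ), 3 * (3 * (Nat.size Δ / (Nat.size Δ - j) + 1) + 1) + 1) : ℕ) : ℝ) ≤
      138 * (logb 2 Δ * logb 2 (logb 2 Δ) + 1) := by
  set ℓ := Nat.size Δ with hℓ
  have h1 : 1 + (∑ j ∈ range ℓ, 3 * (3 * (ℓ / (ℓ - j) + 1) + 1) + 1) =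
      2 + 12 * ℓ + 9 * ∑ j ∈ range ℓ, ℓ / (ℓ - j) := by
    simp only [mul_add, sum_add_distrib, ← mul_sum, sum_const, card_range, smul_eq_mul]
    ring
  have h2 := sum_div_le ℓ
  rw [h1]
  push_cast at h2 ⊢
  by_cases hΔ : Δ ≤ 2
  · have hz : logb 2 (Δ : ℝ) * logb 2 (logb 2 (Δ : ℝ)) = 0 := by
      interval_cases Δ <;> simp
    rw [hz]
    have hℓ2 : ℓ ≤ 2 := by
      rw [hℓ, Nat.size_le]
      omega
    have hlog : log (ℓ : ℝ) ≤ 1 := by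
      have h' : (ℓ : ℝ) ≤ 2 := by exact_mod_cast hℓ2
      rcases Nat.eq_zero_or_pos ℓ with h0 | h0
      · simp [h0]
      · have := Real.log_le_sub_one_of_pos (show (0 : ℝ) < ℓ by exact_mod_cast h0)
        linarith
    have h' : (ℓ : ℝ) ≤ 2 := by exact_mod_cast hℓ2
    have h'' : (0 : ℝ) ≤ ℓ := by positivity
    nlinarith
  · push Not at hΔ
    set L := logb 2 (Δ : ℝ) with hL
    have hL32 : 3 / 2 ≤ L := by
      rw [hL, Real.le_logb_iff_rpow_le (by norm_num) (by positivity)]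
      have h3 : (3 : ℝ) ≤ Δ := by exact_mod_cast hΔ
      refine le_trans ?_ h3
      rw [← Real.sqrt_sq (by norm_num : (0 : ℝ) ≤ 3), Real.le_sqrt (by positivity) (by norm_num),
        ← Real.rpow_natCast, ← Real.rpow_mul (by norm_num)]
      norm_num
    have hLL : 1 / 2 ≤ logb 2 L := by
      rw [Real.le_logb_iff_rpow_le (by norm_num) (by linarith), ← Real.sqrt_eq_rpow,
        Real.sqrt_le_left (by linarith)]
      nlinarith
    have hℓL : (ℓ : ℝ) ≤ 2 * L := by
      have := size_le_logb (a := Δ) (by omega)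
      linarith
    have hℓpos : (0 : ℝ) < ℓ := by
      have : 0 < ℓ := Nat.size_pos.2 (by omega)
      exact_mod_cast this
    have hlog : log (ℓ : ℝ) ≤ 1 + logb 2 L := by
      have h3 : log (ℓ : ℝ) ≤ log (2 * L) := Real.log_le_log hℓpos hℓL
      rw [Real.log_mul (by norm_num) (by linarith)] at h3
      have h4 : log L = logb 2 L * log 2 := by
        rw [Real.logb, div_mul_cancel₀]
        exact (Real.log_pos (by norm_num)).ne'
      have h5 : log 2 ≤ 1 := by
        have := Real.log_le_sub_one_of_pos (show (0 : ℝ) < 2 by norm_num)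
        linarith
      nlinarith
    have h6 : (ℓ : ℝ) * (1 + log ℓ) ≤ 2 * L * (2 + logb 2 L) := by
      refine mul_le_mul hℓL (by linarith) ?_ (by linarith)
      have : 0 ≤ log (ℓ : ℝ) := Real.log_natCast_nonneg ℓ
      linarith
    nlinarith

/-- The memory of `mainProg`, with 39 arrays of `8 (n + 1) (ℓ + 1) + 3` cells with values below
`(n + 2) ^ 16`, together with the temporary values of a step, takes `O(n log² n)` bits. -/
theorem peak_le (n ℓ c : ℕ) (hℓ : ℓ ≤ Nat.size n) :
    39 * (8 * (n + 1) * (ℓ + 1) + 3) *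
        (Nat.size 39 + Nat.size (8 * (n + 1) * (ℓ + 1) + 3) + Nat.size ((n + 2) ^ 16)) +
      c * Nat.size ((n + 2) ^ 16) ≤ (200000 + 100 * c) * (n * Nat.size n ^ 2 + 1) := by
  set s := Nat.size n with hs
  set N := 8 * (n + 1) * (ℓ + 1) + 3 with hN
  have hsn : s ≤ n := Nat.size_le.2 Nat.lt_two_pow_self
  have hV : Nat.size ((n + 2) ^ 16) ≤ 16 * (s + 3) := by
    have h1 : Nat.size (n + 2) ≤ s + 3 := by
      have := size_add_le n 2
      have h2 : Nat.size 2 ≤ 2 := Nat.size_le.2 (by norm_num)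
      omega
    have h2 : ∀ k, Nat.size ((n + 2) ^ (k + 1)) ≤ (k + 1) * Nat.size (n + 2) := by
      intro k
      induction k with
      | zero => simp
      | succ k ih =>
        rw [pow_succ, add_mul, one_mul]
        exact (size_mul_le _ _).trans (by omega)
    exact (h2 15).trans (by omega)
  have hNV : N ≤ (n + 2) ^ 16 := by
    have h1 : N ≤ 8 * (n + 2) ^ 2 + 3 := by
      have : (n + 1) * (ℓ + 1) ≤ (n + 2) * (n + 2) := Nat.mul_le_mul (by omega) (by omega)
      rw [hN, sq]
      nlinarith
    have h2 : 2 ^ 14 ≤ (n + 2) ^ 14 := Nat.pow_le_pow_left (by omega) _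
    have h3 : 2 ^ 2 ≤ (n + 2) ^ 2 := Nat.pow_le_pow_left (by omega) _
    calc N ≤ 8 * (n + 2) ^ 2 + 3 := h1
      _ ≤ 2 ^ 14 * (n + 2) ^ 2 := by omega
      _ ≤ (n + 2) ^ 14 * (n + 2) ^ 2 := Nat.mul_le_mul_right _ h2
      _ = _ := by ring
  have hNs := (Nat.size_le_size hNV).trans hV
  have h39 : Nat.size 39 ≤ 6 := Nat.size_le.2 (by norm_num)
  have hs1 : n = 0 ∧ s = 0 ∨ 1 ≤ n ∧ 1 ≤ s := by
    rcases Nat.eq_zero_or_pos n with h | h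
    · exact .inl ⟨h, by omega⟩
    · exact .inr ⟨h, Nat.size_pos.2 h⟩
  have hNb : N ≤ 32 * (n * s) + 11 := by
    rcases hs1 with ⟨h, h'⟩ | ⟨h, h'⟩
    · have : ℓ = 0 := by omega
      simp [hN, h, this]
    · have : (n + 1) * (ℓ + 1) ≤ (2 * n) * (2 * s) := Nat.mul_le_mul (by omega) (by omega)
      rw [hN]
      nlinarith
  have hst : s ≤ n * s ^ 2 := by
    rcases hs1 with ⟨h, h'⟩ | ⟨h, h'⟩
    · omega
    · nlinarith [Nat.mul_le_mul h (Nat.mul_le_mul h' (le_refl s))]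
  have hns : n * s ≤ n * s ^ 2 := by
    rcases hs1 with ⟨h, h'⟩ | ⟨h, h'⟩
    · simp [h]
    · exact Nat.mul_le_mul_left _ (Nat.le_self_pow (by norm_num) _)
  calc 39 * N * (Nat.size 39 + Nat.size N + Nat.size ((n + 2) ^ 16)) + c * Nat.size ((n + 2) ^ 16)
      ≤ 39 * (32 * (n * s) + 11) * (6 + 16 * (s + 3) + 16 * (s + 3)) + c * (16 * (s + 3)) := by
        gcongr
    _ = 39936 * (n * s ^ 2) + 127296 * (n * s) + 13728 * s + 43758 + c * (16 * s + 48) := by ring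
    _ ≤ 39936 * (n * s ^ 2) + 127296 * (n * s ^ 2) + 13728 * (n * s ^ 2) + 43758 +
        c * (16 * (n * s ^ 2) + 48) := by gcongr
    _ ≤ _ := by nlinarith [Nat.zero_le (c * (n * s ^ 2))]

theorem peak_le_logb (n a : ℕ) :
    ((a * (n * Nat.size n ^ 2 + 1) : ℕ) : ℝ) ≤ (4 * a : ℕ) * (n * logb 2 n ^ 2 + 1) := by
  push_cast
  by_cases hn : n ≤ 1
  -- Here `logb 2 n` is `0`, and the bound rests on the summand `1`.
  · have h5 : (0 : ℝ) ≤ a := by positivity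
    interval_cases n <;> simp <;> linarith
  · push Not at hn
    have h1 := size_le_logb (a := n) (by omega)
    have h2 := one_le_logb (a := n) hn
    have h3 : (Nat.size n : ℝ) ^ 2 ≤ 4 * logb 2 n ^ 2 := by
      have : (0 : ℝ) ≤ Nat.size n := by positivity
      nlinarith
    have h4 : (n : ℝ) * (Nat.size n : ℝ) ^ 2 ≤ n * (4 * logb 2 n ^ 2) := by gcongr
    have h5 : (0 : ℝ) ≤ a := by positivity
    nlinarith
end

/-! ### The machine program -/

section

theorem Prog.tm_mono {κ κ' V V' l l' : ℕ} (hκ : κ ≤ κ') (hV : V ≤ V') (hl : l ≤ l') (p : Prog) :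
    p.tm κ V l ≤ p.tm κ' V' l' := by
  induction p with
  | set => exact hκ
  | seq p q ihp ihq => simp only [Prog.tm]; gcongr
  | onlyIf e p ih => simp only [Prog.tm]; gcongr
  | forDown x e b ih => simp only [Prog.tm]; gcongr
  | pass b ih => simp only [Prog.tm]; gcongr

theorem Prog.eval_tm (κ V l : Polynomial ℕ) (n : ℕ) (p : Prog) :
    (p.tm κ V l).eval n = p.tm (κ.eval n) (V.eval n) (l.eval n) := by
  induction p <;> simp [Prog.tm, *]

theorem Box.mono {K N N' V : ℕ} {m : Mem} (h : Box K N V m) (hN : N ≤ N') : Box K N' V m :=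
  ⟨fun a ha => ⟨(h.supp a ha).1, (h.supp a ha).2.trans_le hN⟩, h.val⟩

/-- The bound `(n + 2) ^ 16` on all values, as an expression. -/
def valueE : Expr :=
  let sq : Expr → Expr := fun e => e * e
  sq (sq (sq (sq (rd aVert + 2))))

theorem ev_valueE (m : Store) : ev m valueE = (m aVert 0 + 2) ^ 16 := by
  simp [valueE]
  ring

/-- The coloring algorithm. Until `Δ` is known, the indices of cells are kept below `n + 3`. -/
def colorCmd : Cmd :=
  .seq (compile (rd aVert + 3) valueE preludeProg) (compile (rd aSize) valueE mainProg)

/-- The cost of a single step of `colorCmd`, in units of the length of `(n + 2) ^ 16`. -/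
def stepCost : ℕ := preludeProg.kap (rd aVert + 3) valueE + mainProg.kap (rd aSize) valueE

/-- A polynomial bound on the running time of `colorCmd`: a loop makes at most `(n + 2) ^ 16` iterations,
and a pass reads at most `n ^ 2` tokens. -/
noncomputable def timeBound : Polynomial ℕ :=
  let V : Polynomial ℕ := (Polynomial.X + 2) ^ 16
  let κ : Polynomial ℕ := stepCost * V
  preludeProg.tm κ V (Polynomial.X ^ 2) + mainProg.tm κ V (Polynomial.X ^ 2)

/-- The store with which the machine starts. -/
def startStore (n : ℕ) : Store := fun k i => if k = 0 ∧ i = 0 then n else 0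

theorem view_start (n : ℕ) : view (State.start n).mem = startStore n := by
  funext k i
  simp only [view, State.start, startStore, Finsupp.single_apply, Prod.mk.injEq]
  congr 1
  simp [eq_comm]

/-- The environment of the two parts of the program, with the bound `N` on the indices. -/
def env (ts : List (ℕ × ℕ)) (n N : ℕ) : Env := ⟨ts, N, (n + 2) ^ 16⟩

/-- The machine runs the two parts of the program, with the bounds `n + 3` and `N` on the indices, one
after the other within the same resources. -/
theorem exec_colorCmd {ts : List (ℕ × ℕ)} {n N : ℕ} (hts : ∀ t ∈ ts, t.1 < n ∧ t.2 < n)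
    (hlen : ts.length ≤ n ^ 2) (hN : n + 3 ≤ N)
    (hsize : run (env ts n (n + 3)) preludeProg (startStore n) aSize 0 = N) :
    ∃ t : State, Exec ts colorCmd (State.start n) t ∧
      view t.mem = run (env ts n N) mainProg
        (run (env ts n (n + 3)) preludeProg (startStore n)) ∧
      t.passes = np (env ts n (n + 3)) preludeProg (startStore n) +
        np (env ts n N) mainProg (run (env ts n (n + 3)) preludeProg (startStore n)) ∧
      t.time ≤ timeBound.eval n ∧
      t.peak ≤ 39 * N * (Nat.size 39 + Nat.size N + Nat.size ((n + 2) ^ 16)) +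
        stepCost * Nat.size ((n + 2) ^ 16) := by
  set V := (n + 2) ^ 16 with hVdef
  set m₁ := run (env ts n (n + 3)) preludeProg (startStore n) with hm₁
  set κ := stepCost * Nat.size V with hκ
  set Bd := 39 * N * (Nat.size 39 + Nat.size N + Nat.size V) + κ with hBd
  have hnV : n + 2 ≤ V := Nat.le_self_pow (by norm_num) _
  have h₀ : Limits (env ts n (n + 3)) 39 Bd κ := by
    refine ⟨?_, ?_, ?_, ?_⟩
    · simp [env]
    · simp only [env]; omega
    · intro t ht
      have := hts t ht
      simp only [env]; omega
    · simp only [env, hBd]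
      gcongr
      exact Nat.size_le_size hN
  have h₁ : Limits (env ts n N) 39 Bd κ := by
    refine ⟨?_, ?_, ?_, le_rfl⟩
    · simp only [env]; omega
    · simp only [env]; omega
    · intro t ht
      have := hts t ht
      simp only [env]; omega
  obtain ⟨r, hr, -⟩ := h₀.adequate (g := rd aVert + 3) (v := valueE) (W := preludeProg.writes)
    (m₀ := startStore n) (fun m hm => by
      have : m aVert 0 = n := by rw [hm aVert (by decide)]; simp [startStore]
      exact ⟨by simp [this, env], by rw [ev_valueE, this]; rfl⟩)
    (by decide) preludeProg (fun _ h => h) preludeProg_wf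
    (Nat.mul_le_mul_right _ (Nat.le_add_right _ _)) (startStore n) (fun _ _ => rfl) []
  obtain ⟨r', hr', -⟩ := h₁.adequate (g := rd aSize) (v := valueE) (W := mainProg.writes)
    (m₀ := m₁) (fun m hm => by
      have h0 : m aVert 0 = n := by
        rw [hm aVert (by decide), hm₁, run_frame _ _ _ (by decide)]
        simp [startStore]
      have h2 : m aSize 0 = N := by rw [hm aSize (by decide), hsize]
      exact ⟨by simp [h2, env], by rw [ev_valueE, h0]; rfl⟩)
    mainProg_writes_lt mainProg (fun _ h => h) mainProg_wf
    (Nat.mul_le_mul_right _ (Nat.le_add_left _ _)) m₁ (fun _ _ => rfl) r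
  have hbox : Box 39 (n + 3) V (State.start n).mem := by
    constructor
    · intro a ha
      have : a = (0, 0) := by
        by_contra h
        exact ha (Finsupp.single_eq_of_ne h)
      subst this
      simp
    · intro a
      have := congr_fun (congr_fun (view_start n) a.1) a.2
      simp only [view, startStore, Prod.mk.eta] at this
      rw [this]
      split_ifs <;> omega
  have hpeak : (State.start n).peak ≤ Bd := by
    have := (hbox.mono hN).bits_le
    simp only [State.start] at this ⊢
    omega
  obtain ⟨t, ht, tb, tm, tr, tp, tt, tk⟩ := hr (State.start n) hbox (view_start n) rfl hpeak
  obtain ⟨u, hu, -, um, -, up, ut, uk⟩ := hr' t (tb.mono hN) tm tr tk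
  refine ⟨u, .seq ht hu, um, ?_, ?_, uk⟩
  · rw [up, tp]
    simp [State.start]
  · have hκV : κ ≤ stepCost * V :=
      Nat.mul_le_mul_left _ (Nat.size_le.2 Nat.lt_two_pow_self)
    have e : timeBound.eval n =
        preludeProg.tm (stepCost * V) V (n ^ 2) + mainProg.tm (stepCost * V) V (n ^ 2) := by
      simp [timeBound, Prog.eval_tm, hVdef]
    rw [e]
    have t1 := preludeProg.tm_mono hκV (le_refl V) hlen
    have t2 := mainProg.tm_mono hκV (le_refl V) hlen
    have e0 : (State.start n).time = 0 := rfl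
    simp only [env, ← hVdef, e0] at tt ut
    omega

theorem two_pow_size_le (a : ℕ) : 2 ^ Nat.size a ≤ 2 * a + 1 := by
  rcases Nat.eq_zero_or_pos a with rfl | h
  · simp
  · obtain ⟨k, hk⟩ : ∃ k, Nat.size a = k + 1 :=
      ⟨Nat.size a - 1, by have := Nat.size_pos.2 h; omega⟩
    have : 2 ^ k ≤ a := by rw [← Nat.lt_size]; omega
    rw [hk, pow_succ]
    omega

theorem value_lt (n : ℕ) : 2 ^ 8 * (n + 1) ^ 6 < (n + 2) ^ 16 := by
  calc 2 ^ 8 * (n + 1) ^ 6 < (n + 2) ^ 8 * (n + 2) ^ 6 :=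
        Nat.mul_lt_mul_of_le_of_lt (Nat.pow_le_pow_left (by omega) _)
          (Nat.pow_lt_pow_left (by omega) (by norm_num)) (by positivity)
    _ = (n + 2) ^ 14 := by ring
    _ ≤ (n + 2) ^ 16 := Nat.pow_le_pow_right (by omega) (by norm_num)

theorem sq_lt_value (n : ℕ) : 2 ^ 8 * ((n + 1) * (n + 1)) < (n + 2) ^ 16 := by
  refine lt_of_le_of_lt (Nat.mul_le_mul_left _ ?_) (value_lt n)
  rw [← sq]
  exact Nat.pow_le_pow_right (by omega) (by norm_num)

theorem IsEdgeStream.sizes {n : ℕ} {G : SimpleGraph (Fin n)} [DecidableRel G.Adj]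
    {es : List (Fin n × Fin n)} (h : IsEdgeStream G es) {ℓ N p : ℕ} (hℓ : Nat.size G.maxDegree = ℓ)
    (hp : p.Prime) (hlp : 4 * (n + 1) * (ℓ + 1) < p) (hpℓ : p ≤ 8 * (n + 1) * (ℓ + 1))
    (hpN : p ≤ N) : Sizes (env (tokens es) n N) n G.maxDegree ℓ p := by
  have hΔn := maxDegree_le_card G
  have hℓn : ℓ ≤ n := hℓ ▸ (Nat.size_le.2 Nat.lt_two_pow_self).trans hΔn
  have hV := value_lt n
  have hsq := sq_lt_value n
  have hpn : p ≤ 8 * ((n + 1) * (n + 1)) := by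
    refine hpℓ.trans ?_
    rw [mul_assoc]
    exact Nat.mul_le_mul_left _ (Nat.mul_le_mul_left _ (by omega))
  have hnn : n + 1 ≤ (n + 1) * (n + 1) := Nat.le_mul_self _
  refine ⟨h.isDartSet, h.nodup_darts, hp, hlp, hℓ ▸ Nat.lt_size_self _, hΔn, hpN, ?_, ?_, ?_, ?_⟩
  · calc n * n * (p * p)
        ≤ (n + 1) * (n + 1) * ((8 * ((n + 1) * (n + 1))) * (8 * ((n + 1) * (n + 1)))) := by
          gcongr <;> omega
      _ = 2 ^ 6 * (n + 1) ^ 6 := by ring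
      _ < (n + 2) ^ 16 := by omega
  · change p < (n + 2) ^ 16
    omega
  · have := two_pow_size_le G.maxDegree
    rw [hℓ] at this
    have h2 : 2 ^ ℓ ≤ 2 * (n + 1) := by omega
    calc 2 ^ (2 * ℓ) = 2 ^ ℓ * 2 ^ ℓ := by rw [two_mul, pow_add]
      _ ≤ (2 * (n + 1)) * (2 * (n + 1)) := Nat.mul_le_mul h2 h2
      _ = 4 * ((n + 1) * (n + 1)) := by ring
      _ < (n + 2) ^ 16 := by omega
  · intro t ht
    have := tokens_lt t ht
    change t.1 < (n + 2) ^ 16 ∧ t.2 < (n + 2) ^ 16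
    omega

theorem IsEdgeStream.run_preludeProg {n : ℕ} {G : SimpleGraph (Fin n)} [DecidableRel G.Adj]
    {es : List (Fin n × Fin n)} (h : IsEdgeStream G es) {E : Env}
    (hE : E = env (tokens es) n (n + 3)) {m : Store}
    (hm : m = run E preludeProg (startStore n)) :
    m aVert 0 = n ∧ m aMax 0 = G.maxDegree ∧ m aLog 0 = Nat.size G.maxDegree ∧
      m aSize 0 = 8 * (n + 1) * (Nat.size G.maxDegree + 1) + 3 ∧ (∀ v, m aDone v = 0) ∧
      ∀ k i, m k i < E.V := by
  have hsq := sq_lt_value n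
  have hnn : n + 1 ≤ (n + 1) * (n + 1) := Nat.le_mul_self _
  have hV : E.V = (n + 2) ^ 16 := by rw [hE]; rfl
  have hin : E.input = tokens es := by rw [hE]; rfl
  obtain ⟨p1, p2, p3⟩ := Streaming.run_preludeProg (E := E) (n := n) (m := startStore n)
    (by simp [startStore]) (fun k hk i => by simp [startStore, hk])
    (fun d hd => by
      rw [hin] at hd
      obtain ⟨u, v, hu, -, -⟩ := h.mem_darts.1 hd
      omega) (by rw [hE]; simp [env]) (by rw [hV, mul_assoc]; omega)
    (h.sup_outDeg hin) (maxDegree_le_card G)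
  rw [← hm] at p1 p2 p3
  refine ⟨?_, p1, p2, p3, fun v => ?_, ?_⟩
  · rw [hm, run_frame _ _ _ (by decide)]
    simp [startStore]
  · rw [hm, run_frame _ _ _ (by decide)]
    simp [startStore]
  · rw [hm]
    refine run_lt (by omega) (fun t ht => ?_) preludeProg fun k i => ?_
    · rw [hin] at ht
      have := tokens_lt t ht
      omega
    · simp only [startStore]
      split_ifs <;> omega

/-- The colors that `mainProg` leaves in the array `1` form a proper coloring. -/
theorem IsEdgeStream.run_mainProg {n : ℕ} {G : SimpleGraph (Fin n)} [DecidableRel G.Adj]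
    {es : List (Fin n × Fin n)} (h : IsEdgeStream G es) {E : Env} {N ℓ : ℕ} {m : Store}
    (hE : E = env (tokens es) n N) (hℓ : Nat.size G.maxDegree = ℓ)
    (hN : N = 8 * (n + 1) * (ℓ + 1) + 3) (hvert : m aVert 0 = n) (hmax : m aMax 0 = G.maxDegree)
    (hlog : m aLog 0 = ℓ) (hdone : ∀ v, m aDone v = 0) (hlt : ∀ k i, m k i < E.V) :
    (∃ χ : G.Coloring (Fin (G.maxDegree + 1)), ∀ v : Fin n, run E mainProg m aCol v = χ v) ∧
      np E mainProg m ≤ ∑ j ∈ range ℓ, 3 * (3 * (ℓ / (ℓ - j) + 1) + 1) + 1 := by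
  have hℓn : ℓ ≤ n := hℓ ▸ (Nat.size_le.2 Nat.lt_two_pow_self).trans (maxDegree_le_card G)
  have hsq := sq_lt_value n
  have hnn : n + 1 ≤ (n + 1) * (n + 1) := Nat.le_mul_self _
  have hℓ2 : (n + 1) * (ℓ + 1) ≤ (n + 1) * (n + 1) := Nat.mul_le_mul_left _ (by omega)
  have hV : E.V = (n + 2) ^ 16 := by rw [hE]; rfl
  have hin : E.input = tokens es := by rw [hE]; rfl
  obtain ⟨q1, q2, q3⟩ := run_primeProg (E := E) (m := m) hvert hlog (by rw [hV, mul_assoc]; omega)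
  have hS := h.sizes hℓ q1 q2 q3 (N := N) (by omega)
  rw [← hE] at hS
  obtain ⟨c1, c2⟩ := Streaming.run_mainProg hS hvert hmax hlog hlt hdone
  have hcol : ∀ v : Fin n, run E mainProg m aDone v ≠ 0 := fun v hv => by
    have : (v : ℕ) ∈ undone n (run E mainProg m) := mem_undone.2 ⟨v.2, hv⟩
    rw [c2] at this
    exact absurd this (notMem_empty _)
  rw [hin] at c1
  refine ⟨⟨SimpleGraph.Coloring.mk
    (fun v => ⟨run E mainProg m aCol v, Nat.lt_succ_of_le (c1.le v v.2 (hcol v))⟩) ?_, ?_⟩,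
    np_mainProg_le hlog (by omega)⟩
  · intro u v huv heq
    exact c1.ne (u, v) (List.mem_toFinset.2 (h.mem_darts.2 ⟨u, v, rfl, rfl, huv⟩)) (hcol u)
      (hcol v) (Fin.mk.inj heq)
  · exact fun v => rfl

/-- The algorithm is correct, with explicit bounds on its resources. -/
theorem IsEdgeStream.exec_colorCmd {n : ℕ} {G : SimpleGraph (Fin n)} [DecidableRel G.Adj]
    {es : List (Fin n × Fin n)} (h : IsEdgeStream G es) {ℓ : ℕ} (hℓ : Nat.size G.maxDegree = ℓ) :
    ∃ t : State, Exec (tokens es) colorCmd (State.start n) t ∧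
      (∃ χ : G.Coloring (Fin (G.maxDegree + 1)), ∀ v : Fin n, t.mem (1, (v : ℕ)) = χ v) ∧
      t.peak ≤ (200000 + 100 * stepCost) * (n * Nat.size n ^ 2 + 1) ∧
      t.passes ≤ 1 + (∑ j ∈ range ℓ, 3 * (3 * (ℓ / (ℓ - j) + 1) + 1) + 1) ∧
      t.time ≤ timeBound.eval n := by
  obtain ⟨p1, p2, p3, p4, p5, p6⟩ := h.run_preludeProg rfl rfl
  rw [hℓ] at p3 p4
  obtain ⟨t, ht, tv, tp, tt, tk⟩ := Streaming.exec_colorCmd tokens_lt h.length_le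
    (by nlinarith [Nat.zero_le (n * ℓ)]) p4
  obtain ⟨⟨χ, hχ⟩, hnp⟩ := h.run_mainProg rfl hℓ rfl p1 p2 p3 p5 p6
  refine ⟨t, ht, ⟨χ, fun v => ?_⟩,
    tk.trans (peak_le n ℓ stepCost (hℓ ▸ Nat.size_le_size (maxDegree_le_card G))), ?_, tt⟩
  · rw [← hχ, ← tv]
    rfl
  · rw [tp, np_preludeProg]
    exact Nat.add_le_add_left hnp 1

end

end Streaming

theorem theorem1 :
    ∃ (prog : Streaming.Cmd) (C : ℝ) (T : Polynomial ℕ),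
      ∀ (n : ℕ) (G : SimpleGraph (Fin n)) [DecidableRel G.Adj] (es : List (Fin n × Fin n)),
        Streaming.IsEdgeStream G es →
          ∃ t : Streaming.State,
            Streaming.Exec (Streaming.tokens es) prog (Streaming.State.start n) t ∧
            (∃ χ : G.Coloring (Fin (G.maxDegree + 1)), ∀ v : Fin n, t.mem (1, (v : ℕ)) = χ v) ∧
            (t.peak : ℝ) ≤ C * (n * Real.logb 2 n ^ 2 + 1) ∧
            (t.passes : ℝ) ≤
              C * (Real.logb 2 G.maxDegree * Real.logb 2 (Real.logb 2 G.maxDegree) + 1) ∧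
            t.time ≤ T.eval n := by
  set C : ℕ := 4 * (200000 + 100 * Streaming.stepCost) with hC
  refine ⟨Streaming.colorCmd, C, Streaming.timeBound, fun n G _ es h => ?_⟩
  obtain ⟨t, ht, hχ, hpeak, hpasses, htime⟩ := h.exec_colorCmd rfl
  refine ⟨t, ht, hχ, ?_, ?_, htime⟩
  · exact (Nat.cast_le.2 hpeak).trans (Streaming.peak_le_logb n _)
  · have h1 := (Nat.cast_le (α := ℝ).2 hpasses).trans (Streaming.passes_le G.maxDegree)
    have h2 : (138 : ℝ) ≤ C := by
      rw [hC]
      exact_mod_cast (by omega : 138 ≤ 4 * (200000 + 100 * Streaming.stepCost))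
    -- The bound on the passes is nonnegative, so that `138` may be replaced by `C`.
    refine h1.trans (mul_le_mul_of_nonneg_right h2 ?_)
    have h0 := (Nat.cast_nonneg (α := ℝ) _).trans (Streaming.passes_le G.maxDegree)
    linarith
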